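/- **Setting.** Let $\mathcal V=(V,\leq,\otimes,k)$ be a commutative unital quantale (a complete lattice with a commutative monoid structure whose multiplication preserves arbitrary joins in each argument) which is *integral*, i.e. $k=\top$. Write $y\ll x$ ($y$ is way below $x$) if whenever $x\le\bigvee X$ there is a finite $A\subseteq X$ with $y\le\bigvee A$. Assume that the lattice $V$ is continuous ($x=\bigvee\{y\mid y\ll x\}$ for all $x$), and let $B\subseteq V$ be a basis (for every $x$ the set $\{y\in B\mid y\ll x\}$ is directed with join $x$) that is closed under finite joins (including the empty one) and under $\otimes$, and contains $k$. **Syntax.** Given a class $G$ of ground types, types are generated by $A::=X\in G\mid I\mid A\otimes A\mid A\multimap A$. A signature consists of $G$ and a class of operation symbols $f:A_1,\dots,A_n\to A$ with $n\ge 1$. Typing contexts $\Gamma$ are finite lists of typed variables in which each variable occurs at most once, and a shuffle of $\Gamma_1;\dots;\Gamma_n$ is a permutation of $\Gamma_1,\dots,\Gamma_n$ preserving the relative order inside each $\Gamma_i$. Terms (up to renaming of bound variables) and judgements $\Gamma\rhd v:A$ of linear $\lambda$-calculus are generated by the following rules, where $E$ is a shuffle of the contexts of the premises (of $\Gamma;\Delta$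 in the rule for $\mathsf{pm}$): * $x:A\rhd x:A$; $\ -\rhd *:I$; if $\Gamma_i\rhd v_i:A_i$ then $E\rhd f(v_1,\dots,v_n):A$; * if $\Gamma\rhd v:I$ and $\Delta\rhd w:A$ then $E\rhd v\ \mathsf{to}\ *.\,w:A$; * if $\Gamma\rhd v:A$ and $\Delta\rhd w:B$ then $E\rhd v\otimes w:A\otimes B$; * if $\Gamma\rhd v:A\otimes B$ and $\Delta,x:A,y:B\rhd w:C$ then $E\rhd \mathsf{pm}\ v\ \mathsf{to}\ x\otimes y.\,w:C$; * if $\Gamma,x:A\rhd v:B$ then $\Gamma\rhd\lambda x:A.\,v:A\multimap B$; if $\Gamma\rhd v:A\multimap B$ and $\Delta\rhd w:A$ then $E\rhd v\,w:B$. Each judgement has a unique derivation. **Theories.** A $\mathcal V$-equation-in-context $\Gamma\rhd v=_q w:A$ consists of $q\in B$ and judgements $\Gamma\rhd v:A$, $\Gamma\rhd w:A$. A linear $\mathcal V\lambda$-theory $T$ is a signature with a class $Ax$ of $\mathcal V$-equations-in-context (the axioms). Its theorems form the smallest class of $\mathcal V$-equations-in-context that contains $Ax$, contains $v=_\top w$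 and $w=_\top v$ for all well-typed instances $v=w$ of $$\mathsf{pm}\ v\otimes w\ \mathsf{to}\ x\otimes y.\,u=u[v/x,w/y],\qquad \mathsf{pm}\ v\ \mathsf{to}\ x\otimes y.\,u[x\otimes y/z]=u[v/z],$$ $$*\ \mathsf{to}\ *.\,v=v,\qquad v\ \mathsf{to}\ *.\,w[*/z]=w[v/z],\qquad (\lambda x:A.\,v)\,w=v[w/x],\qquad \lambda x:A.\,(v\,x)=v,$$ $$u[v\ \mathsf{to}\ *.\,w/z]=v\ \mathsf{to}\ *.\,u[w/z],\qquad u[\mathsf{pm}\ v\ \mathsf{to}\ x\otimes y.\,w/z]=\mathsf{pm}\ v\ \mathsf{to}\ x\otimes y.\,u[w/z],$$ and is closed under the following rules (all labels in $B$): * (refl) $v=_\top v$; (trans) $v=_q w$ and $w=_r u$ give $v=_{q\otimes r}u$; (weak) $v=_q w$ and $r\le q$ give $v=_r w$; (arch) if $v=_r w$ for all $r\in B$ with $r\ll q$, then $v=_q w$; (join) if $v=_{q_i}w$ for all $i\le n$ (with $n\ge 0$), then $v=_{\bigvee q_i}w$; * compatibility: if $v_i=_{q_i}w_i$ for all $i\le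 n$ then $f(v_1,\dots,v_n)=_{\bigotimes q_i}f(w_1,\dots,w_n)$; if $v=_q w$ and $v'=_r w'$ then $v\otimes v'=_{q\otimes r}w\otimes w'$, $\ \mathsf{pm}\ v\ \mathsf{to}\ x\otimes y.\,v'=_{q\otimes r}\mathsf{pm}\ w\ \mathsf{to}\ x\otimes y.\,w'$, $\ v\ \mathsf{to}\ *.\,v'=_{q\otimes r}w\ \mathsf{to}\ *.\,w'$ and $v\,v'=_{q\otimes r}w\,w'$; if $v=_q w$ then $\lambda x:A.\,v=_q\lambda x:A.\,w$; * exchange: $\Gamma\rhd v=_q w:A$ gives $\Delta\rhd v=_q w:A$ for every permutation $\Delta$ of $\Gamma$; substitution: $\Gamma,x:A\rhd v=_q w:B$ and $\Delta\rhd v'=_r w':A$ give $\Gamma,\Delta\rhd v[v'/x]=_{q\otimes r}w[w'/x]:B$. For types $A,B'$, put $a(v,w)=\bigvee\{q\mid x:A\rhd v=_q w:B'\text{ is a theorem}\}$ on the class of terms $v$ with $x:A\rhd v:B'$. The theory is *varietal* if, for all $A,B'$, the quotient of this class by the relation "$k\le a(v,w)$ and $k\le a(w,v)$" is a small set. **Models.**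 A $\mathcal V$-category is a set $X$ with $a:X\times X\to V$ such that $k\le a(x,x)$ and $a(x,y)\otimes a(y,z)\le a(x,z)$; it is separated if $k\le a(x,y)$ and $k\le a(y,x)$ imply $x=y$. A $\mathcal V$-functor $(X,a)\to(Y,b)$ is a map $h$ with $a(x,y)\le b(h(x),h(y))$, and $(X,a)\otimes(Y,b)$ is $X\times Y$ with $((x,y),(x',y'))\mapsto a(x,x')\otimes b(y,y')$. A $\mathcal V\text{-}\mathsf{Cat}_{\mathsf{sep}}$-enriched autonomous category is a locally small symmetric monoidal closed category $\mathsf C$ whose hom-sets are separated $\mathcal V$-categories such that composition $\mathsf C(X,Y)\otimes\mathsf C(Y,Z)\to\mathsf C(X,Z)$, the action of $\otimes$ on morphisms and the action of $X\multimap-$ on morphisms are $\mathcal V$-functors, and the bijections $\mathsf C(Y\otimes X,Z)\simeq\mathsf C(Y,X\multimap Z)$ are isomorphisms of $\mathcal V$-categories. An interpretation in $\mathsf C$ assigns an object to each ground type and a morphism $[\![A_1]\!]\otimes\dots\otimes[\![A_n]\!]\to[\![A]\!]$ to each operation symbol; it extends in the standard way to types, contexts ($[\![x_1:A_1,\dots,x_n:A_n]\!]=[\![A_1]\!]\otimes\dots\otimes[\![A_n]\!]$,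 the unit object for $n=0$) and judgements, $[\![\Gamma\rhd v:A]\!]:[\![\Gamma]\!]\to[\![A]\!]$. It satisfies $\Gamma\rhd v=_q w:A$ if $a([\![\Gamma\rhd v:A]\!],[\![\Gamma\rhd w:A]\!])\ge q$, and it is a model of $T$ if it satisfies all axioms of $T$. **Theorem (Soundness and completeness).** Let $T$ be a varietal linear $\mathcal V\lambda$-theory. A $\mathcal V$-equation-in-context $\Gamma\rhd v=_q w:A$ (with $q\in B$) is a theorem of $T$ if and only if it is satisfied by all models of $T$ in all $\mathcal V\text{-}\mathsf{Cat}_{\mathsf{sep}}$-enriched autonomous categories. -/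

import Mathlib

open CategoryTheory MonoidalCategory

universe w u u₂ u' v

/-! ## Quantales, bases, and generalised metric spaces -/

/-- `y` is way below `x` in a complete lattice. -/
def WayBelow {L : Type w} [CompleteLattice L] (y x : L) : Prop :=
  ∀ X : Set L, x ≤ sSup X → ∃ A : Set L, A ⊆ X ∧ A.Finite ∧ y ≤ sSup A

/-- A complete lattice is continuous if every element is the join of the elements way below it. -/
def IsContinuousLattice (L : Type w) [CompleteLattice L] : Prop :=
  ∀ x : L, IsLUB {y | WayBelow y x} x

/-- `B` is a basis of `L`: for every `x`, the elements of `B` way below `x` form a directed set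
with least upper bound `x`. -/
def IsLatticeBasis {L : Type w} [CompleteLattice L] (B : Set L) : Prop :=
  ∀ x : L, (B ∩ {y | WayBelow y x}).Nonempty ∧
    DirectedOn (· ≤ ·) (B ∩ {y | WayBelow y x}) ∧ IsLUB (B ∩ {y | WayBelow y x}) x

/-- The standing assumptions on the commutative unital quantale `V` (multiplication `*`, unit `1`)
and on the set `B` of labels. -/
structure IsLabelBasis {V : Type w} [CommMonoid V] [CompleteLattice V] [IsQuantale V]
    (B : Set V) : Prop where
  /-- `V` is integral -/
  integral : (1 : V) = ⊤
  /-- the underlying lattice is continuous -/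
  continuous : IsContinuousLattice V
  basis : IsLatticeBasis B
  /-- closure under finite joins, the empty one included -/
  sSup_mem : ∀ s : Set V, s.Finite → s ⊆ B → sSup s ∈ B
  mul_mem : ∀ q ∈ B, ∀ r ∈ B, q * r ∈ B
  one_mem : (1 : V) ∈ B

/-- `a` makes `X` a `V`-category. -/
structure IsVCat {V : Type w} [CommMonoid V] [CompleteLattice V] {X : Type*}
    (a : X → X → V) : Prop where
  refl : ∀ x, 1 ≤ a x x
  trans : ∀ x y z, a x y * a y z ≤ a x z

/-- The `V`-category `(X, a)` is separated: its natural order is antisymmetric. -/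
def IsVSeparated {V : Type w} [CommMonoid V] [CompleteLattice V] {X : Type*}
    (a : X → X → V) : Prop :=
  ∀ x y, 1 ≤ a x y → 1 ≤ a y x → x = y

/-- `f : (X, a) → (Y, b)` is a `V`-functor. -/
def IsVFunctor {V : Type w} [CompleteLattice V] {X Y : Type*}
    (a : X → X → V) (b : Y → Y → V) (f : X → Y) : Prop :=
  ∀ x y, a x y ≤ b (f x) (f y)

/-- The tensor product of `V`-categories. -/
def vTensor {V : Type w} [CommMonoid V] {X Y : Type*}
    (a : X → X → V) (b : Y → Y → V) : X × Y → X × Y → V :=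
  fun p p' => a p.1 p'.1 * b p.2 p'.2

/-- Enrichment of a (locally small) category over separated `V`-categories. -/
class VCatSepEnriched (V : Type w) [CommMonoid V] [CompleteLattice V]
    (C : Type u) [Category.{v} C] where
  dist : ∀ {X Y : C}, (X ⟶ Y) → (X ⟶ Y) → V
  isVCat : ∀ X Y : C, IsVCat (dist (X := X) (Y := Y))
  separated : ∀ X Y : C, IsVSeparated (dist (X := X) (Y := Y))
  comp_vfunctor : ∀ X Y Z : C, IsVFunctor
    (vTensor (dist (X := X) (Y := Y)) (dist (X := Y) (Y := Z))) (dist (X := X) (Y := Z))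
    (fun p => p.1 ≫ p.2)

/-- A symmetric monoidal closed category enriched over separated `V`-categories:
the tensor is an enriched bifunctor, and the adjunction between tensoring with `X` and the
internal hom out of `X` is enriched (`ihom X` is a `V`-functor on homs and the hom-bijection is an
isomorphism of `V`-categories; tensoring with `X` is a `V`-functor by `tensor_vfunctor`). -/
class VCatSepAutonomous (V : Type w) [CommMonoid V] [CompleteLattice V]
    (C : Type u) [Category.{v} C] [MonoidalCategory C] [SymmetricCategory C] [MonoidalClosed C]
    extends VCatSepEnriched V C where
  tensor_vfunctor : ∀ X X' Y Y' : C, IsVFunctor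
    (vTensor (dist (X := X) (Y := X')) (dist (X := Y) (Y := Y')))
    (dist (X := X ⊗ Y) (Y := X' ⊗ Y')) (fun p => p.1 ⊗ₘ p.2)
  ihom_vfunctor : ∀ X Y Z : C, IsVFunctor (dist (X := Y) (Y := Z))
    (dist (X := (ihom X).obj Y) (Y := (ihom X).obj Z)) (fun f => (ihom X).map f)
  curry_vfunctor : ∀ X Y Z : C, IsVFunctor (dist (X := X ⊗ Y) (Y := Z))
    (dist (X := Y) (Y := (ihom X).obj Z)) MonoidalClosed.curry
  uncurry_vfunctor : ∀ X Y Z : C, IsVFunctor (dist (X := Y) (Y := (ihom X).obj Z))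
    (dist (X := X ⊗ Y) (Y := Z)) MonoidalClosed.uncurry

/-! ## Types and terms of linear lambda-calculus

All sequences (typing contexts, domains of operation symbols, argument lists) grow to the right in
the usual notation and are represented by lists whose HEAD is the RIGHTMOST entry, so that
`A :: Γ` stands for `Γ, A` and `Δ ++ Γ` for `Γ, Δ`. -/

/-- Types over a class `G` of ground types. -/
inductive LTy (G : Type u) : Type u
  | ground (X : G) : LTy G
  | unit : LTy G
  | tensor (A B : LTy G) : LTy G
  | lolli (A B : LTy G) : LTy G

/-- Ground types and sorted operation symbols `f : A₁, …, Aₙ → A` with `n ≥ 1`. -/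
structure LSig where
  G : Type u
  Op : Type u₂
  dom : Op → List (LTy G)
  cod : Op → LTy G
  dom_ne_nil : ∀ f, dom f ≠ []

/- Terms up to renaming of bound variables, in de Bruijn style.  Variables are natural numbers.
`lam A v` binds the variable `0` of `v`, and `pm v w` is `pm v to x ⊗ y. w` with `x`, `y` the
variables `1`, `0` of `w`; the other variables are shifted by `1` (resp. `2`) below the binder. -/
mutual
/-- Terms. -/
inductive LTm (S : LSig.{u, u₂}) : Type (max u u₂)
  | var (x : ℕ) : LTm S
  | op (f : S.Op) (as : LArgs S) : LTm S
  | star : LTm S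
  | letStar (v w : LTm S) : LTm S
  | pair (v w : LTm S) : LTm S
  | pm (v w : LTm S) : LTm S
  | lam (A : LTy S.G) (v : LTm S) : LTm S
  | app (v w : LTm S) : LTm S
/-- Argument lists of operation symbols. -/
inductive LArgs (S : LSig.{u, u₂}) : Type (max u u₂)
  | nil : LArgs S
  | snoc (as : LArgs S) (v : LTm S) : LArgs S
end

/-- Extension of a renaming below one binder. -/
def upRen (ρ : ℕ → ℕ) : ℕ → ℕ
  | 0 => 0
  | n + 1 => ρ n + 1

mutual
/-- Renaming of free variables. -/
def LTm.rename {S : LSig.{u, u₂}} : LTm S → (ℕ → ℕ) → LTm S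
  | .var x, ρ => .var (ρ x)
  | .op f as, ρ => .op f (as.rename ρ)
  | .star, _ => .star
  | .letStar v w, ρ => .letStar (v.rename ρ) (w.rename ρ)
  | .pair v w, ρ => .pair (v.rename ρ) (w.rename ρ)
  | .pm v w, ρ => .pm (v.rename ρ) (w.rename (upRen (upRen ρ)))
  | .lam A v, ρ => .lam A (v.rename (upRen ρ))
  | .app v w, ρ => .app (v.rename ρ) (w.rename ρ)
/-- Renaming of free variables. -/
def LArgs.rename {S : LSig.{u, u₂}} : LArgs S → (ℕ → ℕ) → LArgs S
  | .nil, _ => .nil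
  | .snoc as v, ρ => .snoc (as.rename ρ) (v.rename ρ)
end

/-- Extension of a simultaneous substitution below one binder. -/
def upSubst {S : LSig.{u, u₂}} (σ : ℕ → LTm S) : ℕ → LTm S
  | 0 => .var 0
  | n + 1 => (σ n).rename (· + 1)

mutual
/-- Simultaneous capture-avoiding substitution. -/
def LTm.subst {S : LSig.{u, u₂}} : LTm S → (ℕ → LTm S) → LTm S
  | .var x, σ => σ x
  | .op f as, σ => .op f (as.subst σ)
  | .star, _ => .star
  | .letStar v w, σ => .letStar (v.subst σ) (w.subst σ)
  | .pair v w, σ => .pair (v.subst σ) (w.subst σ)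
  | .pm v w, σ => .pm (v.subst σ) (w.subst (upSubst (upSubst σ)))
  | .lam A v, σ => .lam A (v.subst (upSubst σ))
  | .app v w, σ => .app (v.subst σ) (w.subst σ)
/-- Simultaneous capture-avoiding substitution. -/
def LArgs.subst {S : LSig.{u, u₂}} : LArgs S → (ℕ → LTm S) → LArgs S
  | .nil, _ => .nil
  | .snoc as v, σ => .snoc (as.subst σ) (v.subst σ)
end

/-- `v[w/x]` for a free variable `x`. -/
def LTm.sub {S : LSig.{u, u₂}} (v : LTm S) (x : ℕ) (w : LTm S) : LTm S :=
  v.subst (Function.update LTm.var x w)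

/-- The substitution `0 ↦ w`, `n + 1 ↦ n`. -/
def instSubst {S : LSig.{u, u₂}} (w : LTm S) : ℕ → LTm S
  | 0 => w
  | n + 1 => .var n

/-- The substitution `0 ↦ w`, `1 ↦ v`, `n + 2 ↦ n`. -/
def instSubst₂ {S : LSig.{u, u₂}} (v w : LTm S) : ℕ → LTm S
  | 0 => w
  | 1 => v
  | n + 2 => .var n

/-- `v[w/x]` where `x` is the variable bound by a `lam` with body `v`. -/
def LTm.inst {S : LSig.{u, u₂}} (v w : LTm S) : LTm S := v.subst (instSubst w)

/-- `u[v/x, w/y]` where `x`, `y` are the variables bound by a `pm` with body `u`. -/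
def LTm.inst₂ {S : LSig.{u, u₂}} (u v w : LTm S) : LTm S := u.subst (instSubst₂ v w)

/-! ## Typing -/

/-- Sequences of typed variables. -/
abbrev LCtx (S : LSig.{u, u₂}) : Type u := List (ℕ × LTy S.G)

/-- Each variable occurs at most once. -/
def LCtx.Distinct {S : LSig.{u, u₂}} (Γ : LCtx S) : Prop := (Γ.map Prod.fst).Nodup

/-- The context `Γ` seen from below `n` binders. -/
def LCtx.shift {S : LSig.{u, u₂}} (n : ℕ) (Γ : LCtx S) : LCtx S :=
  Γ.map (fun p => (p.1 + n, p.2))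

/-- `Γ, x : A` as the context of the body of a `lam`. -/
def LCtx.bind {S : LSig.{u, u₂}} (Γ : LCtx S) (A : LTy S.G) : LCtx S :=
  (0, A) :: Γ.shift 1

/-- `Γ, x : A, y : B` as the context of the body of a `pm`. -/
def LCtx.bind₂ {S : LSig.{u, u₂}} (Γ : LCtx S) (A B : LTy S.G) : LCtx S :=
  (0, B) :: (1, A) :: Γ.shift 2

/-- `Shuffle Γ Δ E`: ways in which `E` is a shuffle of `Γ` and `Δ`.  (When the entries of `E` are
distinct there is at most one.)  Shuffles of `n` sequences are iterated binary shuffles. -/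
inductive Shuffle {α : Type u} : List α → List α → List α → Type u
  | nil : Shuffle [] [] []
  | left (a : α) {Γ Δ E : List α} (s : Shuffle Γ Δ E) : Shuffle (a :: Γ) Δ (a :: E)
  | right (a : α) {Γ Δ E : List α} (s : Shuffle Γ Δ E) : Shuffle Γ (a :: Δ) (a :: E)

mutual
/-- Derivations of judgements `Γ ▷ v : A`. -/
inductive LDer (S : LSig.{u, u₂}) : LCtx S → LTm S → LTy S.G → Type (max u u₂)
  | ax (f : S.Op) {E : LCtx S} {as : LArgs S} (d : LDerArgs S E as (S.dom f)) :
      LDer S E (.op f as) (S.cod f)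
  | hyp (x : ℕ) (A : LTy S.G) : LDer S [(x, A)] (.var x) A
  | unitI : LDer S [] .star .unit
  | unitE {Γ Δ E : LCtx S} {v w : LTm S} {A : LTy S.G}
      (d : LDer S Γ v .unit) (e : LDer S Δ w A) (s : Shuffle Γ Δ E) :
      LDer S E (.letStar v w) A
  | tensorI {Γ Δ E : LCtx S} {v w : LTm S} {A B : LTy S.G}
      (d : LDer S Γ v A) (e : LDer S Δ w B) (s : Shuffle Γ Δ E) :
      LDer S E (.pair v w) (.tensor A B)
  | tensorE {Γ Δ E : LCtx S} {v w : LTm S} {A B D : LTy S.G}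
      (d : LDer S Γ v (.tensor A B)) (e : LDer S (Δ.bind₂ A B) w D) (s : Shuffle Γ Δ E) :
      LDer S E (.pm v w) D
  | lolliI {Γ : LCtx S} {v : LTm S} {A B : LTy S.G} (d : LDer S (Γ.bind A) v B) :
      LDer S Γ (.lam A v) (.lolli A B)
  | lolliE {Γ Δ E : LCtx S} {v w : LTm S} {A B : LTy S.G}
      (d : LDer S Γ v (.lolli A B)) (e : LDer S Δ w A) (s : Shuffle Γ Δ E) :
      LDer S E (.app v w) B
/-- Derivations of the typing of an argument list `v₁, …, vₙ` against `A₁, …, Aₙ`. -/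
inductive LDerArgs (S : LSig.{u, u₂}) : LCtx S → LArgs S → List (LTy S.G) → Type (max u u₂)
  | nil : LDerArgs S [] .nil []
  | snoc {Γ Δ E : LCtx S} {as : LArgs S} {v : LTm S} {As : List (LTy S.G)} {A : LTy S.G}
      (d : LDerArgs S Γ as As) (e : LDer S Δ v A) (s : Shuffle Γ Δ E) :
      LDerArgs S E (.snoc as v) (A :: As)
end

/-- The judgement `Γ ▷ v : A` (over a genuine typing context) is derivable. -/
def HasTy {S : LSig.{u, u₂}} (Γ : LCtx S) (v : LTm S) (A : LTy S.G) : Prop :=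
  Γ.Distinct ∧ Nonempty (LDer S Γ v A)

/-! ## `V`-equations, theories and their theorems -/

/-- Raw `V`-equations-in-context `Γ ▷ v =_q w : A`. -/
structure VEqn (V : Type w) (S : LSig.{u, u₂}) where
  ctx : LCtx S
  lhs : LTm S
  rhs : LTm S
  label : V
  ty : LTy S.G

/-- `V`-equations-in-context: both sides are well typed and the label lies in `B`. -/
def VEqn.WellFormed {V : Type w} {S : LSig.{u, u₂}} (B : Set V) (e : VEqn V S) : Prop :=
  e.label ∈ B ∧ HasTy e.ctx e.lhs e.ty ∧ HasTy e.ctx e.rhs e.ty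

/-- Linear `Vλ`-theories with labels in `B`. -/
structure VTheory (V : Type w) (B : Set V) where
  sig : LSig.{u, u₂}
  Ax : Set (VEqn V sig)
  wellFormed : ∀ e ∈ Ax, e.WellFormed B

/-- The (ordinary) equations-in-context that correspond to the axiomatics of autonomous
categories. -/
inductive AutEqn {S : LSig.{u, u₂}} : LCtx S → LTm S → LTm S → LTy S.G → Prop
  /-- `pm v ⊗ w to x ⊗ y. t = t[v/x, w/y]` -/
  | tensor_beta {Γ Δ Θ E : LCtx S} {v w t : LTm S} {A B D : LTy S.G}
      (hv : HasTy Γ v A) (hw : HasTy Δ w B) (ht : HasTy (Θ.bind₂ A B) t D)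
      (hE : E.Distinct) (p : E.Perm (Γ ++ Δ ++ Θ)) :
      AutEqn E (.pm (.pair v w) t) (t.inst₂ v w) D
  /-- `pm v to x ⊗ y. t[x ⊗ y/z] = t[v/z]` -/
  | tensor_eta {Γ Δ E : LCtx S} {v t : LTm S} {z : ℕ} {A B D : LTy S.G}
      (hv : HasTy Γ v (.tensor A B)) (ht : HasTy ((z, .tensor A B) :: Δ) t D)
      (hE : E.Distinct) (p : E.Perm (Γ ++ Δ)) :
      AutEqn E (.pm v ((t.rename (· + 2)).sub (z + 2) (.pair (.var 1) (.var 0)))) (t.sub z v) D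
  /-- `* to *. v = v` -/
  | unit_beta {Γ : LCtx S} {v : LTm S} {A : LTy S.G} (hv : HasTy Γ v A) :
      AutEqn Γ (.letStar .star v) v A
  /-- `v to *. w[*/z] = w[v/z]` -/
  | unit_eta {Γ Δ E : LCtx S} {v t : LTm S} {z : ℕ} {A : LTy S.G}
      (hv : HasTy Γ v .unit) (ht : HasTy ((z, .unit) :: Δ) t A)
      (hE : E.Distinct) (p : E.Perm (Γ ++ Δ)) :
      AutEqn E (.letStar v (t.sub z .star)) (t.sub z v) A
  /-- `(λ x : A. v) w = v[w/x]` -/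
  | lolli_beta {Γ Δ E : LCtx S} {v t : LTm S} {A B : LTy S.G}
      (hv : HasTy (Γ.bind A) v B) (ht : HasTy Δ t A)
      (hE : E.Distinct) (p : E.Perm (Γ ++ Δ)) :
      AutEqn E (.app (.lam A v) t) (v.inst t) B
  /-- `λ x : A. (v x) = v` -/
  | lolli_eta {Γ : LCtx S} {v : LTm S} {A B : LTy S.G} (hv : HasTy Γ v (.lolli A B)) :
      AutEqn Γ (.lam A (.app (v.rename (· + 1)) (.var 0))) v (.lolli A B)
  /-- `t[v to *. w/z] = v to *. t[w/z]` -/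
  | comm_unit {Γ Δ Θ E : LCtx S} {v w t : LTm S} {z : ℕ} {A B : LTy S.G}
      (ht : HasTy ((z, A) :: Γ) t B) (hv : HasTy Δ v .unit) (hw : HasTy Θ w A)
      (hE : E.Distinct) (p : E.Perm (Γ ++ Δ ++ Θ)) :
      AutEqn E (t.sub z (.letStar v w)) (.letStar v (t.sub z w)) B
  /-- `t[pm v to x ⊗ y. w/z] = pm v to x ⊗ y. t[w/z]` -/
  | comm_tensor {Γ Δ Θ E : LCtx S} {v w t : LTm S} {z : ℕ} {A B D F : LTy S.G}
      (ht : HasTy ((z, D) :: Γ) t F) (hv : HasTy Δ v (.tensor A B))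
      (hw : HasTy (Θ.bind₂ A B) w D)
      (hE : E.Distinct) (p : E.Perm (Γ ++ Δ ++ Θ)) :
      AutEqn E (t.sub z (.pm v w)) (.pm v ((t.rename (· + 2)).sub (z + 2) w)) F

mutual
/-- `T.Thm Γ v w q A`: the `V`-equation `Γ ▷ v =_q w : A` is a theorem of `T`. -/
inductive VTheory.Thm {V : Type w} [CommMonoid V] [CompleteLattice V] {B : Set V}
    (T : VTheory.{w, u, u₂} V B) : LCtx T.sig → LTm T.sig → LTm T.sig → V → LTy T.sig.G → Prop
  | axiom_mem {e : VEqn V T.sig} (h : e ∈ T.Ax) : T.Thm e.ctx e.lhs e.rhs e.label e.ty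
  | aut {Γ : LCtx T.sig} {v w : LTm T.sig} {A : LTy T.sig.G} (h : AutEqn Γ v w A) :
      T.Thm Γ v w ⊤ A
  | aut_symm {Γ : LCtx T.sig} {v w : LTm T.sig} {A : LTy T.sig.G} (h : AutEqn Γ v w A) :
      T.Thm Γ w v ⊤ A
  | refl {Γ : LCtx T.sig} {v : LTm T.sig} {A : LTy T.sig.G} (h : HasTy Γ v A) :
      T.Thm Γ v v ⊤ A
  | trans {Γ : LCtx T.sig} {v w t : LTm T.sig} {q r : V} {A : LTy T.sig.G}
      (h₁ : T.Thm Γ v w q A) (h₂ : T.Thm Γ w t r A) : T.Thm Γ v t (q * r) A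
  | weak {Γ : LCtx T.sig} {v w : LTm T.sig} {q r : V} {A : LTy T.sig.G}
      (h : T.Thm Γ v w q A) (hr : r ∈ B) (hrq : r ≤ q) : T.Thm Γ v w r A
  | arch {Γ : LCtx T.sig} {v w : LTm T.sig} {q : V} {A : LTy T.sig.G}
      (hv : HasTy Γ v A) (hw : HasTy Γ w A) (hq : q ∈ B)
      (h : ∀ r ∈ B, WayBelow r q → T.Thm Γ v w r A) : T.Thm Γ v w q A
  | join {Γ : LCtx T.sig} {v w : LTm T.sig} {A : LTy T.sig.G} {n : ℕ} {q : Fin n → V}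
      (hv : HasTy Γ v A) (hw : HasTy Γ w A)
      (h : ∀ i, T.Thm Γ v w (q i) A) : T.Thm Γ v w (⨆ i, q i) A
  | op_congr (f : T.sig.Op) {E : LCtx T.sig} {as bs : LArgs T.sig} {q : V}
      (h : T.ThmArgs E as bs q (T.sig.dom f)) : T.Thm E (.op f as) (.op f bs) q (T.sig.cod f)
  | pair_congr {Γ Δ E : LCtx T.sig} {v v' w w' : LTm T.sig} {q r : V} {A A' : LTy T.sig.G}
      (h : T.Thm Γ v w q A) (h' : T.Thm Δ v' w' r A') (s : Shuffle Γ Δ E) (hE : E.Distinct) :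
      T.Thm E (.pair v v') (.pair w w') (q * r) (.tensor A A')
  | pm_congr {Γ Δ E : LCtx T.sig} {v v' w w' : LTm T.sig} {q r : V} {A A' D : LTy T.sig.G}
      (h : T.Thm Γ v w q (.tensor A A')) (h' : T.Thm (Δ.bind₂ A A') v' w' r D)
      (s : Shuffle Γ Δ E) (hE : E.Distinct) :
      T.Thm E (.pm v v') (.pm w w') (q * r) D
  | letStar_congr {Γ Δ E : LCtx T.sig} {v v' w w' : LTm T.sig} {q r : V} {A : LTy T.sig.G}
      (h : T.Thm Γ v w q .unit) (h' : T.Thm Δ v' w' r A) (s : Shuffle Γ Δ E) (hE : E.Distinct) :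
      T.Thm E (.letStar v v') (.letStar w w') (q * r) A
  | lam_congr {Γ : LCtx T.sig} {v w : LTm T.sig} {q : V} {A A' : LTy T.sig.G}
      (h : T.Thm (Γ.bind A) v w q A') : T.Thm Γ (.lam A v) (.lam A w) q (.lolli A A')
  | app_congr {Γ Δ E : LCtx T.sig} {v v' w w' : LTm T.sig} {q r : V} {A A' : LTy T.sig.G}
      (h : T.Thm Γ v w q (.lolli A A')) (h' : T.Thm Δ v' w' r A)
      (s : Shuffle Γ Δ E) (hE : E.Distinct) :
      T.Thm E (.app v v') (.app w w') (q * r) A'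
  | exchange {Γ Δ : LCtx T.sig} {v w : LTm T.sig} {q : V} {A : LTy T.sig.G}
      (h : T.Thm Γ v w q A) (p : Δ.Perm Γ) : T.Thm Δ v w q A
  | subst {Γ Δ : LCtx T.sig} {x : ℕ} {v v' w w' : LTm T.sig} {q r : V} {A D : LTy T.sig.G}
      (h : T.Thm ((x, A) :: Γ) v w q D) (h' : T.Thm Δ v' w' r A)
      (hE : LCtx.Distinct (Δ ++ Γ)) :
      T.Thm (Δ ++ Γ) (v.sub x v') (w.sub x w') (q * r) D
/-- Componentwise `V`-equality of argument lists, labelled by the product of the labels. -/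
inductive VTheory.ThmArgs {V : Type w} [CommMonoid V] [CompleteLattice V] {B : Set V}
    (T : VTheory.{w, u, u₂} V B) :
    LCtx T.sig → LArgs T.sig → LArgs T.sig → V → List (LTy T.sig.G) → Prop
  | nil : T.ThmArgs [] .nil .nil 1 []
  | snoc {Γ Δ E : LCtx T.sig} {as bs : LArgs T.sig} {v w : LTm T.sig} {q r : V}
      {As : List (LTy T.sig.G)} {A : LTy T.sig.G}
      (h : T.ThmArgs Γ as bs q As) (h' : T.Thm Δ v w r A) (s : Shuffle Γ Δ E)
      (hE : E.Distinct) :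
      T.ThmArgs E (.snoc as v) (.snoc bs w) (q * r) (A :: As)
end

/-- The class of terms `v` with `x : A ▷ v : D`. -/
def VTheory.TermHom {V : Type w} {B : Set V} (T : VTheory.{w, u, u₂} V B)
    (A D : LTy T.sig.G) : Type (max u u₂) :=
  {v : LTm T.sig // HasTy [(0, A)] v D}

/-- `a(v, w) = ⋁ {q | v =_q w is a theorem}`. -/
def VTheory.termDist {V : Type w} [CommMonoid V] [CompleteLattice V] {B : Set V}
    (T : VTheory.{w, u, u₂} V B) {A D : LTy T.sig.G} (v w : T.TermHom A D) : V :=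
  sSup {q | T.Thm [(0, A)] v.1 w.1 q D}

/-- `T` is varietal: the separated quotients of the `V`-categories of terms are small. -/
def VTheory.Varietal {V : Type w} [CommMonoid V] [CompleteLattice V] {B : Set V}
    (T : VTheory.{w, u, u₂} V B) : Prop :=
  ∀ A D : LTy T.sig.G, Small.{v}
    (Quot (fun v w : T.TermHom A D => 1 ≤ T.termDist v w ∧ 1 ≤ T.termDist w v))

/-! ## Interpretation in autonomous categories -/

section Interpretation

variable {C : Type u'} [Category.{v} C] [MonoidalCategory C]

/-- `X₁ ⊗ ⋯ ⊗ Xₙ`, bracketed to the left; the unit object for `n = 0`. -/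
def tens {α : Type u} (F : α → C) : List α → C
  | [] => 𝟙_ C
  | [a] => F a
  | a :: b :: l => tens F (b :: l) ⊗ F a

/-- `⟦Γ, a⟧ ≅ ⟦Γ⟧ ⊗ ⟦a⟧`. -/
def snocIso {α : Type u} (F : α → C) (a : α) : (l : List α) → (tens F (a :: l) ≅ tens F l ⊗ F a)
  | [] => (λ_ (F a)).symm
  | _ :: _ => Iso.refl _

/-- The canonical (shuffle, then split) morphism `⟦E⟧ ⟶ ⟦Γ⟧ ⊗ ⟦Δ⟧`. -/
def Shuffle.split [SymmetricCategory C] {α : Type u} (F : α → C) {Γ Δ E : List α} :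
    Shuffle Γ Δ E → (tens F E ⟶ tens F Γ ⊗ tens F Δ)
  | .nil => (λ_ (𝟙_ C)).inv
  | .left (Γ := Γ) (Δ := Δ) (E := E) a s =>
      (snocIso F a E).hom ≫ (s.split F ▷ F a) ≫ (α_ _ _ _).hom ≫
        (tens F Γ ◁ (β_ (tens F Δ) (F a)).hom) ≫ (α_ _ _ _).inv ≫ ((snocIso F a Γ).inv ▷ tens F Δ)
  | .right (Γ := Γ) (Δ := Δ) (E := E) a s =>
      (snocIso F a E).hom ≫ (s.split F ▷ F a) ≫ (α_ _ _ _).hom ≫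
        (tens F Γ ◁ (snocIso F a Δ).inv)

theorem tens_shift {S : LSig.{u, u₂}} (F : LTy S.G → C) (n : ℕ) (Γ : LCtx S) :
    tens (fun p : ℕ × LTy S.G => F p.2) Γ =
      tens (fun p : ℕ × LTy S.G => F p.2) (Γ.shift n) := by
  match Γ with
  | [] => rfl
  | [_] => rfl
  | a :: b :: l =>
    have h := tens_shift F n (b :: l)
    simp only [LCtx.shift, List.map_cons, tens] at h ⊢
    rw [h]

end Interpretation

/-- Interpretation of types, given the interpretation of ground types. -/
def LTy.interp {G : Type u} {C : Type u'} [Category.{v} C] [MonoidalCategory C] [MonoidalClosed C]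
    (g : G → C) : LTy G → C
  | .ground X => g X
  | .unit => 𝟙_ C
  | .tensor A B => A.interp g ⊗ B.interp g
  | .lolli A B => (ihom (A.interp g)).obj (B.interp g)

/-- Interpretations of the ground types and operation symbols of `S` in an autonomous category. -/
structure LInterp (S : LSig.{u, u₂}) (C : Type u') [Category.{v} C] [MonoidalCategory C]
    [MonoidalClosed C] where
  ground : S.G → C
  op : ∀ f : S.Op, tens (LTy.interp ground) (S.dom f) ⟶ (S.cod f).interp ground

namespace LInterp

variable {S : LSig.{u, u₂}} {C : Type u'} [Category.{v} C] [MonoidalCategory C]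
  [MonoidalClosed C]

/-- `⟦A⟧`. -/
abbrev ty (M : LInterp S C) (A : LTy S.G) : C := A.interp M.ground

/-- `⟦Γ⟧`. -/
abbrev ctx (M : LInterp S C) (Γ : LCtx S) : C := tens (fun p : ℕ × LTy S.G => M.ty p.2) Γ

/-- The evident identification of `⟦Γ⟧` with the interpretation of the shifted context. -/
def shiftHom (M : LInterp S C) (n : ℕ) (Γ : LCtx S) : M.ctx Γ ⟶ M.ctx (Γ.shift n) :=
  eqToHom (tens_shift M.ty n Γ)

/-- `⟦Γ⟧ ⊗ ⟦A⟧ ⟶ ⟦Γ, x : A⟧`. -/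
def join₁ (M : LInterp S C) (Γ : LCtx S) (A : LTy S.G) :
    M.ctx Γ ⊗ M.ty A ⟶ M.ctx (Γ.bind A) :=
  (M.shiftHom 1 Γ ▷ M.ty A) ≫
    (snocIso (fun p : ℕ × LTy S.G => M.ty p.2) (0, A) (Γ.shift 1)).inv

/-- `(⟦Γ⟧ ⊗ ⟦A⟧) ⊗ ⟦B⟧ ⟶ ⟦Γ, x : A, y : B⟧`. -/
def join₂ (M : LInterp S C) (Γ : LCtx S) (A B : LTy S.G) :
    (M.ctx Γ ⊗ M.ty A) ⊗ M.ty B ⟶ M.ctx (Γ.bind₂ A B) :=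
  (((M.shiftHom 2 Γ ▷ M.ty A) ≫
    (snocIso (fun p : ℕ × LTy S.G => M.ty p.2) (1, A) (Γ.shift 2)).inv) ▷ M.ty B) ≫
    (snocIso (fun p : ℕ × LTy S.G => M.ty p.2) (0, B) ((1, A) :: Γ.shift 2)).inv

variable [SymmetricCategory C]

/-- `app : (X ⊸ Y) ⊗ X ⟶ Y`. -/
def appHom (X Y : C) : (ihom X).obj Y ⊗ X ⟶ Y :=
  (β_ _ _).hom ≫ (ihom.ev X).app Y

/-- The right transpose `X ⟶ (Y ⊸ Z)` of `f : X ⊗ Y ⟶ Z`. -/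
def transpose {X Y Z : C} (f : X ⊗ Y ⟶ Z) : X ⟶ (ihom Y).obj Z :=
  MonoidalClosed.curry ((β_ Y X).hom ≫ f)

mutual
/-- `⟦Γ ▷ v : A⟧`, by recursion on the derivation of the judgement. -/
def den (M : LInterp S C) {Γ : LCtx S} {v : LTm S} {A : LTy S.G} :
    LDer S Γ v A → (M.ctx Γ ⟶ M.ty A)
  | .ax f d => M.denArgs d ≫ M.op f
  | .hyp _ A => 𝟙 (M.ty A)
  | .unitI => 𝟙 (𝟙_ C)
  | .unitE d e s => s.split _ ≫ (M.den d ▷ _) ≫ (λ_ _).hom ≫ M.den e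
  | .tensorI d e s => s.split _ ≫ (M.den d ⊗ₘ M.den e)
  | .tensorE (Δ := Δ) (A := A) (B := B) d e s =>
      s.split _ ≫ (M.den d ▷ _) ≫ (β_ (M.ty A ⊗ M.ty B) (M.ctx Δ)).hom ≫ (α_ _ _ _).inv ≫
        M.join₂ Δ A B ≫ M.den e
  | .lolliI (Γ := Γ) (A := A) d => transpose (M.join₁ Γ A ≫ M.den d)
  | .lolliE d e s => s.split _ ≫ (M.den d ⊗ₘ M.den e) ≫ appHom _ _
/-- `⟦v₁⟧ ⊗ ⋯ ⊗ ⟦vₙ⟧` precomposed with the canonical morphism out of `⟦E⟧`. -/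
def denArgs (M : LInterp S C) {Γ : LCtx S} {as : LArgs S} {As : List (LTy S.G)} :
    LDerArgs S Γ as As → (M.ctx Γ ⟶ tens M.ty As)
  | .nil => 𝟙 (𝟙_ C)
  | .snoc (As := As) (A := A) d e s =>
      s.split _ ≫ (M.denArgs d ⊗ₘ M.den e) ≫ (snocIso M.ty A As).inv
end

/-- The `V`-equation `Γ ▷ v =_q w : A` is satisfied: `q ≤ a(⟦Γ ▷ v : A⟧, ⟦Γ ▷ w : A⟧)`.  (A
judgement over a genuine context has just one derivation.) -/
def Satisfies {V : Type w} [CommMonoid V] [CompleteLattice V] [VCatSepEnriched V C]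
    (M : LInterp S C) (e : VEqn V S) : Prop :=
  ∀ (d : LDer S e.ctx e.lhs e.ty) (d' : LDer S e.ctx e.rhs e.ty),
    e.label ≤ VCatSepEnriched.dist (M.den d) (M.den d')

end LInterp

/-- The interpretation `M` is a model of the theory `T`. -/
def VTheory.IsModel {V : Type w} [CommMonoid V] [CompleteLattice V] {B : Set V}
    (T : VTheory.{w, u, u₂} V B) {C : Type u'} [Category.{v} C] [MonoidalCategory C]
    [SymmetricCategory C] [MonoidalClosed C] [VCatSepEnriched V C]
    (M : LInterp T.sig C) : Prop :=
  ∀ e ∈ T.Ax, M.Satisfies e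

/-!
# Soundness and completeness of quantale-labelled equations for linear lambda calculus

*Soundness* is an induction over the theorems of the theory. Every judgement over a context with
distinct variables has a single derivation (`LDer.unique`), so its denotation is well defined and
may be computed from whichever derivation is at hand. The compatibility rules are the enrichment of
the category. The substitution rule and the equations of linear lambda calculus rest on the
substitution lemma `LDer.exists_subst`: the denotation turns a simultaneous substitution (`SDer`)
into composition. Its combinatorial core is that a shuffle of shuffles can be reassociated,
compatibly with the canonical morphisms of the symmetric monoidal category
(`Shuffle.exists_assoc`). With it each equation becomes a diagram in an autonomous category
(`AutEqn.sound`), and `VTheory.Thm.sound` follows. Applied to the terminal category, soundness also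
says that both sides of a theorem are well typed.

*Completeness* uses the syntactic category `SynCat`. Its objects are the types; a morphism from `A`
to `D` is a term `v` with `x : A ▷ v : D`, up to provable distance `⊤` in both directions, and
varietality provides a small set of these. Composition is substitution, and the distance is the
join of the provable labels. A label of `B` below that join is itself provable
(`VTheory.Thm.of_le_sSup`): what is way below it is bounded by a finite join of provable labels, so
the rules for finite joins, weakening and the archimedean rule apply.

To avoid computing with nested eliminators, equality of morphisms is tested on *patterns*, terms
built from variables and `*` by pairing. Patterns are generic elements of their types
(`Pat.thm_of_sub`), by the eta rules for `⊗` and `I`. The relation `SynHom.Ev f u u'` says that `f`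
takes the term `u` to `u'`; it is compatible with composition and tensor products, every structure
morphism has the expected value on a pattern, and so each coherence law is proved by evaluating
both sides (`SynHom.ext_pat`).

The signature is interpreted in `SynCat` by itself. A context `Γ` is interpreted by the tensor
product of its types, of which the tuple of the variables of `Γ` is a generic element, and the
denotation of `Γ ▷ v : A` takes this tuple to `v` (`SynCat.ev_den`). Hence an equation is satisfied
in the syntactic model if and only if it is a theorem (`SynCat.le_dist_den_iff`): the syntactic
model satisfies the axioms, and an equation true in all models is a theorem because it is true in
this one.
-/

/-! ### Renaming and substitution of raw terms -/

section RawTerms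

variable {S : LSig.{u, u₂}}

mutual
/-- `v.Free x`: the variable `x` occurs freely in `v`. -/
def LTm.Free : LTm S → ℕ → Prop
  | .var y, x => x = y
  | .op _ as, x => as.Free x
  | .star, _ => False
  | .letStar v w, x => v.Free x ∨ w.Free x
  | .pair v w, x => v.Free x ∨ w.Free x
  | .pm v w, x => v.Free x ∨ w.Free (x + 2)
  | .lam _ v, x => v.Free (x + 1)
  | .app v w, x => v.Free x ∨ w.Free x
/-- `as.Free x`: the variable `x` occurs freely in the argument list `as`. -/
def LArgs.Free : LArgs S → ℕ → Prop
  | .nil, _ => False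
  | .snoc as v, x => as.Free x ∨ v.Free x
end

/-- Here `P` is meant to be the predicate "free in the body of a binder". -/
theorem upSubst_congr {σ τ : ℕ → LTm S} {P : ℕ → Prop} (h : ∀ x, P (x + 1) → σ x = τ x) :
    ∀ x, P x → upSubst σ x = upSubst τ x
  | 0, _ => rfl
  | x + 1, hx => by simp [upSubst, h x hx]

mutual
/-- A substitution instance depends only on the values at the free variables. -/
theorem LTm.subst_congr : ∀ (v : LTm S) {σ τ : ℕ → LTm S},
    (∀ x, v.Free x → σ x = τ x) → v.subst σ = v.subst τ
  | .var y, _, _, h => h y rfl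
  | .op _ as, _, _, h => by simp only [LTm.subst]; rw [as.subst_congr h]
  | .star, _, _, _ => rfl
  | .letStar v w, _, _, h => by
      simp only [LTm.subst]
      rw [v.subst_congr fun x hx => h x (Or.inl hx), w.subst_congr fun x hx => h x (Or.inr hx)]
  | .pair v w, _, _, h => by
      simp only [LTm.subst]
      rw [v.subst_congr fun x hx => h x (Or.inl hx), w.subst_congr fun x hx => h x (Or.inr hx)]
  | .pm v w, _, _, h => by
      simp only [LTm.subst]
      rw [v.subst_congr fun x hx => h x (Or.inl hx),
        w.subst_congr (upSubst_congr (upSubst_congr fun x hx => h x (Or.inr hx)))]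
  | .lam _ v, _, _, h => by
      simp only [LTm.subst]; rw [v.subst_congr (upSubst_congr h)]
  | .app v w, _, _, h => by
      simp only [LTm.subst]
      rw [v.subst_congr fun x hx => h x (Or.inl hx), w.subst_congr fun x hx => h x (Or.inr hx)]
theorem LArgs.subst_congr : ∀ (as : LArgs S) {σ τ : ℕ → LTm S},
    (∀ x, as.Free x → σ x = τ x) → as.subst σ = as.subst τ
  | .nil, _, _, _ => rfl
  | .snoc as v, _, _, h => by
      simp only [LArgs.subst]
      rw [as.subst_congr fun x hx => h x (Or.inl hx), v.subst_congr fun x hx => h x (Or.inr hx)]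
end

theorem upSubst_var_comp (ρ : ℕ → ℕ) :
    upSubst (fun x => (.var (ρ x) : LTm S)) = fun x => .var (upRen ρ x) := by
  funext x; cases x <;> simp [upSubst, upRen, LTm.rename]

mutual
/-- A renaming is a substitution of variables. -/
theorem LTm.rename_eq_subst : ∀ (v : LTm S) (ρ : ℕ → ℕ),
    v.rename ρ = v.subst (fun x => .var (ρ x))
  | .var _, _ => rfl
  | .op _ as, ρ => by simp only [LTm.rename, LTm.subst]; rw [as.rename_eq_subst]
  | .star, _ => rfl
  | .letStar v w, ρ => by
      simp only [LTm.rename, LTm.subst]; rw [v.rename_eq_subst, w.rename_eq_subst]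
  | .pair v w, ρ => by
      simp only [LTm.rename, LTm.subst]; rw [v.rename_eq_subst, w.rename_eq_subst]
  | .pm v w, ρ => by
      simp only [LTm.rename, LTm.subst, upSubst_var_comp]
      rw [v.rename_eq_subst, w.rename_eq_subst]
  | .lam _ v, ρ => by
      simp only [LTm.rename, LTm.subst, upSubst_var_comp]; rw [v.rename_eq_subst]
  | .app v w, ρ => by
      simp only [LTm.rename, LTm.subst]; rw [v.rename_eq_subst, w.rename_eq_subst]
theorem LArgs.rename_eq_subst : ∀ (as : LArgs S) (ρ : ℕ → ℕ),
    as.rename ρ = as.subst (fun x => .var (ρ x))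
  | .nil, _ => rfl
  | .snoc as v, ρ => by
      simp only [LArgs.rename, LArgs.subst]; rw [as.rename_eq_subst, v.rename_eq_subst]
end

theorem upSubst_comp_upRen (σ : ℕ → LTm S) (ρ : ℕ → ℕ) :
    (fun x => upSubst σ (upRen ρ x)) = upSubst (fun x => σ (ρ x)) := by
  funext x; cases x <;> simp [upSubst, upRen]

mutual
theorem LTm.subst_rename : ∀ (v : LTm S) (ρ : ℕ → ℕ) (σ : ℕ → LTm S),
    (v.rename ρ).subst σ = v.subst (fun x => σ (ρ x))
  | .var _, _, _ => rfl
  | .op _ as, ρ, σ => by simp only [LTm.rename, LTm.subst]; rw [as.subst_rename]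
  | .star, _, _ => rfl
  | .letStar v w, ρ, σ => by
      simp only [LTm.rename, LTm.subst]; rw [v.subst_rename, w.subst_rename]
  | .pair v w, ρ, σ => by
      simp only [LTm.rename, LTm.subst]; rw [v.subst_rename, w.subst_rename]
  | .pm v w, ρ, σ => by
      simp only [LTm.rename, LTm.subst]
      rw [v.subst_rename, w.subst_rename, upSubst_comp_upRen, upSubst_comp_upRen]
  | .lam _ v, ρ, σ => by
      simp only [LTm.rename, LTm.subst]; rw [v.subst_rename, upSubst_comp_upRen]
  | .app v w, ρ, σ => by
      simp only [LTm.rename, LTm.subst]; rw [v.subst_rename, w.subst_rename]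
theorem LArgs.subst_rename : ∀ (as : LArgs S) (ρ : ℕ → ℕ) (σ : ℕ → LTm S),
    (as.rename ρ).subst σ = as.subst (fun x => σ (ρ x))
  | .nil, _, _ => rfl
  | .snoc as v, ρ, σ => by
      simp only [LArgs.rename, LArgs.subst]; rw [as.subst_rename, v.subst_rename]
end

theorem LTm.rename_rename (v : LTm S) (ρ ρ' : ℕ → ℕ) :
    (v.rename ρ).rename ρ' = v.rename (fun x => ρ' (ρ x)) := by
  rw [LTm.rename_eq_subst _ ρ', LTm.subst_rename, LTm.rename_eq_subst]

theorem rename_upSubst (σ : ℕ → LTm S) (ρ : ℕ → ℕ) :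
    (fun x => (upSubst σ x).rename (upRen ρ)) = upSubst (fun x => (σ x).rename ρ) := by
  funext x; cases x <;> simp [upSubst, upRen, LTm.rename, LTm.rename_rename]

mutual
theorem LTm.rename_subst : ∀ (v : LTm S) (σ : ℕ → LTm S) (ρ : ℕ → ℕ),
    (v.subst σ).rename ρ = v.subst (fun x => (σ x).rename ρ)
  | .var _, _, _ => rfl
  | .op _ as, σ, ρ => by simp only [LTm.rename, LTm.subst]; rw [as.rename_subst]
  | .star, _, _ => rfl
  | .letStar v w, σ, ρ => by
      simp only [LTm.rename, LTm.subst]; rw [v.rename_subst, w.rename_subst]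
  | .pair v w, σ, ρ => by
      simp only [LTm.rename, LTm.subst]; rw [v.rename_subst, w.rename_subst]
  | .pm v w, σ, ρ => by
      simp only [LTm.rename, LTm.subst]
      rw [v.rename_subst, w.rename_subst, rename_upSubst, rename_upSubst]
  | .lam _ v, σ, ρ => by
      simp only [LTm.rename, LTm.subst]; rw [v.rename_subst, rename_upSubst]
  | .app v w, σ, ρ => by
      simp only [LTm.rename, LTm.subst]; rw [v.rename_subst, w.rename_subst]
theorem LArgs.rename_subst : ∀ (as : LArgs S) (σ : ℕ → LTm S) (ρ : ℕ → ℕ),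
    (as.subst σ).rename ρ = as.subst (fun x => (σ x).rename ρ)
  | .nil, _, _ => rfl
  | .snoc as v, σ, ρ => by
      simp only [LArgs.rename, LArgs.subst]; rw [as.rename_subst, v.rename_subst]
end

theorem subst_upSubst (σ τ : ℕ → LTm S) :
    (fun x => (upSubst σ x).subst (upSubst τ)) = upSubst (fun x => (σ x).subst τ) := by
  funext x
  cases x <;> simp [upSubst, LTm.subst, LTm.subst_rename, LTm.rename_subst]

mutual
theorem LTm.subst_subst : ∀ (v : LTm S) (σ τ : ℕ → LTm S),
    (v.subst σ).subst τ = v.subst (fun x => (σ x).subst τ)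
  | .var _, _, _ => rfl
  | .op _ as, σ, τ => by simp only [LTm.subst]; rw [as.subst_subst]
  | .star, _, _ => rfl
  | .letStar v w, σ, τ => by simp only [LTm.subst]; rw [v.subst_subst, w.subst_subst]
  | .pair v w, σ, τ => by simp only [LTm.subst]; rw [v.subst_subst, w.subst_subst]
  | .pm v w, σ, τ => by
      simp only [LTm.subst]
      rw [v.subst_subst, w.subst_subst, subst_upSubst, subst_upSubst]
  | .lam _ v, σ, τ => by simp only [LTm.subst]; rw [v.subst_subst, subst_upSubst]
  | .app v w, σ, τ => by simp only [LTm.subst]; rw [v.subst_subst, w.subst_subst]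
theorem LArgs.subst_subst : ∀ (as : LArgs S) (σ τ : ℕ → LTm S),
    (as.subst σ).subst τ = as.subst (fun x => (σ x).subst τ)
  | .nil, _, _ => rfl
  | .snoc as v, σ, τ => by simp only [LArgs.subst]; rw [as.subst_subst, v.subst_subst]
end

theorem upSubst_var : upSubst (LTm.var (S := S)) = LTm.var := by
  funext x; cases x <;> simp [upSubst, LTm.rename]

mutual
theorem LTm.subst_var : ∀ v : LTm S, v.subst .var = v
  | .var _ => rfl
  | .op _ as => by simp only [LTm.subst]; rw [as.subst_var]
  | .star => rfl
  | .letStar v w => by simp only [LTm.subst]; rw [v.subst_var, w.subst_var]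
  | .pair v w => by simp only [LTm.subst]; rw [v.subst_var, w.subst_var]
  | .pm v w => by simp only [LTm.subst, upSubst_var]; rw [v.subst_var, w.subst_var]
  | .lam _ v => by simp only [LTm.subst, upSubst_var]; rw [v.subst_var]
  | .app v w => by simp only [LTm.subst]; rw [v.subst_var, w.subst_var]
theorem LArgs.subst_var : ∀ as : LArgs S, as.subst .var = as
  | .nil => rfl
  | .snoc as v => by simp only [LArgs.subst]; rw [as.subst_var, v.subst_var]
end

theorem LTm.sub_rename_add_two (t p : LTm S) (z : ℕ) :
    (t.rename (· + 2)).sub (z + 2) p =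
      t.subst (Function.update (fun n => .var (n + 2)) z p) := by
  rw [LTm.sub, LTm.subst_rename]
  congr 1
  funext x
  by_cases h : x = z
  · subst h; simp
  · rw [Function.update_of_ne h, Function.update_of_ne (by omega)]

theorem LTm.subst_eq_self {v : LTm S} {σ : ℕ → LTm S} (h : ∀ x, v.Free x → σ x = .var x) :
    v.subst σ = v :=
  (v.subst_congr h).trans v.subst_var

end RawTerms

/-! ### Shuffles -/

section Shuffles

variable {α : Type u} {β : Type v}

namespace Shuffle

/-- The shuffle of a list with the empty list. -/
def allLeft : ∀ Γ : List α, Shuffle Γ [] Γ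
  | [] => .nil
  | a :: Γ => .left a (allLeft Γ)

/-- The shuffle of the empty list with a list. -/
def allRight : ∀ Δ : List α, Shuffle [] Δ Δ
  | [] => .nil
  | a :: Δ => .right a (allRight Δ)

/-- Concatenation as a shuffle. -/
def append (Γ : List α) : ∀ Δ : List α, Shuffle Γ Δ (Δ ++ Γ)
  | [] => allLeft Γ
  | a :: Δ => .right a (append Γ Δ)

/-- Exchanging the roles of the two shuffled lists. -/
def swap {Γ Δ E : List α} : Shuffle Γ Δ E → Shuffle Δ Γ E
  | .nil => .nil
  | .left a s => .right a s.swap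
  | .right a s => .left a s.swap

/-- Applying a function to all entries of a shuffle. -/
def map (f : α → β) {Γ Δ E : List α} :
    Shuffle Γ Δ E → Shuffle (Γ.map f) (Δ.map f) (E.map f)
  | .nil => .nil
  | .left a s => .left (f a) (s.map f)
  | .right a s => .right (f a) (s.map f)

theorem perm {Γ Δ E : List α} : Shuffle Γ Δ E → E.Perm (Γ ++ Δ)
  | .nil => .refl _
  | .left a s => s.perm.cons a
  | .right a s => (s.perm.cons a).trans List.perm_middle.symm

theorem mem_iff {Γ Δ E : List α} (s : Shuffle Γ Δ E) {x : α} : x ∈ E ↔ x ∈ Γ ∨ x ∈ Δ := by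
  rw [s.perm.mem_iff, List.mem_append]

theorem sublist_left {Γ Δ E : List α} : Shuffle Γ Δ E → Γ.Sublist E
  | .nil => .refl _
  | .left a s => s.sublist_left.cons_cons a
  | .right a s => s.sublist_left.cons a

theorem sublist_right {Γ Δ E : List α} (s : Shuffle Γ Δ E) : Δ.Sublist E :=
  s.swap.sublist_left

/-- Over a list without repetitions there is at most one shuffle of two given lists. -/
theorem eq_of_nodup {Γ Δ E : List α} (s t : Shuffle Γ Δ E) (h : E.Nodup) : s = t := by
  induction s with
  | nil => cases t; rfl
  | left a s ih =>
    cases t with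
    | left _ t => rw [ih t (List.nodup_cons.1 h).2]
    | right _ t => exact absurd (s.mem_iff.2 (Or.inr List.mem_cons_self)) (List.nodup_cons.1 h).1
  | right a s ih =>
    cases t with
    | left _ t => exact absurd (s.mem_iff.2 (Or.inl List.mem_cons_self)) (List.nodup_cons.1 h).1
    | right _ t => rw [ih t (List.nodup_cons.1 h).2]

/-- An entry of a list can be split off, as the second part of a shuffle. -/
theorem exists_of_mem {a : α} {E : List α} (h : a ∈ E) :
    ∃ E', Nonempty (Shuffle E' [a] E) ∧ E.Perm (a :: E') := by
  induction E with
  | nil => simp at h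
  | cons b E ih =>
    rcases List.mem_cons.1 h with rfl | h
    · exact ⟨E, ⟨.right a (allLeft E)⟩, .refl _⟩
    · obtain ⟨E', ⟨s⟩, p⟩ := ih h
      exact ⟨b :: E', ⟨.left b s⟩, (p.cons b).trans (.swap a b E')⟩

end Shuffle

end Shuffles

/-! ### Free variables and uniqueness of derivations -/

section Derivations

variable {S : LSig.{u, u₂}}

namespace LCtx

theorem mem_shift {n : ℕ} {Γ : LCtx S} {x : ℕ} :
    x ∈ (Γ.shift n).map Prod.fst ↔ ∃ y ∈ Γ.map Prod.fst, y + n = x := by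
  simp [LCtx.shift]

theorem Distinct.of_perm {Γ Δ : LCtx S} (h : Γ.Distinct) (p : Γ.Perm Δ) : Δ.Distinct :=
  (p.map Prod.fst).nodup_iff.1 h

theorem Distinct.sublist {Γ Δ : LCtx S} (h : Γ.Distinct) (p : Δ.Sublist Γ) : Δ.Distinct :=
  List.Nodup.sublist (p.map Prod.fst) h

theorem Distinct.left {Γ Δ E : LCtx S} (h : E.Distinct) (s : Shuffle Γ Δ E) : Γ.Distinct :=
  h.sublist s.sublist_left

theorem Distinct.right {Γ Δ E : LCtx S} (h : E.Distinct) (s : Shuffle Γ Δ E) : Δ.Distinct :=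
  h.sublist s.sublist_right

theorem Distinct.map_of_injective {Γ : LCtx S} (h : Γ.Distinct) {ρ : ℕ → ℕ}
    (hρ : Function.Injective ρ) : LCtx.Distinct (S := S) (Γ.map (fun p => (ρ p.1, p.2))) := by
  have := List.Nodup.map hρ h
  simpa [LCtx.Distinct, Function.comp_def] using this

theorem Distinct.shift {Γ : LCtx S} (h : Γ.Distinct) (n : ℕ) : (Γ.shift n).Distinct :=
  h.map_of_injective (add_left_injective n)

theorem Distinct.of_shift {Γ : LCtx S} {n : ℕ} (h : (Γ.shift n).Distinct) : Γ.Distinct := by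
  have : (Γ.map Prod.fst).map (· + n) = (Γ.shift n).map Prod.fst := by simp [LCtx.shift]
  exact List.Nodup.of_map (· + n) (by rw [this]; exact h)

theorem distinct_cons {p : ℕ × LTy S.G} {Γ : LCtx S} :
    LCtx.Distinct (S := S) (p :: Γ) ↔ p.1 ∉ Γ.map Prod.fst ∧ Γ.Distinct := by
  simp [LCtx.Distinct]

theorem Distinct.bind {Γ : LCtx S} (h : Γ.Distinct) (A : LTy S.G) : (Γ.bind A).Distinct := by
  refine distinct_cons.2 ⟨?_, h.shift 1⟩
  rw [mem_shift]; rintro ⟨y, _, h⟩; exact absurd h (by simp)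

theorem Distinct.of_bind {Γ : LCtx S} {A : LTy S.G} (h : (Γ.bind A).Distinct) : Γ.Distinct :=
  (distinct_cons.1 h).2.of_shift

theorem Distinct.bind₂ {Γ : LCtx S} (h : Γ.Distinct) (A B : LTy S.G) :
    (Γ.bind₂ A B).Distinct := by
  refine distinct_cons.2 ⟨?_, distinct_cons.2 ⟨?_, h.shift 2⟩⟩
  · rw [List.map_cons, List.mem_cons, mem_shift]
    rintro (h | ⟨y, _, h⟩)
    · exact absurd h (by simp)
    · exact absurd h (by simp)
  · rw [mem_shift]; rintro ⟨y, _, h⟩; exact absurd h (by simp)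

theorem Distinct.nodup {Γ : LCtx S} (h : Γ.Distinct) : Γ.Nodup := List.Nodup.of_map _ h

end LCtx

mutual
/-- The variables of the context of a derivable judgement are the free variables of its term. -/
theorem LDer.mem_iff_free : ∀ {Γ : LCtx S} {v : LTm S} {A : LTy S.G}, LDer S Γ v A →
    ∀ x, x ∈ Γ.map Prod.fst ↔ v.Free x
  | _, _, _, .ax _ d, x => d.mem_iff_free x
  | _, _, _, .hyp _ _, x => by simp [LTm.Free]
  | _, _, _, .unitI, x => by simp [LTm.Free]
  | _, _, _, .unitE d e s, x => by
      rw [(s.map Prod.fst).mem_iff, d.mem_iff_free, e.mem_iff_free]; rfl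
  | _, _, _, .tensorI d e s, x => by
      rw [(s.map Prod.fst).mem_iff, d.mem_iff_free, e.mem_iff_free]; rfl
  | _, _, _, .tensorE (Δ := Δ) d e s, x => by
      have := e.mem_iff_free (x + 2)
      simp only [LCtx.bind₂, List.map_cons, List.mem_cons, LCtx.mem_shift] at this
      rw [(s.map Prod.fst).mem_iff, d.mem_iff_free, LTm.Free, ← this]
      simp
  | _, _, _, .lolliI (Γ := Γ) d, x => by
      have := d.mem_iff_free (x + 1)
      simp only [LCtx.bind, List.map_cons, List.mem_cons, LCtx.mem_shift] at this
      rw [LTm.Free, ← this]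
      simp
  | _, _, _, .lolliE d e s, x => by
      rw [(s.map Prod.fst).mem_iff, d.mem_iff_free, e.mem_iff_free]; rfl
theorem LDerArgs.mem_iff_free : ∀ {Γ : LCtx S} {as : LArgs S} {As : List (LTy S.G)},
    LDerArgs S Γ as As → ∀ x, x ∈ Γ.map Prod.fst ↔ as.Free x
  | _, _, _, .nil, x => by simp [LArgs.Free]
  | _, _, _, .snoc d e s, x => by
      rw [(s.map Prod.fst).mem_iff, d.mem_iff_free, e.mem_iff_free]; rfl
end

/-- A sublist of a context without repetitions is determined by the set of its variables. -/
theorem LCtx.Distinct.sublist_ext {E : LCtx S} (h : E.Distinct) {Γ Γ' : LCtx S}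
    (hΓ : Γ.Sublist E) (hΓ' : Γ'.Sublist E)
    (hx : ∀ x, x ∈ Γ.map Prod.fst ↔ x ∈ Γ'.map Prod.fst) : Γ = Γ' := by
  classical
  have key : ∀ {Γ : LCtx S}, Γ.Sublist E →
      Γ = E.filter (fun p => p.1 ∈ Γ.map Prod.fst) := by
    intro Γ hΓ
    refine List.Sublist.eq_of_length_le ?_ ?_
    · have := hΓ.filter (fun p => decide (p.1 ∈ Γ.map Prod.fst))
      rwa [List.filter_eq_self.2] at this
      intro p hp; simpa using ⟨p.2, hp⟩
    · refine (List.Nodup.subperm (h.nodup.filter _) ?_).length_le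
      intro p hp
      simp only [List.mem_filter, decide_eq_true_eq, List.mem_map] at hp
      obtain ⟨hpE, p', hp', e⟩ := hp
      have : p' = p := List.inj_on_of_nodup_map h (hΓ.subset hp') hpE e
      exact this ▸ hp'
  rw [key hΓ, key hΓ']
  congr 1
  funext p
  simp only [hx]

/-- The splitting of the context of a binary rule is determined by the subterms. -/
theorem Shuffle.ctx_unique {Γ Δ E Γ' Δ' : LCtx S} (h : E.Distinct) (s : Shuffle Γ Δ E)
    (s' : Shuffle Γ' Δ' E) (hΓ : ∀ x, x ∈ Γ.map Prod.fst ↔ x ∈ Γ'.map Prod.fst)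
    (hΔ : ∀ x, x ∈ Δ.map Prod.fst ↔ x ∈ Δ'.map Prod.fst) : Γ = Γ' ∧ Δ = Δ' :=
  ⟨h.sublist_ext s.sublist_left s'.sublist_left hΓ,
    h.sublist_ext s.sublist_right s'.sublist_right hΔ⟩

theorem LCtx.mem_bind₂_iff {Γ Γ' : LCtx S} {A B : LTy S.G}
    (h : ∀ x, x ∈ (Γ.bind₂ A B).map Prod.fst ↔ x ∈ (Γ'.bind₂ A B).map Prod.fst) (x : ℕ) :
    x ∈ Γ.map Prod.fst ↔ x ∈ Γ'.map Prod.fst := by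
  have := h (x + 2)
  simpa [LCtx.bind₂, LCtx.shift] using this

/-- Terms have at most one type in a context. -/
theorem LDer.type_unique : ∀ {Γ : LCtx S} {v : LTm S} {A A' : LTy S.G},
    LDer S Γ v A → LDer S Γ v A' → Γ.Distinct → A = A'
  | _, _, _, _, .ax _ _, d', _ => by cases d'; rfl
  | _, _, _, _, .hyp _ _, d', _ => by cases d'; rfl
  | _, _, _, _, .unitI, d', _ => by cases d'; rfl
  | _, _, _, _, .unitE d e s, d', h => by
      cases d' with
      | unitE d' e' s' =>
        obtain ⟨rfl, rfl⟩ := s.ctx_unique h s'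
          (fun x => by rw [d.mem_iff_free, d'.mem_iff_free])
          (fun x => by rw [e.mem_iff_free, e'.mem_iff_free])
        exact e.type_unique e' (h.right s)
  | _, _, _, _, .tensorI d e s, d', h => by
      cases d' with
      | tensorI d' e' s' =>
        obtain ⟨rfl, rfl⟩ := s.ctx_unique h s'
          (fun x => by rw [d.mem_iff_free, d'.mem_iff_free])
          (fun x => by rw [e.mem_iff_free, e'.mem_iff_free])
        rw [d.type_unique d' (h.left s), e.type_unique e' (h.right s)]
  | _, _, _, _, .tensorE (Δ := Δ) (A := A) (B := B) d e s, d', h => by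
      cases d' with
      | tensorE d' e' s' =>
        have hΓ := h.sublist_ext s.sublist_left s'.sublist_left
          (fun x => by rw [d.mem_iff_free, d'.mem_iff_free])
        subst hΓ
        have := d.type_unique d' (h.left s)
        obtain ⟨rfl, rfl⟩ := LTy.tensor.inj this
        have hΔ := h.sublist_ext s.sublist_right s'.sublist_right
          (LCtx.mem_bind₂_iff fun x => by rw [e.mem_iff_free, e'.mem_iff_free])
        subst hΔ
        exact e.type_unique e' ((h.right s).bind₂ _ _)
  | _, _, _, _, .lolliI d, d', h => by
      cases d' with
      | lolliI d' => rw [d.type_unique d' (h.bind _)]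
  | _, _, _, _, .lolliE d e s, d', h => by
      cases d' with
      | lolliE d' e' s' =>
        obtain ⟨rfl, rfl⟩ := s.ctx_unique h s'
          (fun x => by rw [d.mem_iff_free, d'.mem_iff_free])
          (fun x => by rw [e.mem_iff_free, e'.mem_iff_free])
        exact (LTy.lolli.inj (d.type_unique d' (h.left s))).2

mutual
/-- Judgements over contexts without repetitions have at most one derivation. -/
theorem LDer.unique : ∀ {Γ : LCtx S} {v : LTm S} {A : LTy S.G} (d d' : LDer S Γ v A),
    Γ.Distinct → d = d'
  | _, _, _, .ax _ d, d', h => by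
      cases d' with
      | ax _ d' => rw [d.unique d' h]
  | _, _, _, .hyp _ _, d', _ => by cases d'; rfl
  | _, _, _, .unitI, d', _ => by cases d'; rfl
  | _, _, _, .unitE d e s, d', h => by
      cases d' with
      | unitE d' e' s' =>
        obtain ⟨rfl, rfl⟩ := s.ctx_unique h s'
          (fun x => by rw [d.mem_iff_free, d'.mem_iff_free])
          (fun x => by rw [e.mem_iff_free, e'.mem_iff_free])
        rw [d.unique d' (h.left s), e.unique e' (h.right s), s.eq_of_nodup s' h.nodup]
  | _, _, _, .tensorI d e s, d', h => by
      cases d' with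
      | tensorI d' e' s' =>
        obtain ⟨rfl, rfl⟩ := s.ctx_unique h s'
          (fun x => by rw [d.mem_iff_free, d'.mem_iff_free])
          (fun x => by rw [e.mem_iff_free, e'.mem_iff_free])
        rw [d.unique d' (h.left s), e.unique e' (h.right s), s.eq_of_nodup s' h.nodup]
  | _, _, _, .tensorE d e s, d', h => by
      cases d' with
      | tensorE d' e' s' =>
        have hΓ := h.sublist_ext s.sublist_left s'.sublist_left
          (fun x => by rw [d.mem_iff_free, d'.mem_iff_free])
        subst hΓ
        obtain ⟨rfl, rfl⟩ := LTy.tensor.inj (d.type_unique d' (h.left s))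
        have hΔ := h.sublist_ext s.sublist_right s'.sublist_right
          (LCtx.mem_bind₂_iff fun x => by rw [e.mem_iff_free, e'.mem_iff_free])
        subst hΔ
        rw [d.unique d' (h.left s), e.unique e' ((h.right s).bind₂ _ _),
          s.eq_of_nodup s' h.nodup]
  | _, _, _, .lolliI d, d', h => by
      cases d' with
      | lolliI d' => rw [d.unique d' (h.bind _)]
  | _, _, _, .lolliE d e s, d', h => by
      cases d' with
      | lolliE d' e' s' =>
        obtain ⟨rfl, rfl⟩ := s.ctx_unique h s'
          (fun x => by rw [d.mem_iff_free, d'.mem_iff_free])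
          (fun x => by rw [e.mem_iff_free, e'.mem_iff_free])
        obtain rfl := e.type_unique e' (h.right s)
        rw [d.unique d' (h.left s), e.unique e' (h.right s), s.eq_of_nodup s' h.nodup]
theorem LDerArgs.unique : ∀ {Γ : LCtx S} {as : LArgs S} {As : List (LTy S.G)}
    (d d' : LDerArgs S Γ as As), Γ.Distinct → d = d'
  | _, _, _, .nil, d', _ => by cases d'; rfl
  | _, _, _, .snoc d e s, d', h => by
      cases d' with
      | snoc d' e' s' =>
        obtain ⟨rfl, rfl⟩ := s.ctx_unique h s'
          (fun x => by rw [d.mem_iff_free, d'.mem_iff_free])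
          (fun x => by rw [e.mem_iff_free, e'.mem_iff_free])
        rw [d.unique d' (h.left s), e.unique e' (h.right s), s.eq_of_nodup s' h.nodup]
end

end Derivations

/-! ### Splitting tensor products along shuffles -/

section Coherence

variable {C : Type u'} [Category.{v} C] [MonoidalCategory C] [SymmetricCategory C]

/-- The exchange of the last two factors of a threefold tensor product. -/
def swapLast (X Y Z : C) : (X ⊗ Y) ⊗ Z ⟶ (X ⊗ Z) ⊗ Y :=
  (α_ X Y Z).hom ≫ X ◁ (β_ Y Z).hom ≫ (α_ X Z Y).inv

theorem swapLast_natural {X Y Z X' Y' Z' : C} (f : X ⟶ X') (g : Y ⟶ Y') (h : Z ⟶ Z') :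
    ((f ⊗ₘ g) ⊗ₘ h) ≫ swapLast X' Y' Z' = swapLast X Y Z ≫ ((f ⊗ₘ h) ⊗ₘ g) := by
  simp only [swapLast, Category.assoc, associator_naturality_assoc]
  rw [← associator_inv_naturality, ← id_tensorHom, ← id_tensorHom, tensorHom_comp_tensorHom_assoc,
    tensorHom_comp_tensorHom_assoc, BraidedCategory.braiding_naturality]
  simp

theorem swapLast_braiding (X Y Z : C) :
    swapLast X Y Z ≫ (β_ (X ⊗ Z) Y).hom = (β_ X Y).hom ▷ Z ≫ (α_ Y X Z).hom := by
  simp only [swapLast, BraidedCategory.braiding_tensor_left_hom, Category.assoc,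
    Iso.inv_hom_id_assoc, ← whiskerLeft_comp_assoc, SymmetricCategory.symmetry]
  simp

theorem braiding_swapLast (X Y Z : C) :
    (β_ X Y).hom ▷ Z ≫ swapLast Y X Z = (α_ X Y Z).hom ≫ (β_ X (Y ⊗ Z)).hom := by
  simp [swapLast, BraidedCategory.braiding_tensor_right_hom]

theorem swapLast_natural_left {X X' : C} (f : X ⟶ X') (Y Z : C) :
    (f ▷ Y ▷ Z) ≫ swapLast X' Y Z = swapLast X Y Z ≫ (f ▷ Z ▷ Y) := by
  have := swapLast_natural f (𝟙 Y) (𝟙 Z)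
  simpa only [tensorHom_id] using this

theorem swapLast_natural_middle (X : C) {Y Y' : C} (g : Y ⟶ Y') (Z : C) :
    ((X ◁ g) ▷ Z) ≫ swapLast X Y' Z = swapLast X Y Z ≫ ((X ⊗ Z) ◁ g) := by
  have := swapLast_natural (𝟙 X) g (𝟙 Z)
  rwa [tensorHom_id, id_tensorHom, id_tensorHom_id, id_tensorHom] at this

theorem swapLast_assoc_left (X Y Z W : C) :
    swapLast (X ⊗ Y) Z W ≫ (swapLast X Y W ▷ Z) ≫ (α_ (X ⊗ W) Y Z).hom =
      ((α_ X Y Z).hom ▷ W) ≫ swapLast X (Y ⊗ Z) W := by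
  simp only [swapLast, BraidedCategory.braiding_tensor_left_hom]
  monoidal

theorem swapLast_assoc_middle (X Y Z W : C) :
    swapLast (X ⊗ Y) Z W ≫ ((α_ X Y W).hom ▷ Z) ≫ (α_ X (Y ⊗ W) Z).hom =
      ((α_ X Y Z).hom ▷ W) ≫ (α_ X (Y ⊗ Z) W).hom ≫ (X ◁ swapLast Y Z W) := by
  simp only [swapLast]
  monoidal

/-- The inductive step for the naturality of `Shuffle.split` under a head entry of type `A`. In this
lemma and the ones below the objects `W`, `G`, … are arbitrary and come with isomorphisms `i`, `j`
onto tensor products, because the interpretation of a list `a :: Γ` is the tensor product with that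
of `Γ` only along `snocIso`: it has no unit factor if `Γ` is empty. -/
theorem split_left_natural {W W' E E' A G G' X X' Y Y' : C} {i : W ≅ E ⊗ A} {i' : W' ≅ E' ⊗ A}
    {j : G ≅ X ⊗ A} {j' : G' ≅ X' ⊗ A} {r : W ⟶ W'} {e : E ⟶ E'} {g : G ⟶ G'} {f : X ⟶ X'}
    {k : Y ⟶ Y'} {s : E ⟶ X ⊗ Y} {s' : E' ⟶ X' ⊗ Y'} (hr : r = i.hom ≫ (e ▷ A) ≫ i'.inv)
    (hg : g = j.hom ≫ (f ▷ A) ≫ j'.inv) (h : e ≫ s' = s ≫ (f ⊗ₘ k)) :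
    r ≫ i'.hom ≫ (s' ▷ A) ≫ swapLast X' Y' A ≫ (j'.inv ▷ Y') =
      (i.hom ≫ (s ▷ A) ≫ swapLast X Y A ≫ (j.inv ▷ Y)) ≫ (g ⊗ₘ k) := by
  have h₁ := swapLast_natural f k (𝟙 A)
  simp only [tensorHom_id] at h₁
  subst hr hg
  simp only [Category.assoc, Iso.inv_hom_id_assoc]
  rw [← comp_whiskerRight_assoc, h, comp_whiskerRight_assoc, reassoc_of% h₁,
    ← tensorHom_id j'.inv, tensorHom_comp_tensorHom, ← tensorHom_id j.inv,
    tensorHom_comp_tensorHom]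
  simp

theorem split_right_natural {W W' E E' A G G' X X' Y Y' : C} {i : W ≅ E ⊗ A} {i' : W' ≅ E' ⊗ A}
    {j : G ≅ Y ⊗ A} {j' : G' ≅ Y' ⊗ A} {r : W ⟶ W'} {e : E ⟶ E'} {g : G ⟶ G'} {f : X ⟶ X'}
    {k : Y ⟶ Y'} {s : E ⟶ X ⊗ Y} {s' : E' ⟶ X' ⊗ Y'} (hr : r = i.hom ≫ (e ▷ A) ≫ i'.inv)
    (hg : g = j.hom ≫ (k ▷ A) ≫ j'.inv) (h : e ≫ s' = s ≫ (f ⊗ₘ k)) :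
    r ≫ i'.hom ≫ (s' ▷ A) ≫ (α_ X' Y' A).hom ≫ (X' ◁ j'.inv) =
      (i.hom ≫ (s ▷ A) ≫ (α_ X Y A).hom ≫ (X ◁ j.inv)) ≫ (f ⊗ₘ g) := by
  have h₁ := associator_naturality f k (𝟙 A)
  simp only [tensorHom_id] at h₁
  subst hr hg
  simp only [Category.assoc, Iso.inv_hom_id_assoc]
  rw [← comp_whiskerRight_assoc, h, comp_whiskerRight_assoc, reassoc_of% h₁,
    ← id_tensorHom X' j'.inv, tensorHom_comp_tensorHom, ← id_tensorHom X j.inv,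
    tensorHom_comp_tensorHom]
  simp

/-! ### Naturality of the interpretation of the term formers -/

section TermFormers

variable {E E' G G' D D' A B K K' Z : C} {r : E ⟶ E'} {s : E ⟶ G ⊗ D} {s' : E' ⟶ G' ⊗ D'}
  {a : G ⟶ G'} {b : D ⟶ D'}

theorem pair_natural {f : G' ⟶ A} {g : D' ⟶ B} (h : r ≫ s' = s ≫ (a ⊗ₘ b)) :
    r ≫ s' ≫ (f ⊗ₘ g) = s ≫ (a ≫ f ⊗ₘ b ≫ g) := by
  rw [reassoc_of% h, tensorHom_comp_tensorHom]

theorem pair_comp_natural {f : G' ⟶ A} {g : D' ⟶ B} {k : A ⊗ B ⟶ Z}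
    (h : r ≫ s' = s ≫ (a ⊗ₘ b)) :
    r ≫ s' ≫ (f ⊗ₘ g) ≫ k = s ≫ (a ≫ f ⊗ₘ b ≫ g) ≫ k := by
  rw [reassoc_of% h, tensorHom_comp_tensorHom_assoc]

theorem letStar_natural {f : G' ⟶ 𝟙_ C} {g : D' ⟶ A} (h : r ≫ s' = s ≫ (a ⊗ₘ b)) :
    r ≫ s' ≫ (f ▷ D') ≫ (λ_ D').hom ≫ g = s ≫ ((a ≫ f) ▷ D) ≫ (λ_ D).hom ≫ b ≫ g := by
  rw [reassoc_of% h, ← leftUnitor_naturality_assoc, ← id_tensorHom, ← tensorHom_id,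
    tensorHom_comp_tensorHom_assoc, ← tensorHom_id, tensorHom_comp_tensorHom_assoc]
  simp

/-- Here `j` and `j'` stand for the morphisms which append two variables to a context. -/
theorem pm_natural {f : G' ⟶ A ⊗ B} {j : (D ⊗ A) ⊗ B ⟶ K} {j' : (D' ⊗ A) ⊗ B ⟶ K'} {k : K ⟶ K'}
    {g : K' ⟶ Z} (h : r ≫ s' = s ≫ (a ⊗ₘ b)) (hk : (b ▷ A ▷ B) ≫ j' = j ≫ k) :
    r ≫ s' ≫ (f ▷ D') ≫ (β_ (A ⊗ B) D').hom ≫ (α_ D' A B).inv ≫ j' ≫ g =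
      s ≫ ((a ≫ f) ▷ D) ≫ (β_ (A ⊗ B) D).hom ≫ (α_ D A B).inv ≫ j ≫ k ≫ g := by
  rw [reassoc_of% h, ← reassoc_of% hk, ← associator_inv_naturality_left_assoc,
    ← BraidedCategory.braiding_naturality_right_assoc, ← id_tensorHom, ← tensorHom_id,
    tensorHom_comp_tensorHom_assoc, ← tensorHom_id, tensorHom_comp_tensorHom_assoc]
  simp

theorem lam_natural [MonoidalClosed C] {j : D ⊗ A ⟶ K} {j' : D' ⊗ A ⟶ K'} {k : K ⟶ K'}
    {g : K' ⟶ Z} (hk : (b ▷ A) ≫ j' = j ≫ k) :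
    b ≫ LInterp.transpose (j' ≫ g) = LInterp.transpose (j ≫ k ≫ g) := by
  rw [LInterp.transpose, LInterp.transpose, ← reassoc_of% hk,
    ← BraidedCategory.braiding_naturality_right_assoc, MonoidalClosed.curry_natural_left]

theorem join_natural {W W' : C} {i : W ≅ E ⊗ B} {i' : W' ≅ E' ⊗ B} {f : G ⟶ E} {f' : G' ⟶ E'}
    {e : E ⟶ E'} {g : W ⟶ W'} (hf : a ≫ f' = f ≫ e) (hg : g = i.hom ≫ (e ▷ B) ≫ i'.inv) :
    (a ▷ B) ≫ (f' ▷ B) ≫ i'.inv = ((f ▷ B) ≫ i.inv) ≫ g := by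
  subst hg
  rw [← comp_whiskerRight_assoc, hf]
  simp

/-- If a simultaneous substitution `d ⊗ e` is split along a shuffle whose head lies in the first
part, then the substituent `e` moves to the first component. The hypothesis `h` is the same
statement for `d`, and `h'` the compatibility of the shuffles of the resulting contexts. -/
theorem subst_left {W T X Y L P Q H N : C} {e : Y ⟶ A} {i : W ≅ T ⊗ A} {j : L ≅ P ⊗ A}
    {s₂ : H ⟶ X ⊗ Y} {d : X ⟶ T} {t₀ : T ⟶ P ⊗ Q} {t : X ⟶ G ⊗ D} {d₁ : G ⟶ P} {d₂ : D ⟶ Q}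
    {r₁ : N ⟶ G ⊗ Y} {r₂ : H ⟶ N ⊗ D} (h : d ≫ t₀ = t ≫ (d₁ ⊗ₘ d₂))
    (h' : s₂ ≫ (t ▷ Y) ≫ swapLast G D Y = r₂ ≫ (r₁ ▷ D)) :
    (s₂ ≫ (d ⊗ₘ e) ≫ i.inv) ≫ i.hom ≫ (t₀ ▷ A) ≫ swapLast P Q A ≫ (j.inv ▷ Q) =
      r₂ ≫ ((r₁ ≫ (d₁ ⊗ₘ e) ≫ j.inv) ⊗ₘ d₂) := by
  have h₁ := swapLast_natural d₁ d₂ e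
  have h₂ : (d ⊗ₘ e) ≫ (t₀ ▷ A) = (t ▷ Y) ≫ ((d₁ ⊗ₘ d₂) ⊗ₘ e) := by
    rw [← tensorHom_id, ← tensorHom_id, tensorHom_comp_tensorHom, h, tensorHom_comp_tensorHom]
    simp
  simp only [Category.assoc, Iso.inv_hom_id_assoc]
  rw [reassoc_of% h₂, reassoc_of% h₁, reassoc_of% h', ← tensorHom_id j.inv,
    tensorHom_comp_tensorHom, ← tensorHom_id r₁, tensorHom_comp_tensorHom]
  simp

/-- The counterpart of `subst_left` for a head in the second part. -/
theorem subst_right {W T X Y L P Q H N : C} {e : Y ⟶ A} {i : W ≅ T ⊗ A} {j : L ≅ Q ⊗ A}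
    {s₂ : H ⟶ X ⊗ Y} {d : X ⟶ T} {t₀ : T ⟶ P ⊗ Q} {t : X ⟶ G ⊗ D} {d₁ : G ⟶ P} {d₂ : D ⟶ Q}
    {r₁ : N ⟶ D ⊗ Y} {r₂ : H ⟶ G ⊗ N} (h : d ≫ t₀ = t ≫ (d₁ ⊗ₘ d₂))
    (h' : s₂ ≫ (t ▷ Y) ≫ (α_ G D Y).hom = r₂ ≫ (G ◁ r₁)) :
    (s₂ ≫ (d ⊗ₘ e) ≫ i.inv) ≫ i.hom ≫ (t₀ ▷ A) ≫ (α_ P Q A).hom ≫ (P ◁ j.inv) =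
      r₂ ≫ (d₁ ⊗ₘ (r₁ ≫ (d₂ ⊗ₘ e) ≫ j.inv)) := by
  have h₂ : (d ⊗ₘ e) ≫ (t₀ ▷ A) = (t ▷ Y) ≫ ((d₁ ⊗ₘ d₂) ⊗ₘ e) := by
    rw [← tensorHom_id, ← tensorHom_id, tensorHom_comp_tensorHom, h, tensorHom_comp_tensorHom]
    simp
  simp only [Category.assoc, Iso.inv_hom_id_assoc]
  rw [reassoc_of% h₂, associator_naturality_assoc, reassoc_of% h', ← id_tensorHom P j.inv,
    tensorHom_comp_tensorHom, ← id_tensorHom G r₁, tensorHom_comp_tensorHom]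
  simp

end TermFormers

/-! ### Coherence of shuffles -/

namespace Shuffle

variable {α : Type u} (F : α → C) {Γ Δ E : List α}

theorem split_left (a : α) (s : Shuffle Γ Δ E) :
    (s.left a).split F = (snocIso F a E).hom ≫ (s.split F ▷ F a) ≫
      swapLast (tens F Γ) (tens F Δ) (F a) ≫ ((snocIso F a Γ).inv ▷ tens F Δ) := by
  simp [Shuffle.split, swapLast]

theorem split_right (a : α) (s : Shuffle Γ Δ E) :
    (s.right a).split F = (snocIso F a E).hom ≫ (s.split F ▷ F a) ≫
      (α_ _ _ _).hom ≫ (tens F Γ ◁ (snocIso F a Δ).inv) := by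
  simp [Shuffle.split]

theorem split_nil : (Shuffle.nil : Shuffle ([] : List α) [] []).split F = (λ_ (𝟙_ C)).inv := by
  rfl

theorem split_swap (s : Shuffle Γ Δ E) :
    s.swap.split F = s.split F ≫ (β_ (tens F Γ) (tens F Δ)).hom := by
  induction s with
  | nil =>
    simp only [swap, split_nil]
    change (λ_ (𝟙_ C)).inv = (λ_ (𝟙_ C)).inv ≫ (β_ (𝟙_ C) (𝟙_ C)).hom
    rw [leftUnitor_inv_braiding, unitors_inv_equal]
  | left a s ih =>
    rw [swap, split_right, split_left, ih]
    simp only [Category.assoc, comp_whiskerRight, BraidedCategory.braiding_naturality_left]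
    rw [← Category.assoc (swapLast _ _ _), swapLast_braiding]
    simp
  | right a s ih =>
    rw [swap, split_right, split_left, ih]
    simp only [Category.assoc, comp_whiskerRight, BraidedCategory.braiding_naturality_right]
    rw [← Category.assoc _ (swapLast _ _ _), braiding_swapLast]
    simp

theorem assoc_left_left {Θ G H : List α} (a : α) {s₁ : Shuffle Γ Δ E} {s₂ : Shuffle E Θ H}
    {r₁ : Shuffle Δ Θ G} {r₂ : Shuffle Γ G H}
    (h : s₂.split F ≫ (s₁.split F ▷ tens F Θ) ≫ (α_ _ _ _).hom =
      r₂.split F ≫ (tens F Γ ◁ r₁.split F)) :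
    (s₂.left a).split F ≫ ((s₁.left a).split F ▷ tens F Θ) ≫ (α_ _ _ _).hom =
      (r₂.left a).split F ≫ (tens F (a :: Γ) ◁ r₁.split F) := by
  have h' := congrArg (fun f => f ▷ F a) h
  simp only [comp_whiskerRight] at h'
  simp only [split_left, Category.assoc, comp_whiskerRight, associator_naturality_left]
  rw [← comp_whiskerRight_assoc, Iso.inv_hom_id, id_whiskerRight, Category.id_comp,
    ← reassoc_of% swapLast_natural_left, reassoc_of% swapLast_assoc_left, reassoc_of% h',
    reassoc_of% swapLast_natural_middle, whisker_exchange]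

theorem assoc_right_left {Θ G H : List α} (a : α) {s₁ : Shuffle Γ Δ E} {s₂ : Shuffle E Θ H}
    {r₁ : Shuffle Δ Θ G} {r₂ : Shuffle Γ G H}
    (h : s₂.split F ≫ (s₁.split F ▷ tens F Θ) ≫ (α_ _ _ _).hom =
      r₂.split F ≫ (tens F Γ ◁ r₁.split F)) :
    (s₂.left a).split F ≫ ((s₁.right a).split F ▷ tens F Θ) ≫ (α_ _ _ _).hom =
      (r₂.right a).split F ≫ (tens F Γ ◁ (r₁.left a).split F) := by
  have h' := congrArg (fun f => f ▷ F a) h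
  simp only [comp_whiskerRight] at h'
  simp only [split_left, split_right, Category.assoc, comp_whiskerRight,
    MonoidalCategory.whiskerLeft_comp, whiskerLeft_inv_hom_assoc,
    associator_naturality_middle]
  rw [← comp_whiskerRight_assoc, Iso.inv_hom_id, id_whiskerRight, Category.id_comp,
    ← reassoc_of% swapLast_natural_left, reassoc_of% swapLast_assoc_middle, reassoc_of% h',
    associator_naturality_middle_assoc]

theorem assoc_right_right {Θ G H : List α} (a : α) {s₁ : Shuffle Γ Δ E} {s₂ : Shuffle E Θ H}
    {r₁ : Shuffle Δ Θ G} {r₂ : Shuffle Γ G H}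
    (h : s₂.split F ≫ (s₁.split F ▷ tens F Θ) ≫ (α_ _ _ _).hom =
      r₂.split F ≫ (tens F Γ ◁ r₁.split F)) :
    (s₂.right a).split F ≫ (s₁.split F ▷ tens F (a :: Θ)) ≫ (α_ _ _ _).hom =
      (r₂.right a).split F ≫ (tens F Γ ◁ (r₁.right a).split F) := by
  have h' := congrArg (fun f => f ▷ F a) h
  simp only [comp_whiskerRight] at h'
  simp only [split_right, Category.assoc, MonoidalCategory.whiskerLeft_comp,
    whiskerLeft_inv_hom_assoc]
  rw [whisker_exchange_assoc, ← associator_naturality_left_assoc, associator_naturality_right,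
    ← pentagon_assoc, reassoc_of% h', associator_naturality_middle_assoc]

theorem assoc_nil :
    (Shuffle.nil : Shuffle ([] : List α) [] []).split F ≫
        ((Shuffle.nil : Shuffle ([] : List α) [] []).split F ▷ tens F []) ≫ (α_ _ _ _).hom =
      (Shuffle.nil : Shuffle ([] : List α) [] []).split F ≫
        (tens F [] ◁ (Shuffle.nil : Shuffle ([] : List α) [] []).split F) := by
  have key : (λ_ (𝟙_ C)).inv ≫ ((λ_ (𝟙_ C)).inv ▷ (𝟙_ C)) ≫ (α_ (𝟙_ C) (𝟙_ C) (𝟙_ C)).hom =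
      (λ_ (𝟙_ C)).inv ≫ ((𝟙_ C) ◁ (λ_ (𝟙_ C)).inv) := by monoidal
  exact key

/-- Reassociation of iterated shuffles, compatibly with the canonical morphisms. -/
theorem exists_assoc {Θ H : List α} (s₁ : Shuffle Γ Δ E) (s₂ : Shuffle E Θ H) :
    ∃ (G : List α) (r₁ : Shuffle Δ Θ G) (r₂ : Shuffle Γ G H),
      s₂.split F ≫ (s₁.split F ▷ tens F Θ) ≫ (α_ _ _ _).hom =
        r₂.split F ≫ (tens F Γ ◁ r₁.split F) := by
  induction s₂ generalizing Γ Δ with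
  | nil => cases s₁; exact ⟨[], .nil, .nil, assoc_nil F⟩
  | left a s₂ ih =>
    cases s₁ with
    | left _ s₁ =>
      obtain ⟨G, r₁, r₂, h⟩ := ih s₁
      exact ⟨G, r₁, .left a r₂, assoc_left_left F a h⟩
    | right _ s₁ =>
      obtain ⟨G, r₁, r₂, h⟩ := ih s₁
      exact ⟨a :: G, .left a r₁, .right a r₂, assoc_right_left F a h⟩
  | right a s₂ ih =>
    obtain ⟨G, r₁, r₂, h⟩ := ih s₁
    exact ⟨a :: G, .right a r₁, .right a r₂, assoc_right_right F a h⟩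

/-- Reassociation of iterated shuffles in the opposite direction. -/
theorem exists_assoc_symm {Θ G H : List α} (r₁ : Shuffle Δ Θ G) (r₂ : Shuffle Γ G H) :
    ∃ (E : List α) (s₁ : Shuffle Γ Δ E) (s₂ : Shuffle E Θ H),
      s₂.split F ≫ (s₁.split F ▷ tens F Θ) ≫ (α_ _ _ _).hom =
        r₂.split F ≫ (tens F Γ ◁ r₁.split F) := by
  induction r₂ generalizing Δ Θ with
  | nil => cases r₁; exact ⟨[], .nil, .nil, assoc_nil F⟩
  | left a r₂ ih =>
    obtain ⟨E, s₁, s₂, h⟩ := ih r₁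
    exact ⟨a :: E, .left a s₁, .left a s₂, assoc_left_left F a h⟩
  | right a r₂ ih =>
    cases r₁ with
    | left _ r₁ =>
      obtain ⟨E, s₁, s₂, h⟩ := ih r₁
      exact ⟨a :: E, .right a s₁, .left a s₂, assoc_right_left F a h⟩
    | right _ r₁ =>
      obtain ⟨E, s₁, s₂, h⟩ := ih r₁
      exact ⟨E, s₁, .right a s₂, assoc_right_right F a h⟩

theorem exists_swapLast {Θ H : List α} (s₁ : Shuffle Γ Δ E) (s₂ : Shuffle E Θ H) :
    ∃ (G : List α) (r₁ : Shuffle Γ Θ G) (r₂ : Shuffle G Δ H),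
      s₂.split F ≫ (s₁.split F ▷ tens F Θ) ≫ swapLast _ _ _ =
        r₂.split F ≫ (r₁.split F ▷ tens F Δ) := by
  obtain ⟨G, r₁, r₂, h⟩ := exists_assoc F s₁.swap s₂
  refine ⟨G, r₁, r₂.swap, ?_⟩
  rw [split_swap, Category.assoc, ← BraidedCategory.braiding_naturality_right, ← reassoc_of% h,
    split_swap, comp_whiskerRight, Category.assoc, ← reassoc_of% swapLast_braiding,
    SymmetricCategory.symmetry, Category.comp_id]

theorem split_allLeft : ∀ Γ : List α, (allLeft Γ).split F = (ρ_ (tens F Γ)).inv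
  | [] => unitors_inv_equal (C := C)
  | a :: Γ => by
    have key : ∀ {X Y W : C} (i : W ≅ X ⊗ Y), i.hom ≫ ((ρ_ X).inv ▷ Y) ≫
        swapLast X (𝟙_ C) Y ≫ (i.inv ▷ 𝟙_ C) = (ρ_ W).inv := by
      intro X Y W i
      rw [swapLast, braiding_tensorUnit_left]
      simp
    rw [allLeft, split_left, split_allLeft Γ]
    exact key (snocIso F a Γ)

theorem split_allRight (Δ : List α) : (allRight Δ).split F = (λ_ (tens F Δ)).inv := by
  have : allRight Δ = (allLeft Δ).swap := by
    induction Δ with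
    | nil => rfl
    | cons a Δ ih => rw [allRight, allLeft, swap, ih]
  rw [this, split_swap, split_allLeft]
  exact rightUnitor_inv_braiding _

/-- Splitting off the head of a list undoes `snocIso`. -/
theorem split_right_allLeft (a : α) (Γ : List α) :
    ((allLeft Γ).right a).split F = (snocIso F a Γ).hom := by
  have key : ∀ {X Y W : C} (i : W ⟶ X ⊗ Y),
      i ≫ ((ρ_ X).inv ▷ Y) ≫ (α_ X (𝟙_ C) Y).hom ≫ (X ◁ (λ_ Y).hom) = i := by
    intro X Y W i; simp
  rw [split_right, split_allLeft]
  exact key (snocIso F a Γ).hom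

theorem eq_of_nil_left {Δ E : List α} : ∀ s : Shuffle [] Δ E, ∃ h : E = Δ, s = h ▸ allRight Δ
  | .nil => ⟨rfl, rfl⟩
  | .right a s => by
    obtain ⟨rfl, h⟩ := eq_of_nil_left s
    exact ⟨rfl, by rw [h]; rfl⟩

end Shuffle
end Coherence

/-! ### Renaming and substitution of derivations, with their denotations -/

section Denotations

theorem eqToHom_snoc {C : Type u'} [Category.{v} C] [MonoidalCategory C] {X X' Y : C}
    (h : X = X') (h' : X ⊗ Y = X' ⊗ Y) :
    eqToHom h' = (Iso.refl (X ⊗ Y)).hom ≫ (eqToHom h ▷ Y) ≫ (Iso.refl (X' ⊗ Y)).inv := by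
  subst h; simp

variable {S : LSig.{u, u₂}} {C : Type u'} [Category.{v} C] [MonoidalCategory C] [MonoidalClosed C]

namespace LInterp

theorem ctx_congr (M : LInterp S C) : ∀ {Γ Γ' : LCtx S},
    Γ.map Prod.snd = Γ'.map Prod.snd → M.ctx Γ = M.ctx Γ'
  | [], [], _ => rfl
  | [], _ :: _, h => by simp at h
  | _ :: _, [], h => by simp at h
  | [p], [p'], h => by
      have : p.2 = p'.2 := by simpa using h
      change M.ty p.2 = M.ty p'.2
      rw [this]
  | [_], _ :: _ :: _, h => by simp at h
  | _ :: _ :: _, [_], h => by simp at h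
  | p :: q :: Γ, p' :: q' :: Γ', h => by
      have h₁ : p.2 = p'.2 := by simp at h; exact h.1
      have h₂ := M.ctx_congr (Γ := q :: Γ) (Γ' := q' :: Γ') (by simpa using (List.cons.inj h).2)
      change M.ctx (q :: Γ) ⊗ M.ty p.2 = M.ctx (q' :: Γ') ⊗ M.ty p'.2
      rw [h₁, h₂]

/-- The identification of the interpretations of two contexts with the same types. -/
def retag (M : LInterp S C) {Γ Γ' : LCtx S} (h : Γ.map Prod.snd = Γ'.map Prod.snd) :
    M.ctx Γ ⟶ M.ctx Γ' :=
  eqToHom (M.ctx_congr h)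

theorem retag_trans (M : LInterp S C) {Γ Γ' Γ'' : LCtx S} (h : Γ.map Prod.snd = Γ'.map Prod.snd)
    (h' : Γ'.map Prod.snd = Γ''.map Prod.snd) :
    M.retag h ≫ M.retag h' = M.retag (h.trans h') := by
  simp [retag]

theorem map_snd_of_shift {n : ℕ} {Γ : LCtx S} : Γ.map Prod.snd = (Γ.shift n).map Prod.snd := by
  simp [LCtx.shift]

theorem shiftHom_eq (M : LInterp S C) (n : ℕ) (Γ : LCtx S) :
    M.shiftHom n Γ = M.retag map_snd_of_shift := rfl

theorem retag_cons (M : LInterp S C) {x y : ℕ} {A : LTy S.G} : ∀ {Γ Γ' : LCtx S}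
    (h : Γ.map Prod.snd = Γ'.map Prod.snd)
    (h' : List.map Prod.snd ((x, A) :: Γ) = List.map Prod.snd ((y, A) :: Γ')),
    M.retag h' = (snocIso (fun p : ℕ × LTy S.G => M.ty p.2) (x, A) Γ).hom ≫
      (M.retag h ▷ M.ty A) ≫ (snocIso (fun p : ℕ × LTy S.G => M.ty p.2) (y, A) Γ').inv
  | [], [], _, _ => by
      have key : 𝟙 (M.ty A) = (λ_ (M.ty A)).inv ≫ (𝟙 (𝟙_ C) ▷ M.ty A) ≫ (λ_ (M.ty A)).hom := by
        simp
      exact key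
  | [], _ :: _, h, _ => by simp at h
  | _ :: _, [], h, _ => by simp at h
  | _ :: _, _ :: _, h, h' => eqToHom_snoc (M.ctx_congr h) (M.ctx_congr h')

end LInterp

/-- Renaming of the variables of a context. -/
abbrev LCtx.ren (ρ : ℕ → ℕ) (Γ : LCtx S) : LCtx S := Γ.map (fun p => (ρ p.1, p.2))

theorem LCtx.map_snd_ren (ρ : ℕ → ℕ) (Γ : LCtx S) :
    Γ.map Prod.snd = (Γ.ren ρ).map Prod.snd := by
  simp [LCtx.ren]

theorem LCtx.ren_bind (ρ : ℕ → ℕ) (Γ : LCtx S) (A : LTy S.G) :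
    (Γ.bind A).ren (upRen ρ) = (Γ.ren ρ).bind A := by
  simp [LCtx.ren, LCtx.bind, LCtx.shift, upRen]

theorem LCtx.ren_bind₂ (ρ : ℕ → ℕ) (Γ : LCtx S) (A B : LTy S.G) :
    (Γ.bind₂ A B).ren (upRen (upRen ρ)) = (Γ.ren ρ).bind₂ A B := by
  simp [LCtx.ren, LCtx.bind₂, LCtx.shift, upRen]

variable [SymmetricCategory C]

namespace LInterp

/-- Renaming is compatible with shuffles. -/
theorem retag_split (M : LInterp S C) (ρ : ℕ → ℕ) {Γ Δ E : LCtx S} (s : Shuffle Γ Δ E) :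
    M.retag (LCtx.map_snd_ren ρ E) ≫
        (s.map (fun p => (ρ p.1, p.2))).split (fun p : ℕ × LTy S.G => M.ty p.2) =
      s.split (fun p : ℕ × LTy S.G => M.ty p.2) ≫
        (M.retag (LCtx.map_snd_ren ρ Γ) ⊗ₘ M.retag (LCtx.map_snd_ren ρ Δ)) := by
  induction s with
  | nil =>
    have key : 𝟙 (𝟙_ C) ≫ (λ_ (𝟙_ C)).inv = (λ_ (𝟙_ C)).inv ≫ (𝟙 (𝟙_ C) ⊗ₘ 𝟙 (𝟙_ C)) := by simp
    exact key
  | @left a Γ Δ E s ih =>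
    rw [Shuffle.map, Shuffle.split_left, Shuffle.split_left]
    exact split_left_natural (M.retag_cons (LCtx.map_snd_ren ρ E) _)
      (M.retag_cons (LCtx.map_snd_ren ρ Γ) _) ih
  | @right a Γ Δ E s ih =>
    rw [Shuffle.map, Shuffle.split_right, Shuffle.split_right]
    exact split_right_natural (M.retag_cons (LCtx.map_snd_ren ρ E) _)
      (M.retag_cons (LCtx.map_snd_ren ρ Δ) _) ih

theorem retag_join₁ (M : LInterp S C) {Γ Γ' : LCtx S} (A : LTy S.G)
    (h : Γ.map Prod.snd = Γ'.map Prod.snd)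
    (h' : (Γ.bind A).map Prod.snd = (Γ'.bind A).map Prod.snd) :
    (M.retag h ▷ M.ty A) ≫ M.join₁ Γ' A = M.join₁ Γ A ≫ M.retag h' := by
  have h₁ := M.retag_cons (map_snd_of_shift.symm.trans (h.trans map_snd_of_shift)) h'
  exact join_natural (by rw [shiftHom_eq, shiftHom_eq, retag_trans, retag_trans]) h₁

theorem retag_join₂ (M : LInterp S C) {Γ Γ' : LCtx S} (A B : LTy S.G)
    (h : Γ.map Prod.snd = Γ'.map Prod.snd)
    (h' : (Γ.bind₂ A B).map Prod.snd = (Γ'.bind₂ A B).map Prod.snd) :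
    (M.retag h ▷ M.ty A ▷ M.ty B) ≫ M.join₂ Γ' A B = M.join₂ Γ A B ≫ M.retag h' := by
  have h₀ : (Γ.shift 2).map Prod.snd = (Γ'.shift 2).map Prod.snd :=
    map_snd_of_shift.symm.trans (h.trans map_snd_of_shift)
  have h₁ : List.map Prod.snd ((1, A) :: Γ.shift 2) = List.map Prod.snd ((1, A) :: Γ'.shift 2) := by
    rw [List.map_cons, List.map_cons, h₀]
  refine join_natural ?_ (M.retag_cons h₁ h')
  exact join_natural (by rw [shiftHom_eq, shiftHom_eq, retag_trans, retag_trans])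
    (M.retag_cons h₀ h₁)

end LInterp

mutual
/-- Derivations are stable under renaming, and the denotation is unchanged. -/
theorem LDer.exists_rename (M : LInterp S C) : ∀ {Γ Γ' : LCtx S} {v : LTm S} {A : LTy S.G}
    (d : LDer S Γ v A) (ρ : ℕ → ℕ) (_ : Γ' = Γ.ren ρ) (h' : Γ.map Prod.snd = Γ'.map Prod.snd),
    ∃ d' : LDer S Γ' (v.rename ρ) A, M.retag h' ≫ M.den d' = M.den d
  | _, _, _, _, .ax f d, ρ, h, h' => by
      obtain ⟨d', hd⟩ := d.exists_rename M ρ h h'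
      exact ⟨.ax f d', by simp only [LInterp.den, ← hd, Category.assoc]⟩
  | _, _, _, _, .hyp x A, ρ, h, h' => by
      subst h
      exact ⟨.hyp (ρ x) A, Category.id_comp _⟩
  | _, _, _, _, .unitI, ρ, h, h' => by
      subst h
      exact ⟨.unitI, Category.id_comp _⟩
  | _, _, _, _, .unitE d e s, ρ, h, h' => by
      subst h
      obtain ⟨d', hd⟩ := d.exists_rename M ρ rfl (LCtx.map_snd_ren ρ _)
      obtain ⟨e', he⟩ := e.exists_rename M ρ rfl (LCtx.map_snd_ren ρ _)
      refine ⟨.unitE d' e' (s.map _), ?_⟩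
      simp only [LInterp.den, ← hd, ← he]
      exact letStar_natural (M.retag_split ρ s)
  | _, _, _, _, .tensorI d e s, ρ, h, h' => by
      subst h
      obtain ⟨d', hd⟩ := d.exists_rename M ρ rfl (LCtx.map_snd_ren ρ _)
      obtain ⟨e', he⟩ := e.exists_rename M ρ rfl (LCtx.map_snd_ren ρ _)
      refine ⟨.tensorI d' e' (s.map _), ?_⟩
      simp only [LInterp.den, ← hd, ← he]
      exact pair_natural (M.retag_split ρ s)
  | _, _, _, _, .tensorE (Δ := Δ) (A := A) (B := B) d e s, ρ, h, h' => by
      subst h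
      obtain ⟨d', hd⟩ := d.exists_rename M ρ rfl (LCtx.map_snd_ren ρ _)
      obtain ⟨e', he⟩ := e.exists_rename M (Γ' := LCtx.bind₂ (Δ.ren ρ) A B) (upRen (upRen ρ))
        (LCtx.ren_bind₂ ρ Δ A B).symm
        (by rw [← LCtx.ren_bind₂]; exact LCtx.map_snd_ren _ _)
      refine ⟨.tensorE d' e' (s.map _), ?_⟩
      simp only [LInterp.den, ← hd, ← he]
      exact pm_natural (M.retag_split ρ s) (M.retag_join₂ A B _ _)
  | _, _, _, _, .lolliI (Γ := Γ) (A := A) d, ρ, h, h' => by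
      subst h
      obtain ⟨d', hd⟩ := d.exists_rename M (Γ' := LCtx.bind (Γ.ren ρ) A) (upRen ρ)
        (LCtx.ren_bind ρ Γ A).symm
        (by rw [← LCtx.ren_bind]; exact LCtx.map_snd_ren _ _)
      refine ⟨.lolliI d', ?_⟩
      simp only [LInterp.den, ← hd]
      exact lam_natural (M.retag_join₁ A _ _)
  | _, _, _, _, .lolliE d e s, ρ, h, h' => by
      subst h
      obtain ⟨d', hd⟩ := d.exists_rename M ρ rfl (LCtx.map_snd_ren ρ _)
      obtain ⟨e', he⟩ := e.exists_rename M ρ rfl (LCtx.map_snd_ren ρ _)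
      refine ⟨.lolliE d' e' (s.map _), ?_⟩
      simp only [LInterp.den, ← hd, ← he]
      exact pair_comp_natural (M.retag_split ρ s)
theorem LDerArgs.exists_rename (M : LInterp S C) : ∀ {Γ Γ' : LCtx S} {as : LArgs S}
    {As : List (LTy S.G)} (d : LDerArgs S Γ as As) (ρ : ℕ → ℕ) (_ : Γ' = Γ.ren ρ)
    (h' : Γ.map Prod.snd = Γ'.map Prod.snd),
    ∃ d' : LDerArgs S Γ' (as.rename ρ) As, M.retag h' ≫ M.denArgs d' = M.denArgs d
  | _, _, _, _, .nil, ρ, h, h' => by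
      subst h
      exact ⟨.nil, Category.id_comp _⟩
  | _, _, _, _, .snoc d e s, ρ, h, h' => by
      subst h
      obtain ⟨d', hd⟩ := d.exists_rename M ρ rfl (LCtx.map_snd_ren ρ _)
      obtain ⟨e', he⟩ := e.exists_rename M ρ rfl (LCtx.map_snd_ren ρ _)
      refine ⟨.snoc d' e' (s.map _), ?_⟩
      simp only [LInterp.denArgs, ← hd, ← he]
      exact pair_comp_natural (M.retag_split ρ s)
end

/-! ### Simultaneous substitutions -/

/-- `SDer σ Γ E`: derivations of all `σ x`, for `x : A` in `Γ`, over contexts of which `E` is a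
shuffle. -/
inductive SDer (σ : ℕ → LTm S) : LCtx S → LCtx S → Type (max u u₂)
  | nil : SDer σ [] []
  | cons {Γ E Δ E' : LCtx S} {x : ℕ} {A : LTy S.G} (d : SDer σ Γ E) (e : LDer S Δ (σ x) A)
      (s : Shuffle E Δ E') : SDer σ ((x, A) :: Γ) E'

/-- The denotation of a simultaneous substitution. -/
def LInterp.sden (M : LInterp S C) {σ : ℕ → LTm S} {Γ E : LCtx S} :
    SDer σ Γ E → (M.ctx E ⟶ M.ctx Γ)
  | .nil => 𝟙 (𝟙_ C)
  | .cons (Γ := Γ) (x := x) (A := A) d e s =>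
      s.split (fun p : ℕ × LTy S.G => M.ty p.2) ≫ (M.sden d ⊗ₘ M.den e) ≫
        (snocIso (fun p : ℕ × LTy S.G => M.ty p.2) (x, A) Γ).inv

/-- A substitution into a shuffle of two contexts decomposes. -/
theorem SDer.exists_split (M : LInterp S C) {σ : ℕ → LTm S} {Γ₁ Γ₂ Γ : LCtx S}
    (s : Shuffle Γ₁ Γ₂ Γ) : ∀ {E : LCtx S} (d : SDer σ Γ E),
    ∃ (E₁ E₂ : LCtx S) (d₁ : SDer σ Γ₁ E₁) (d₂ : SDer σ Γ₂ E₂) (t : Shuffle E₁ E₂ E),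
      M.sden d ≫ s.split (fun p : ℕ × LTy S.G => M.ty p.2) =
        t.split (fun p : ℕ × LTy S.G => M.ty p.2) ≫ (M.sden d₁ ⊗ₘ M.sden d₂) := by
  induction s with
  | nil =>
    intro E d
    cases d
    refine ⟨[], [], .nil, .nil, .nil, ?_⟩
    have key : 𝟙 (𝟙_ C) ≫ (λ_ (𝟙_ C)).inv = (λ_ (𝟙_ C)).inv ≫ (𝟙 (𝟙_ C) ⊗ₘ 𝟙 (𝟙_ C)) := by simp
    exact key
  | left a s ih =>
    intro E d
    cases d with
    | cons d e s₂ =>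
      obtain ⟨E₁, E₂, d₁, d₂, t, h⟩ := ih d
      obtain ⟨G, r₁, r₂, h'⟩ := Shuffle.exists_swapLast (fun p : ℕ × LTy S.G => M.ty p.2) t s₂
      refine ⟨G, E₂, .cons d₁ e r₁, d₂, r₂, ?_⟩
      rw [LInterp.sden, LInterp.sden, Shuffle.split_left]
      exact subst_left h h'
  | right a s ih =>
    intro E d
    cases d with
    | cons d e s₂ =>
      obtain ⟨E₁, E₂, d₁, d₂, t, h⟩ := ih d
      obtain ⟨G, r₁, r₂, h'⟩ := Shuffle.exists_assoc (fun p : ℕ × LTy S.G => M.ty p.2) t s₂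
      refine ⟨E₁, G, d₁, .cons d₂ e r₁, r₂, ?_⟩
      rw [LInterp.sden, LInterp.sden, Shuffle.split_right]
      exact subst_right h h'

end Denotations

/-! ### The substitution lemma -/

section SubstitutionLemma

variable {S : LSig.{u, u₂}} {C : Type u'} [Category.{v} C] [MonoidalCategory C] [MonoidalClosed C]
  [SymmetricCategory C]

theorem cons_natural {E E' G G' D D' A W W' : C} {r : E ⟶ E'} {s : E ⟶ G ⊗ D} {s' : E' ⟶ G' ⊗ D'}
    {a : G ⟶ G'} {b : D ⟶ D'} {X X' : C} {f : G ⟶ X} {f' : G' ⟶ X'} {k : X ⟶ X'} {e : D ⟶ A}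
    {e' : D' ⟶ A} {i : W ≅ X ⊗ A} {i' : W' ≅ X' ⊗ A} {g : W ⟶ W'}
    (h : r ≫ s' = s ≫ (a ⊗ₘ b)) (hf : a ≫ f' = f ≫ k) (he : b ≫ e' = e)
    (hg : g = i.hom ≫ (k ▷ A) ≫ i'.inv) :
    r ≫ s' ≫ (f' ⊗ₘ e') ≫ i'.inv = (s ≫ (f ⊗ₘ e) ≫ i.inv) ≫ g := by
  subst hg he
  rw [reassoc_of% h, tensorHom_comp_tensorHom_assoc, hf]
  simp only [Category.assoc, Iso.inv_hom_id_assoc]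
  rw [← tensorHom_id, tensorHom_comp_tensorHom_assoc, Category.comp_id]

namespace SDer

theorem exists_shift (M : LInterp S C) {σ : ℕ → LTm S} : ∀ {Γ E : LCtx S} (d : SDer σ Γ E),
    ∃ d' : SDer (upSubst σ) (Γ.shift 1) (E.shift 1),
      M.shiftHom 1 E ≫ M.sden d' = M.sden d ≫ M.shiftHom 1 Γ
  | _, _, .nil => ⟨.nil, (Category.id_comp _).trans (Category.comp_id _).symm⟩
  | _, _, .cons d e s => by
      obtain ⟨d', hd⟩ := d.exists_shift M
      obtain ⟨e', he⟩ := e.exists_rename M (· + 1) rfl (LCtx.map_snd_ren _ _)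
      exact ⟨.cons d' e' (s.map _), cons_natural (M.retag_split (· + 1) s) hd he
        (M.retag_cons LInterp.map_snd_of_shift LInterp.map_snd_of_shift)⟩

/-- A substitution can be carried under a binder. -/
theorem exists_bind (M : LInterp S C) {σ : ℕ → LTm S} {Γ E : LCtx S} (d : SDer σ Γ E)
    (A : LTy S.G) : ∃ d' : SDer (upSubst σ) (Γ.bind A) (E.bind A),
      (M.sden d ▷ M.ty A) ≫ M.join₁ Γ A = M.join₁ E A ≫ M.sden d' := by
  obtain ⟨d', hd⟩ := d.exists_shift M
  refine ⟨.cons d' (.hyp 0 A) (.right _ (.allLeft _)), ?_⟩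
  have key : ∀ {X X' Y Y' Z W W' : C} {i : W ≅ X ⊗ Z} {i' : W' ≅ X' ⊗ Z} {a : Y ⟶ Y'} {f : Y ⟶ X}
      {f' : Y' ⟶ X'} {k : X ⟶ X'} {j : W ⟶ X ⊗ Z} (_ : j = i.hom) (_ : f ≫ k = a ≫ f'),
      (a ▷ Z) ≫ (f' ▷ Z) ≫ i'.inv = ((f ▷ Z) ≫ i.inv) ≫ j ≫ (k ⊗ₘ 𝟙 Z) ≫ i'.inv := by
    intro X X' Y Y' Z W W' i i' a f f' k j hj h
    subst hj
    rw [← comp_whiskerRight_assoc, ← h]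
    simp
  exact key (Shuffle.split_right_allLeft _ _ _) hd

theorem exists_cast (M : LInterp S C) {σ : ℕ → LTm S} {Γ E Γ' E' : LCtx S} (d : SDer σ Γ E)
    (hΓ : Γ = Γ') (hE : E = E') : ∃ d' : SDer σ Γ' E',
      M.retag (congrArg _ hE) ≫ M.sden d' = M.sden d ≫ M.retag (congrArg _ hΓ) := by
  subst hΓ hE
  exact ⟨d, (Category.id_comp _).trans (Category.comp_id _).symm⟩

end SDer

theorem LCtx.bind_bind (Γ : LCtx S) (A B : LTy S.G) : (Γ.bind A).bind B = Γ.bind₂ A B := by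
  simp [LCtx.bind, LCtx.bind₂, LCtx.shift]

/-- Two single binders make a double one. -/
theorem LInterp.join₁_join₁ (M : LInterp S C) (Γ : LCtx S) (A B : LTy S.G) :
    (M.join₁ Γ A ▷ M.ty B) ≫ M.join₁ (Γ.bind A) B ≫ M.retag (congrArg _ (Γ.bind_bind A B)) =
      M.join₂ Γ A B := by
  have h₀ : ((Γ.shift 1).shift 1).map Prod.snd = (Γ.shift 2).map Prod.snd :=
    congrArg (fun Γ : LCtx S => Γ.tail.tail.map Prod.snd) (Γ.bind_bind A B)
  have h₁ : ((Γ.bind A).shift 1).map Prod.snd = List.map Prod.snd ((1, A) :: Γ.shift 2) :=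
    congrArg (fun Γ : LCtx S => Γ.tail.map Prod.snd) (Γ.bind_bind A B)
  have e₁ := M.retag_cons h₁ (congrArg _ (Γ.bind_bind A B))
  have key : ∀ {X Y Z W W' Q Q' : C} {i : W ≅ Y ⊗ Z} {i' : W' ≅ Q ⊗ Z} {j : X ⟶ Q'} {a : Q' ⟶ Y}
      {b : Y ⟶ Q} {g : W ⟶ W'} {l : X ⟶ Q} (_ : j ≫ a ≫ b = l)
      (_ : g = i.hom ≫ (b ▷ Z) ≫ i'.inv),
      (j ▷ Z) ≫ ((a ▷ Z) ≫ i.inv) ≫ g = (l ▷ Z) ≫ i'.inv := by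
    intro X Y Z W W' Q Q' i i' j a b g l h hg
    subst hg h
    simp
  refine key ?_ e₁
  rw [shiftHom_eq, retag_trans]
  have e₂ := M.retag_cons (A := A) (x := 0) (y := 1) (Γ := Γ.shift 1) (Γ' := Γ.shift 2)
    (map_snd_of_shift.trans h₀) (map_snd_of_shift.trans h₁)
  have key₂ : ∀ {X Y Z W W' Q : C} {i : W ≅ Y ⊗ Z} {i' : W' ≅ Q ⊗ Z} {a : X ⟶ Y}
      {b : Y ⟶ Q} {g : W ⟶ W'} {l : X ⟶ Q} (_ : a ≫ b = l)
      (_ : g = i.hom ≫ (b ▷ Z) ≫ i'.inv),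
      ((a ▷ Z) ≫ i.inv) ≫ g = (l ▷ Z) ≫ i'.inv := by
    intro X Y Z W W' Q i i' a b g l h hg
    subst hg h
    simp
  exact key₂ (by rw [shiftHom_eq, shiftHom_eq, retag_trans]) e₂

namespace SDer

theorem exists_bind₂ (M : LInterp S C) {σ : ℕ → LTm S} {Γ E : LCtx S} (d : SDer σ Γ E)
    (A B : LTy S.G) : ∃ d' : SDer (upSubst (upSubst σ)) (Γ.bind₂ A B) (E.bind₂ A B),
      (M.sden d ▷ M.ty A ▷ M.ty B) ≫ M.join₂ Γ A B = M.join₂ E A B ≫ M.sden d' := by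
  obtain ⟨d₁, h₁⟩ := d.exists_bind M A
  obtain ⟨d₂, h₂⟩ := d₁.exists_bind M B
  obtain ⟨d₃, h₃⟩ := d₂.exists_cast M (LCtx.bind_bind _ _ _) (LCtx.bind_bind _ _ _)
  refine ⟨d₃, ?_⟩
  rw [← M.join₁_join₁, ← M.join₁_join₁, ← comp_whiskerRight_assoc, h₁, comp_whiskerRight_assoc,
    reassoc_of% h₂, Category.assoc, Category.assoc, h₃]

end SDer

mutual
/-- The substitution lemma: denotations turn simultaneous substitution into composition. -/
theorem LDer.exists_subst (M : LInterp S C) : ∀ {Γ E : LCtx S} {v : LTm S} {A : LTy S.G}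
    (d : LDer S Γ v A) {σ : ℕ → LTm S} (t : SDer σ Γ E),
    ∃ d' : LDer S E (v.subst σ) A, M.den d' = M.sden t ≫ M.den d
  | _, _, _, _, .ax f d, _, t => by
      obtain ⟨d', hd⟩ := d.exists_subst M t
      exact ⟨.ax f d', by simp only [LInterp.den, hd, Category.assoc]⟩
  | _, _, _, _, .hyp x A, _, .cons .nil e s => by
      obtain ⟨rfl, hs⟩ := s.eq_of_nil_left
      refine ⟨e, ?_⟩
      subst hs
      have key : ∀ {X Y : C} (f : X ⟶ Y) (s : X ⟶ 𝟙_ C ⊗ X), s = (λ_ X).inv →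
          f = (s ≫ (𝟙 (𝟙_ C) ⊗ₘ f) ≫ (λ_ Y).hom) ≫ 𝟙 Y := by
        rintro X Y f _ rfl; simp
      exact key _ _ (Shuffle.split_allRight _ _)
  | _, _, _, _, .unitI, _, .nil => ⟨.unitI, (Category.id_comp _).symm⟩
  | _, _, _, _, .unitE d e s, _, t => by
      obtain ⟨_, _, t₁, t₂, s', h⟩ := t.exists_split M s
      obtain ⟨d', hd⟩ := d.exists_subst M t₁
      obtain ⟨e', he⟩ := e.exists_subst M t₂
      refine ⟨.unitE d' e' s', ?_⟩
      simp only [LInterp.den, hd, he]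
      exact (letStar_natural h).symm
  | _, _, _, _, .tensorI d e s, _, t => by
      obtain ⟨_, _, t₁, t₂, s', h⟩ := t.exists_split M s
      obtain ⟨d', hd⟩ := d.exists_subst M t₁
      obtain ⟨e', he⟩ := e.exists_subst M t₂
      refine ⟨.tensorI d' e' s', ?_⟩
      simp only [LInterp.den, hd, he]
      exact (pair_natural h).symm
  | _, _, _, _, .tensorE (A := A) (B := B) d e s, _, t => by
      obtain ⟨_, _, t₁, t₂, s', h⟩ := t.exists_split M s
      obtain ⟨d', hd⟩ := d.exists_subst M t₁
      obtain ⟨t₃, ht⟩ := t₂.exists_bind₂ M A B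
      obtain ⟨e', he⟩ := e.exists_subst M t₃
      refine ⟨.tensorE d' e' s', ?_⟩
      simp only [LInterp.den, hd, he]
      exact (pm_natural h ht).symm
  | _, _, _, _, .lolliI (A := A) d, _, t => by
      obtain ⟨t', ht⟩ := t.exists_bind M A
      obtain ⟨d', hd⟩ := d.exists_subst M t'
      refine ⟨.lolliI d', ?_⟩
      simp only [LInterp.den, hd]
      exact (lam_natural ht).symm
  | _, _, _, _, .lolliE d e s, _, t => by
      obtain ⟨_, _, t₁, t₂, s', h⟩ := t.exists_split M s
      obtain ⟨d', hd⟩ := d.exists_subst M t₁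
      obtain ⟨e', he⟩ := e.exists_subst M t₂
      refine ⟨.lolliE d' e' s', ?_⟩
      simp only [LInterp.den, hd, he]
      exact (pair_comp_natural h).symm
theorem LDerArgs.exists_subst (M : LInterp S C) : ∀ {Γ E : LCtx S} {as : LArgs S}
    {As : List (LTy S.G)} (d : LDerArgs S Γ as As) {σ : ℕ → LTm S} (t : SDer σ Γ E),
    ∃ d' : LDerArgs S E (as.subst σ) As, M.denArgs d' = M.sden t ≫ M.denArgs d
  | _, _, _, _, .nil, _, .nil => ⟨.nil, (Category.id_comp _).symm⟩
  | _, _, _, _, .snoc d e s, _, t => by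
      obtain ⟨_, _, t₁, t₂, s', h⟩ := t.exists_split M s
      obtain ⟨d', hd⟩ := d.exists_subst M t₁
      obtain ⟨e', he⟩ := e.exists_subst M t₂
      refine ⟨.snoc d' e' s', ?_⟩
      simp only [LInterp.denArgs, hd, he]
      exact (pair_comp_natural h).symm
end

namespace SDer

/-- Substitutions of variables for variables that keep the order of the context. -/
theorem exists_of_vars (M : LInterp S C) {σ : ℕ → LTm S} {Γ E : LCtx S}
    (h : List.Forall₂ (fun p q => σ p.1 = .var q.1 ∧ p.2 = q.2) Γ E)
    (h' : E.map Prod.snd = Γ.map Prod.snd) : ∃ d : SDer σ Γ E, M.sden d = M.retag h' := by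
  induction h with
  | nil => exact ⟨.nil, rfl⟩
  | @cons p q Γ E hpq hΓ ih =>
    obtain ⟨d, hd⟩ := ih (List.cons.inj h').2
    obtain ⟨x, A⟩ := p
    obtain ⟨y, B⟩ := q
    obtain ⟨hσ, rfl⟩ : σ x = .var y ∧ A = B := hpq
    refine ⟨.cons d (hσ ▸ .hyp y A) (.right _ (.allLeft _)), ?_⟩
    have he : M.den (hσ ▸ LDer.hyp y A : LDer S [(y, A)] (σ x) A) = 𝟙 (M.ty A) := by
      generalize σ x = t at hσ
      subst hσ
      rfl
    have e₁ := M.retag_cons (x := y) (y := x) (A := A) (List.cons.inj h').2 h'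
    rw [← hd] at e₁
    refine Eq.trans ?_ e₁.symm
    have key : ∀ {X X' Z W W' : C} {i : W ≅ X ⊗ Z} {i' : W' ≅ X' ⊗ Z}
        {k : X ⟶ X'} {j : W ⟶ X ⊗ Z} {e : Z ⟶ Z} (_ : j = i.hom) (_ : e = 𝟙 Z),
        j ≫ (k ⊗ₘ e) ≫ i'.inv = i.hom ≫ (k ▷ Z) ≫ i'.inv := by
      intro X X' Z W W' i i' k j e hj he
      subst hj he
      simp
    exact key (Shuffle.split_right_allLeft _ _ _) he

/-- Permutations of a context are substitutions. -/
theorem nonempty_of_perm : ∀ {Γ E : LCtx S}, E.Perm Γ → Nonempty (SDer LTm.var Γ E)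
  | [], _, p => by rw [List.perm_nil.1 p]; exact ⟨.nil⟩
  | (x, A) :: Γ, E, p => by
      obtain ⟨E', ⟨s⟩, p'⟩ := Shuffle.exists_of_mem (p.symm.subset List.mem_cons_self)
      obtain ⟨d⟩ := nonempty_of_perm ((p'.symm.trans p).cons_inv)
      exact ⟨.cons d (.hyp x A) s⟩

end SDer

end SubstitutionLemma

/-! ### Soundness of the equations of autonomous categories -/

section AutKeys

/- Each lemma is the diagram behind one of the equations. The objects are arbitrary, and the
structure maps of contexts are arbitrary morphisms or isomorphisms with the property that is used:
the diagrams are then independent of how the interpretation of a context unfolds. -/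


variable {C : Type u'} [Category.{v} C] [MonoidalCategory C] [SymmetricCategory C]
  {H T T' G G' N A B D W W' Z : C}

theorem tensor_beta_key {X Y : C} {r : H ⟶ T ⊗ G} {s : G ⟶ X ⊗ Y} {f : X ⟶ A} {g : Y ⟶ B}
    {l : T ⟶ T'} {i : T' ⊗ A ⟶ W} {j : W ⊗ B ⟶ W'} {s₂ : H ⟶ N ⊗ Y} {s₁ : N ⟶ T ⊗ X}
    {m : W' ⟶ Z} (h : s₂ ≫ (s₁ ▷ Y) ≫ (α_ T X Y).hom = r ≫ (T ◁ s)) :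
    (r ≫ (β_ T G).hom) ≫ ((s ≫ (f ⊗ₘ g)) ▷ T) ≫ (β_ (A ⊗ B) T).hom ≫ (α_ T A B).inv ≫
        ((((l ▷ A) ≫ i) ▷ B) ≫ j) ≫ m =
      (s₂ ≫ ((s₁ ≫ (l ⊗ₘ f) ≫ i) ⊗ₘ g) ≫ j) ≫ m := by
  simp only [Category.assoc]
  rw [← BraidedCategory.braiding_naturality_right_assoc, SymmetricCategory.symmetry_assoc,
    whiskerLeft_comp_assoc, ← reassoc_of% h]
  simp only [← tensorHom_id, ← id_tensorHom, ← associator_naturality_assoc,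
    Iso.hom_inv_id_assoc, tensorHom_comp_tensorHom_assoc, Category.id_comp, Category.comp_id]

theorem tensor_eta_key {l' : T' ⟶ G} {s : H ⟶ T ⊗ D} {f : D ⟶ A ⊗ B}
    {l : T ⟶ T'} {i : W ≅ T' ⊗ A} {j : W' ≅ W ⊗ B} {i' : W ⟶ T' ⊗ A} {e : A ⊗ B ⟶ A ⊗ B}
    {k : A ⊗ B ⟶ A ⊗ B}
    {n : G ⊗ (A ⊗ B) ⟶ N} {m : N ⟶ Z} {l'' : T ⟶ G} (hi : i' = i.hom)
    (hk : k ≫ e = 𝟙 _) (hl : l ≫ l' = l'') :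
    (s ≫ (β_ T D).hom) ≫ (f ▷ T) ≫ (β_ (A ⊗ B) T).hom ≫ (α_ T A B).inv ≫
        ((((l ▷ A) ≫ i.inv) ▷ B) ≫ j.inv) ≫ ((j.hom ≫ (i' ▷ B) ≫ (α_ T' A B).hom ≫ (T' ◁ k)) ≫
          (l' ⊗ₘ e) ≫ n) ≫ m = (s ≫ (l'' ⊗ₘ f) ≫ n) ≫ m := by
  subst hi hl
  simp only [Category.assoc]
  rw [← BraidedCategory.braiding_naturality_right_assoc, SymmetricCategory.symmetry_assoc]
  simp only [comp_whiskerRight, Category.assoc, Iso.inv_hom_id_assoc, inv_hom_whiskerRight_assoc]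
  rw [associator_naturality_left_assoc, Iso.inv_hom_id_assoc]
  simp only [← tensorHom_id, ← id_tensorHom, tensorHom_comp_tensorHom_assoc, hk,
    Category.id_comp, Category.comp_id]

theorem braiding_whisker_leftUnitor (T : C) {D : C} (f : D ⟶ 𝟙_ C) :
    (β_ T D).hom ≫ (f ▷ T) ≫ (λ_ T).hom = (T ◁ f) ≫ (ρ_ T).hom := by
  rw [← BraidedCategory.braiding_naturality_right_assoc, braiding_leftUnitor]

theorem unit_eta_key {s : H ⟶ T ⊗ D} {f : D ⟶ 𝟙_ C} {l : T ⟶ G} {m : G ⊗ 𝟙_ C ⟶ Z}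
    {r : T ⟶ T ⊗ 𝟙_ C} (hr : r = (ρ_ T).inv) :
    (s ≫ (β_ T D).hom) ≫ (f ▷ T) ≫ (λ_ T).hom ≫ r ≫ (l ⊗ₘ 𝟙 (𝟙_ C)) ≫ m =
      s ≫ (l ⊗ₘ f) ≫ m := by
  subst hr
  simp only [Category.assoc]
  rw [reassoc_of% braiding_whisker_leftUnitor, Iso.hom_inv_id_assoc, ← id_tensorHom,
    tensorHom_comp_tensorHom_assoc, Category.id_comp, Category.comp_id]

theorem comm_unit_key {X Y : C} {q : G ⟶ Y ⊗ X} {r : H ⟶ T ⊗ G} {f : X ⟶ 𝟙_ C} {g : Y ⟶ A}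
    {l : T ⟶ T'} {m : T' ⊗ A ⟶ Z} {s₂ : H ⟶ N ⊗ X} {s₁ : N ⟶ T ⊗ Y}
    (h : s₂ ≫ (s₁ ▷ X) ≫ (α_ T Y X).hom = r ≫ (T ◁ q)) :
    r ≫ (l ⊗ₘ ((q ≫ (β_ Y X).hom) ≫ (f ▷ Y) ≫ (λ_ Y).hom ≫ g)) ≫ m =
      (s₂ ≫ (β_ N X).hom) ≫ (f ▷ N) ≫ (λ_ N).hom ≫ s₁ ≫ (l ⊗ₘ g) ≫ m := by
  simp only [Category.assoc]
  rw [reassoc_of% braiding_whisker_leftUnitor, reassoc_of% braiding_whisker_leftUnitor,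
    ← rightUnitor_naturality_assoc, whisker_exchange_assoc, rightUnitor_tensor_hom,
    MonoidalCategory.tensorHom_def']
  simp only [MonoidalCategory.whiskerLeft_comp, Category.assoc]
  rw [← reassoc_of% h]
  simp [MonoidalCategory.tensorHom_def']

theorem comm_tensor_key {X Y P P' Q Q' F : C} {q : G ⟶ Y ⊗ X} {r : H ⟶ T ⊗ G} {f : X ⟶ A ⊗ B}
    {g : Q' ⟶ F}
    {l : T ⟶ T'} {n : T' ⊗ F ⟶ W} {m : W ⟶ Z} {s₂ : H ⟶ N ⊗ X} {s₁ : N ⟶ T ⊗ Y} {N' Y' R : C}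
    {rn : N ⟶ N'} {ry : Y ⟶ Y'} {rt : T ⟶ R} {lt : R ⟶ T'} {s' : N' ⟶ R ⊗ Y'}
    {i : P ≅ N' ⊗ A} {j : P' ≅ P ⊗ B} {i' : Y' ⊗ A ⟶ Q} {j' : Q ⊗ B ⟶ Q'}
    (h : s₂ ≫ (s₁ ▷ X) ≫ (α_ T Y X).hom = r ≫ (T ◁ q))
    (hs : rn ≫ s' = s₁ ≫ (rt ⊗ₘ ry)) (hl : rt ≫ lt = l) :
    (r ≫ (l ⊗ₘ ((q ≫ (β_ Y X).hom) ≫ (f ▷ Y) ≫ (β_ (A ⊗ B) Y).hom ≫ (α_ Y A B).inv ≫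
        ((((ry ▷ A) ≫ i') ▷ B) ≫ j') ≫ g)) ≫ n) ≫ m =
      (s₂ ≫ (β_ N X).hom) ≫ (f ▷ N) ≫ (β_ (A ⊗ B) N).hom ≫ (α_ N A B).inv ≫
        ((((rn ▷ A) ≫ i.inv) ▷ B) ≫ j.inv) ≫
          ((j.hom ≫ ((i.hom ≫ (s' ▷ A) ≫ (α_ _ _ _).hom ≫ (R ◁ i')) ▷ B) ≫ (α_ _ _ _).hom ≫
            (R ◁ j')) ≫ (lt ⊗ₘ g) ≫ n) ≫ m := by
  have e : ((rt ⊗ₘ ry) ▷ A ▷ B) ≫ ((α_ R Y' A).hom ▷ B) ≫ ((R ◁ i') ▷ B) ≫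
      (α_ R Q B).hom ≫ (R ◁ j') ≫ (lt ⊗ₘ g) =
        ((α_ T Y A).hom ▷ B) ≫ (α_ T (Y ⊗ A) B).hom ≫
          (l ⊗ₘ ((ry ▷ A ▷ B) ≫ (i' ▷ B) ≫ j' ≫ g)) := by
    subst hl
    rw [← comp_whiskerRight_assoc, ← tensorHom_id (rt ⊗ₘ ry), associator_naturality,
      comp_whiskerRight_assoc]
    simp only [← tensorHom_id, ← id_tensorHom, tensorHom_comp_tensorHom_assoc,
      associator_naturality_assoc, tensorHom_comp_tensorHom, Category.id_comp, Category.comp_id]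
  have p : ((T ⊗ Y) ◁ f) ≫ (α_ (T ⊗ Y) A B).inv ≫ ((α_ T Y A).hom ▷ B) ≫
      (α_ T (Y ⊗ A) B).hom = (α_ T Y X).hom ≫ (T ◁ Y ◁ f) ≫ (T ◁ (α_ Y A B).inv) := by
    simp
  simp only [Category.assoc]
  rw [← BraidedCategory.braiding_naturality_right_assoc, SymmetricCategory.symmetry_assoc,
    ← BraidedCategory.braiding_naturality_right_assoc, SymmetricCategory.symmetry_assoc]
  simp only [comp_whiskerRight, Category.assoc, Iso.inv_hom_id_assoc, inv_hom_whiskerRight_assoc]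
  rw [← comp_whiskerRight_assoc (f := rn ▷ A), ← comp_whiskerRight, hs]
  simp only [comp_whiskerRight, Category.assoc]
  rw [reassoc_of% e, ← associator_inv_naturality_left_assoc s₁, whisker_exchange_assoc s₁,
    reassoc_of% p, reassoc_of% h]
  simp only [← id_tensorHom, tensorHom_comp_tensorHom_assoc, Category.id_comp]

theorem transpose_appHom [MonoidalClosed C] {X Y : C} (f : X ⊗ Y ⟶ Z) {g : D ⟶ Y} :
    (LInterp.transpose f ⊗ₘ g) ≫ LInterp.appHom Y Z = (X ◁ g) ≫ f := by
  rw [LInterp.transpose, LInterp.appHom, MonoidalCategory.tensorHom_def', Category.assoc,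
    BraidedCategory.braiding_naturality_left_assoc, ← MonoidalClosed.uncurry_eq,
    MonoidalClosed.uncurry_curry, SymmetricCategory.symmetry_assoc]

theorem lolli_beta_key [MonoidalClosed C] {s : H ⟶ T ⊗ D} {g : D ⟶ A} {l : T ⟶ T'}
    {i : T' ⊗ A ⟶ W} {m : W ⟶ Z} :
    s ≫ (LInterp.transpose (((l ▷ A) ≫ i) ≫ m) ⊗ₘ g) ≫ LInterp.appHom A Z =
      (s ≫ (l ⊗ₘ g) ≫ i) ≫ m := by
  rw [transpose_appHom, MonoidalCategory.tensorHom_def']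
  simp

theorem lolli_eta_key [MonoidalClosed C] {l : T ⟶ T'} {i : W ≅ T' ⊗ A} {i' : W ⟶ T' ⊗ A}
    {f : T ⟶ (ihom A).obj Z} {f' : T' ⟶ (ihom A).obj Z} (hf : l ≫ f' = f) (hi : i' = i.hom) :
    LInterp.transpose (((l ▷ A) ≫ i.inv) ≫ i' ≫ (f' ⊗ₘ 𝟙 A) ≫ LInterp.appHom A Z) = f := by
  subst hi hf
  rw [LInterp.transpose, LInterp.appHom, tensorHom_id]
  simp only [Category.assoc, Iso.inv_hom_id_assoc]
  rw [← comp_whiskerRight_assoc, BraidedCategory.braiding_naturality_left_assoc,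
    SymmetricCategory.symmetry_assoc, ← MonoidalClosed.uncurry_eq, MonoidalClosed.curry_uncurry]

end AutKeys

section AutSound

variable {S : LSig.{u, u₂}} {C : Type u'} [Category.{v} C] [MonoidalCategory C] [MonoidalClosed C]
  [SymmetricCategory C]

theorem SDer.exists_cons (M : LInterp S C) {σ : ℕ → LTm S} {Γ E Δ E' : LCtx S} {x : ℕ}
    {A : LTy S.G} {w : LTm S} (d : SDer σ Γ E) (e : LDer S Δ w A) (hσ : σ x = w)
    (s : Shuffle E Δ E') : ∃ d' : SDer σ ((x, A) :: Γ) E',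
      M.sden d' = s.split (fun p : ℕ × LTy S.G => M.ty p.2) ≫ (M.sden d ⊗ₘ M.den e) ≫
        (snocIso (fun p : ℕ × LTy S.G => M.ty p.2) (x, A) Γ).inv := by
  subst hσ
  exact ⟨.cons d e s, rfl⟩

/-- The substitution of a single variable, as a simultaneous substitution. -/
theorem SDer.exists_update (M : LInterp S C) {Γ Δ E : LCtx S} {x : ℕ} {A : LTy S.G} {w : LTm S}
    (hx : LCtx.Distinct (S := S) ((x, A) :: Γ)) (e : LDer S Δ w A) (s : Shuffle Γ Δ E) :
    ∃ d : SDer (Function.update LTm.var x w) ((x, A) :: Γ) E,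
      M.sden d = s.split (fun p : ℕ × LTy S.G => M.ty p.2) ≫ (M.retag rfl ⊗ₘ M.den e) ≫
        (snocIso (fun p : ℕ × LTy S.G => M.ty p.2) (x, A) Γ).inv := by
  obtain ⟨d, hd⟩ := SDer.exists_of_vars M (σ := Function.update LTm.var x w) (Γ := Γ) (E := Γ)
    (List.forall₂_same.2 fun p hp => ⟨Function.update_of_ne
      (fun h : p.1 = x => (LCtx.distinct_cons.1 hx).1 (List.mem_map.2 ⟨p, hp, h⟩)) _ _, rfl⟩) rfl
  rw [← hd]
  exact d.exists_cons M e (Function.update_self _ _ _) s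

/-- The substitution of a single variable below two binders. -/
theorem SDer.exists_update_shift (M : LInterp S C) {Γ Δ E : LCtx S} {x : ℕ} {A : LTy S.G}
    {w : LTm S} (hx : LCtx.Distinct (S := S) ((x, A) :: Γ)) (e : LDer S Δ w A)
    (s : Shuffle (Γ.shift 2) Δ E) :
    ∃ d : SDer (Function.update (fun n => LTm.var (n + 2)) x w) ((x, A) :: Γ) E,
      M.sden d = s.split (fun p : ℕ × LTy S.G => M.ty p.2) ≫
        (M.retag LInterp.map_snd_of_shift.symm ⊗ₘ M.den e) ≫
          (snocIso (fun p : ℕ × LTy S.G => M.ty p.2) (x, A) Γ).inv := by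
  obtain ⟨d, hd⟩ := SDer.exists_of_vars M (σ := Function.update (fun n => LTm.var (n + 2)) x w)
    (Γ := Γ) (E := Γ.shift 2) (List.forall₂_map_right_iff.2 <| List.forall₂_same.2 fun p hp =>
      ⟨Function.update_of_ne
        (fun h : p.1 = x => (LCtx.distinct_cons.1 hx).1 (List.mem_map.2 ⟨p, hp, h⟩)) _ _, rfl⟩)
    LInterp.map_snd_of_shift.symm
  rw [← hd]
  exact d.exists_cons M e (Function.update_self _ _ _) s

/-- Permuting the context composes all denotations with the same morphism. -/
theorem LDer.exists_perm (M : LInterp S C) {E E' : LCtx S} (p : E'.Perm E) :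
    ∃ r : M.ctx E' ⟶ M.ctx E, ∀ {v : LTm S} {A : LTy S.G} (d : LDer S E v A),
      ∃ d' : LDer S E' v A, M.den d' = r ≫ M.den d := by
  obtain ⟨t⟩ := SDer.nonempty_of_perm p
  refine ⟨M.sden t, fun {v A} d => ?_⟩
  have h := d.exists_subst M t
  rw [LTm.subst_var] at h
  exact h

theorem LDer.exists_den_eq_of_perm (M : LInterp S C) {E E' : LCtx S} {v w : LTm S} {A : LTy S.G}
    (p : E'.Perm E) (h : ∃ (d : LDer S E v A) (d' : LDer S E w A), M.den d = M.den d') :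
    ∃ (d : LDer S E' v A) (d' : LDer S E' w A), M.den d = M.den d' := by
  obtain ⟨r, hr⟩ := LDer.exists_perm M p
  obtain ⟨d, d', h⟩ := h
  obtain ⟨e, he⟩ := hr d
  obtain ⟨e', he'⟩ := hr d'
  exact ⟨e, e', by rw [he, he', h]⟩

theorem Shuffle.perm_append_append {α : Type u} {Γ Δ Θ G E H : List α} (s : Shuffle Γ Δ G)
    (t : Shuffle Θ G H) (p : E.Perm (Γ ++ Δ ++ Θ)) : E.Perm H :=
  p.trans (List.perm_append_comm.trans ((s.perm.symm.append_left Θ).trans t.perm.symm))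

/-- The two sides of an equation of linear lambda calculus have derivations with equal denotations.
Since the context of the equation is only given up to permutation, it is first brought into the
order of the concatenated contexts, by `LDer.exists_den_eq_of_perm`. -/
theorem AutEqn.sound (M : LInterp S C) {E : LCtx S} {v w : LTm S} {A : LTy S.G}
    (h : AutEqn E v w A) :
    ∃ (d : LDer S E v A) (d' : LDer S E w A), M.den d = M.den d' := by
  cases h with
  | @tensor_beta Γ Δ Θ _ v w t A B D hv hw ht hE p =>
    obtain ⟨_, ⟨dv⟩⟩ := hv
    obtain ⟨_, ⟨dw⟩⟩ := hw
    obtain ⟨_, ⟨dt⟩⟩ := ht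
    unfold LTm.inst₂
    let s := Shuffle.append Γ Δ
    let r := Shuffle.append Θ (Δ ++ Γ)
    refine LDer.exists_den_eq_of_perm M (s.perm_append_append r p) ?_
    obtain ⟨E', s₁, s₂, h⟩ := Shuffle.exists_assoc_symm (fun p : ℕ × LTy S.G => M.ty p.2) s r
    obtain ⟨t₀, h₀⟩ := SDer.exists_of_vars M (σ := instSubst₂ v w) (Γ := Θ.shift 2) (E := Θ)
      (List.forall₂_map_left_iff.2 <| List.forall₂_same.2 fun p _ => ⟨rfl, rfl⟩)
      LInterp.map_snd_of_shift
    obtain ⟨d', hd'⟩ := dt.exists_subst M (SDer.cons (x := 0) (SDer.cons (x := 1) t₀ dv s₁) dw s₂)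
    refine ⟨.tensorE (.tensorI dv dw s) dt r.swap, d', ?_⟩
    simp only [LInterp.den, hd', LInterp.sden, h₀, Shuffle.split_swap]
    exact tensor_beta_key (f := M.den dv) (g := M.den dw)
      (l := M.retag LInterp.map_snd_of_shift)
      (i := (snocIso (fun p : ℕ × LTy S.G => M.ty p.2) (1, A) (Θ.shift 2)).inv)
      (j := (snocIso (fun p : ℕ × LTy S.G => M.ty p.2) (0, B) ((1, A) :: Θ.shift 2)).inv) h
  | @tensor_eta Γ Δ _ v t z A B D hv ht hE p =>
    obtain ⟨_, ⟨dv⟩⟩ := hv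
    obtain ⟨hz, ⟨dt⟩⟩ := ht
    rw [LTm.sub_rename_add_two]
    unfold LTm.sub
    let s := Shuffle.append Δ Γ
    refine LDer.exists_den_eq_of_perm M (p.trans (List.perm_append_comm.trans s.perm.symm)) ?_
    let e : LDer S [(0, B), (1, A)] (.pair (.var 1) (.var 0)) (.tensor A B) :=
      .tensorI (.hyp 1 A) (.hyp 0 B) (.right _ (.allLeft _))
    obtain ⟨t₁, h₁⟩ := SDer.exists_update_shift M (E := Δ.bind₂ A B) hz e
      (.right (0, B) (.right (1, A) (.allLeft _)))
    obtain ⟨t₂, h₂⟩ := SDer.exists_update M hz dv s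
    obtain ⟨d₁, hd₁⟩ := dt.exists_subst M t₁
    obtain ⟨d₂, hd₂⟩ := dt.exists_subst M t₂
    refine ⟨.tensorE dv d₁ s.swap, d₂, ?_⟩
    simp only [LInterp.den, hd₁, hd₂, h₁, h₂, Shuffle.split_swap]
    have he : (snocIso (fun p : ℕ × LTy S.G => M.ty p.2) (0, B) [(1, A)]).inv ≫ M.den e =
        𝟙 (M.ty A ⊗ M.ty B) := by
      have key : ∀ {X : C} {s : M.ty A ⊗ M.ty B ⟶ X} {i : X ⟶ M.ty A ⊗ M.ty B} (_ : s ≫ i = 𝟙 _)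
          {j : X ⟶ M.ty A ⊗ M.ty B} (_ : j = i),
          s ≫ j ≫ (𝟙 (M.ty A) ⊗ₘ 𝟙 (M.ty B)) = 𝟙 _ := by
        intro X s i h j hj
        subst hj
        simpa using h
      exact key (Iso.inv_hom_id _) (Shuffle.split_right_allLeft _ _ _)
    exact tensor_eta_key (s := s.split (fun p : ℕ × LTy S.G => M.ty p.2)) (f := M.den dv)
      (l := M.retag LInterp.map_snd_of_shift)
      (i := snocIso (fun p : ℕ × LTy S.G => M.ty p.2) (1, A) (Δ.shift 2))
      (j := snocIso (fun p : ℕ × LTy S.G => M.ty p.2) (0, B) ((1, A) :: Δ.shift 2))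
      (n := (snocIso (fun p : ℕ × LTy S.G => M.ty p.2) (z, A.tensor B) Δ).inv) (m := M.den dt)
      (l' := M.retag LInterp.map_snd_of_shift.symm) (l'' := M.retag rfl)
      (Shuffle.split_right_allLeft (fun p : ℕ × LTy S.G => M.ty p.2) (1, A) (Δ.shift 2)) he
      (M.retag_trans _ _)
  | @unit_beta Γ v A hv =>
    obtain ⟨_, ⟨dv⟩⟩ := hv
    refine ⟨.unitE .unitI dv (.allRight _), dv, ?_⟩
    have key : ∀ {X Y : C} {s : X ⟶ 𝟙_ C ⊗ X} (_ : s = (λ_ X).inv) (f : X ⟶ Y),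
        s ≫ (𝟙 (𝟙_ C) ▷ X) ≫ (λ_ X).hom ≫ f = f := by
      rintro X Y s rfl f; simp
    exact key (Shuffle.split_allRight _ _) _
  | @unit_eta Γ Δ _ v t z A hv ht hE p =>
    unfold LTm.sub
    obtain ⟨_, ⟨dv⟩⟩ := hv
    obtain ⟨hz, ⟨dt⟩⟩ := ht
    let s := Shuffle.append Δ Γ
    refine LDer.exists_den_eq_of_perm M (p.trans (List.perm_append_comm.trans s.perm.symm)) ?_
    obtain ⟨t₁, h₁⟩ := SDer.exists_update M hz .unitI (.allLeft _)
    obtain ⟨t₂, h₂⟩ := SDer.exists_update M hz dv s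
    obtain ⟨d₁, hd₁⟩ := dt.exists_subst M t₁
    obtain ⟨d₂, hd₂⟩ := dt.exists_subst M t₂
    refine ⟨.unitE dv d₁ s.swap, d₂, ?_⟩
    simp only [LInterp.den, hd₁, hd₂, h₁, h₂, Shuffle.split_swap]
    have k := unit_eta_key (s := s.split (fun p : ℕ × LTy S.G => M.ty p.2)) (f := M.den dv)
      (l := M.retag rfl)
      (m := (snocIso (fun p : ℕ × LTy S.G => M.ty p.2) (z, LTy.unit) Δ).inv ≫ M.den dt)
      (Shuffle.split_allLeft _ _)
    simp only [Category.assoc] at k ⊢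
    exact k
  | @lolli_beta Γ Δ _ v t A B hv ht hE p =>
    obtain ⟨_, ⟨dv⟩⟩ := hv
    obtain ⟨_, ⟨dt⟩⟩ := ht
    unfold LTm.inst
    let s := Shuffle.append Γ Δ
    refine LDer.exists_den_eq_of_perm M (p.trans s.perm.symm) ?_
    obtain ⟨t₀, h₀⟩ := SDer.exists_of_vars M (σ := instSubst t) (Γ := Γ.shift 1) (E := Γ)
      (List.forall₂_map_left_iff.2 <| List.forall₂_same.2 fun p _ => ⟨rfl, rfl⟩)
      LInterp.map_snd_of_shift
    obtain ⟨d', hd'⟩ := dv.exists_subst M (SDer.cons (x := 0) t₀ dt s)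
    refine ⟨.lolliE (.lolliI dv) dt s, d', ?_⟩
    simp only [LInterp.den, hd', LInterp.sden, h₀]
    exact lolli_beta_key (s := s.split (fun p : ℕ × LTy S.G => M.ty p.2)) (g := M.den dt)
      (l := M.retag LInterp.map_snd_of_shift)
      (i := (snocIso (fun p : ℕ × LTy S.G => M.ty p.2) (0, A) (Γ.shift 1)).inv) (m := M.den dv)
  | @lolli_eta Γ v A B hv =>
    obtain ⟨_, ⟨dv⟩⟩ := hv
    obtain ⟨d', hd'⟩ := dv.exists_rename M (· + 1) rfl (LCtx.map_snd_ren _ _)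
    refine ⟨.lolliI (.lolliE d' (.hyp 0 A) (.right _ (.allLeft _))), dv, ?_⟩
    simp only [LInterp.den]
    exact lolli_eta_key hd' (Shuffle.split_right_allLeft _ _ _)
  | @comm_unit Γ Δ Θ _ v w t z A B ht hv hw hE p =>
    unfold LTm.sub
    obtain ⟨_, ⟨dv⟩⟩ := hv
    obtain ⟨_, ⟨dw⟩⟩ := hw
    obtain ⟨hz, ⟨dt⟩⟩ := ht
    let q := Shuffle.append Θ Δ
    let r := Shuffle.append Γ (Δ ++ Θ)
    refine LDer.exists_den_eq_of_perm M (p.trans ?_) ?_ (E := Δ ++ Θ ++ Γ)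
    · rw [List.append_assoc]; exact List.perm_append_comm
    obtain ⟨E', s₁, s₂, h⟩ := Shuffle.exists_assoc_symm (fun p : ℕ × LTy S.G => M.ty p.2) q r
    obtain ⟨t₁, h₁⟩ := SDer.exists_update M hz (.unitE dv dw q.swap) r
    obtain ⟨t₂, h₂⟩ := SDer.exists_update M hz dw s₁
    obtain ⟨d₁, hd₁⟩ := dt.exists_subst M t₁
    obtain ⟨d₂, hd₂⟩ := dt.exists_subst M t₂
    refine ⟨d₁, .unitE dv d₂ s₂.swap, ?_⟩
    simp only [LInterp.den, hd₁, hd₂, h₁, h₂, Shuffle.split_swap]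
    have k := comm_unit_key (f := M.den dv) (g := M.den dw) (l := M.retag rfl)
      (m := (snocIso (fun p : ℕ × LTy S.G => M.ty p.2) (z, A) Γ).inv ≫ M.den dt) h
    simp only [Category.assoc] at k ⊢
    exact k
  | @comm_tensor Γ Δ Θ _ v w t z A B D F ht hv hw hE p =>
    obtain ⟨_, ⟨dv⟩⟩ := hv
    obtain ⟨_, ⟨dw⟩⟩ := hw
    obtain ⟨hz, ⟨dt⟩⟩ := ht
    rw [LTm.sub_rename_add_two]
    unfold LTm.sub
    let q := Shuffle.append Θ Δ
    let r := Shuffle.append Γ (Δ ++ Θ)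
    refine LDer.exists_den_eq_of_perm M (p.trans ?_) ?_ (E := Δ ++ Θ ++ Γ)
    · rw [List.append_assoc]; exact List.perm_append_comm
    obtain ⟨E', s₁, s₂, h⟩ := Shuffle.exists_assoc_symm (fun p : ℕ × LTy S.G => M.ty p.2) q r
    obtain ⟨t₁, h₁⟩ := SDer.exists_update M hz (.tensorE dv dw q.swap) r
    obtain ⟨t₂, h₂⟩ := SDer.exists_update_shift M (E := LCtx.bind₂ E' A B) hz dw
      (.right (0, B) (.right (1, A) (s₁.map _)))
    obtain ⟨d₁, hd₁⟩ := dt.exists_subst M t₁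
    obtain ⟨d₂, hd₂⟩ := dt.exists_subst M t₂
    refine ⟨d₁, .tensorE dv d₂ s₂.swap, ?_⟩
    simp only [LInterp.den, hd₁, hd₂, h₁, h₂, Shuffle.split_swap]
    exact comm_tensor_key (f := M.den dv) (g := M.den dw) (l := M.retag rfl)
      (n := (snocIso (fun p : ℕ × LTy S.G => M.ty p.2) (z, D) Γ).inv) (m := M.den dt)
      (i := snocIso (fun p : ℕ × LTy S.G => M.ty p.2) (1, A) (LCtx.shift 2 E'))
      (j := snocIso (fun p : ℕ × LTy S.G => M.ty p.2) (0, B) ((1, A) :: LCtx.shift 2 E'))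
      (i' := (snocIso (fun p : ℕ × LTy S.G => M.ty p.2) (1, A) (Θ.shift 2)).inv)
      (j' := (snocIso (fun p : ℕ × LTy S.G => M.ty p.2) (0, B) ((1, A) :: Θ.shift 2)).inv)
      h (M.retag_split (· + 2) s₁) (lt := M.retag LInterp.map_snd_of_shift.symm)
      (M.retag_trans _ _)

end AutSound

/-! ### Soundness -/

namespace VCatSepEnriched

variable {V : Type w} [CommMonoid V] [CompleteLattice V] {C : Type u'} [Category.{v} C]

theorem le_dist_comp [IsQuantale V] [VCatSepEnriched V C] {X Y Z : C} {f f' : X ⟶ Y} {g g' : Y ⟶ Z}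
    {q r : V} (h : q ≤ dist f f') (h' : r ≤ dist g g') : q * r ≤ dist (f ≫ g) (f' ≫ g') :=
  (mul_le_mul' h h').trans (comp_vfunctor X Y Z (f, g) (f', g'))

theorem one_le_dist_self [VCatSepEnriched V C] {X Y : C} (f : X ⟶ Y) : (1 : V) ≤ dist f f :=
  (isVCat X Y).refl f

theorem le_dist_comp_left [IsQuantale V] [VCatSepEnriched V C] {X Y Z : C} (f : X ⟶ Y)
    {g g' : Y ⟶ Z} {q : V} (h : q ≤ dist g g') : q ≤ dist (f ≫ g) (f ≫ g') :=
  (one_mul q).symm.le.trans (le_dist_comp (one_le_dist_self f) h)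

theorem le_dist_comp_right [IsQuantale V] [VCatSepEnriched V C] {X Y Z : C} {f f' : X ⟶ Y}
    (g : Y ⟶ Z) {q : V} (h : q ≤ dist f f') : q ≤ dist (f ≫ g) (f' ≫ g) :=
  (mul_one q).symm.le.trans (le_dist_comp h (one_le_dist_self g))

variable [MonoidalCategory C] [SymmetricCategory C] [MonoidalClosed C]

theorem le_dist_tensor [IsQuantale V] [VCatSepAutonomous V C] {X X' Y Y' : C} {f f' : X ⟶ X'}
    {g g' : Y ⟶ Y'} {q r : V} (h : q ≤ dist f f') (h' : r ≤ dist g g') :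
    q * r ≤ dist (f ⊗ₘ g) (f' ⊗ₘ g') :=
  (mul_le_mul' h h').trans (VCatSepAutonomous.tensor_vfunctor X X' Y Y' (f, g) (f', g'))

theorem le_dist_whiskerRight [IsQuantale V] [VCatSepAutonomous V C] {X X' : C} {f f' : X ⟶ X'}
    (Y : C) {q : V} (h : q ≤ dist f f') : q ≤ dist (f ▷ Y) (f' ▷ Y) := by
  rw [← tensorHom_id, ← tensorHom_id]
  exact (mul_one q).symm.le.trans (le_dist_tensor h (one_le_dist_self _))

theorem le_dist_transpose [IsQuantale V] [VCatSepAutonomous V C] {X Y Z : C} {f f' : X ⊗ Y ⟶ Z}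
    {q : V} (h : q ≤ dist f f') : q ≤ dist (LInterp.transpose f) (LInterp.transpose f') :=
  (le_dist_comp_left _ h).trans (VCatSepAutonomous.curry_vfunctor Y X Z _ _)

end VCatSepEnriched

open VCatSepEnriched

section Soundness

variable {V : Type w} [CommMonoid V] [CompleteLattice V] [IsQuantale V] {B : Set V}
  {T : VTheory.{w, u, u₂} V B} {C : Type u'} [Category.{v} C] [MonoidalCategory C]
  [SymmetricCategory C] [MonoidalClosed C] [VCatSepAutonomous V C]

theorem AutEqn.distinct {S : LSig.{u, u₂}} {Γ : LCtx S} {v w : LTm S} {A : LTy S.G}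
    (h : AutEqn Γ v w A) : Γ.Distinct := by
  cases h with
  | tensor_beta _ _ _ hE | tensor_eta _ _ hE | unit_eta _ _ hE | lolli_beta _ _ hE
  | comm_unit _ _ _ hE | comm_tensor _ _ _ hE => exact hE
  | unit_beta hv | lolli_eta hv => exact hv.1

/-- Derivations being unique, an estimate for some derivations holds for all. -/
theorem LDer.le_dist_of_exists {M : LInterp T.sig C} {Γ : LCtx T.sig} (hΓ : Γ.Distinct)
    {v w : LTm T.sig} {A : LTy T.sig.G} {q : V}
    (h : ∃ (d : LDer T.sig Γ v A) (d' : LDer T.sig Γ w A), q ≤ dist (M.den d) (M.den d'))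
    (d : LDer T.sig Γ v A) (d' : LDer T.sig Γ w A) : q ≤ dist (M.den d) (M.den d') := by
  obtain ⟨e, e', h⟩ := h
  rwa [d.unique e hΓ, d'.unique e' hΓ]

mutual
/-- Theorems are satisfied by every model; the derivations of the two judgements are part of the
conclusion because they are built along the way. -/
theorem VTheory.Thm.sound (hB : IsLabelBasis B) (M : LInterp T.sig C) (hM : T.IsModel M) :
    ∀ {Γ : LCtx T.sig} {v w : LTm T.sig} {q : V} {A : LTy T.sig.G}, T.Thm Γ v w q A →
      Γ.Distinct ∧ ∃ (d : LDer T.sig Γ v A) (d' : LDer T.sig Γ w A),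
        q ≤ dist (M.den d) (M.den d')
  | _, _, _, _, _, .axiom_mem (e := e) h => by
      obtain ⟨-, ⟨hΓ, ⟨d⟩⟩, ⟨-, ⟨d'⟩⟩⟩ := T.wellFormed e h
      exact ⟨hΓ, d, d', hM e h d d'⟩
  | _, _, _, _, _, .aut h => by
      obtain ⟨d, d', hd⟩ := h.sound M
      exact ⟨h.distinct, d, d', by rw [hd, ← hB.integral]; exact one_le_dist_self _⟩
  | _, _, _, _, _, .aut_symm h => by
      obtain ⟨d, d', hd⟩ := h.sound M
      exact ⟨h.distinct, d', d, by rw [hd, ← hB.integral]; exact one_le_dist_self _⟩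
  | _, _, _, _, _, .refl ⟨hΓ, ⟨d⟩⟩ =>
      ⟨hΓ, d, d, by rw [← hB.integral]; exact one_le_dist_self _⟩
  | _, _, _, _, _, .trans h₁ h₂ => by
      obtain ⟨hΓ, d, d', hd⟩ := h₁.sound hB M hM
      obtain ⟨-, e, e', he⟩ := h₂.sound hB M hM
      obtain rfl := d'.unique e hΓ
      exact ⟨hΓ, d, e', (mul_le_mul' hd he).trans ((isVCat _ _).trans _ _ _)⟩
  | _, _, _, _, _, .weak h _ hr => by
      obtain ⟨hΓ, d, d', hd⟩ := h.sound hB M hM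
      exact ⟨hΓ, d, d', hr.trans hd⟩
  | _, _, _, q, _, .arch ⟨hΓ, ⟨d⟩⟩ ⟨_, ⟨d'⟩⟩ _ h =>
      ⟨hΓ, d, d', (hB.basis q).2.2.2 fun r hr =>
        LDer.le_dist_of_exists hΓ ((h r hr.1 hr.2).sound hB M hM).2 d d'⟩
  | _, _, _, _, _, .join ⟨hΓ, ⟨d⟩⟩ ⟨_, ⟨d'⟩⟩ h =>
      ⟨hΓ, d, d', iSup_le fun i => LDer.le_dist_of_exists hΓ ((h i).sound hB M hM).2 d d'⟩
  | _, _, _, _, _, .op_congr f h => by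
      obtain ⟨hΓ, d, d', hd⟩ := h.sound hB M hM
      exact ⟨hΓ, .ax f d, .ax f d', le_dist_comp_right _ hd⟩
  | _, _, _, _, _, .pair_congr h h' s hE => by
      obtain ⟨-, d, d', hd⟩ := h.sound hB M hM
      obtain ⟨-, e, e', he⟩ := h'.sound hB M hM
      exact ⟨hE, .tensorI d e s, .tensorI d' e' s, le_dist_comp_left _ (le_dist_tensor hd he)⟩
  | _, _, _, _, _, .pm_congr h h' s hE => by
      obtain ⟨-, d, d', hd⟩ := h.sound hB M hM
      obtain ⟨-, e, e', he⟩ := h'.sound hB M hM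
      exact ⟨hE, .tensorE d e s, .tensorE d' e' s, le_dist_comp_left _ (le_dist_comp
        (le_dist_whiskerRight _ hd) (le_dist_comp_left _ (le_dist_comp_left _
          (le_dist_comp_left _ he))))⟩
  | _, _, _, _, _, .letStar_congr h h' s hE => by
      obtain ⟨-, d, d', hd⟩ := h.sound hB M hM
      obtain ⟨-, e, e', he⟩ := h'.sound hB M hM
      exact ⟨hE, .unitE d e s, .unitE d' e' s, le_dist_comp_left _ (le_dist_comp
        (le_dist_whiskerRight _ hd) (le_dist_comp_left _ he))⟩
  | _, _, _, _, _, .lam_congr h => by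
      obtain ⟨hE, d, d', hd⟩ := h.sound hB M hM
      exact ⟨hE.of_bind, .lolliI d, .lolliI d', le_dist_transpose (le_dist_comp_left _ hd)⟩
  | _, _, _, _, _, .app_congr h h' s hE => by
      obtain ⟨-, d, d', hd⟩ := h.sound hB M hM
      obtain ⟨-, e, e', he⟩ := h'.sound hB M hM
      exact ⟨hE, .lolliE d e s, .lolliE d' e' s, le_dist_comp_left _ (le_dist_comp_right _
        (le_dist_tensor hd he))⟩
  | _, _, _, _, _, .exchange h p => by
      obtain ⟨hΓ, d, d', hd⟩ := h.sound hB M hM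
      obtain ⟨r, hr⟩ := LDer.exists_perm M p
      obtain ⟨e, he⟩ := hr d
      obtain ⟨e', he'⟩ := hr d'
      exact ⟨hΓ.of_perm p.symm, e, e', by rw [he, he']; exact le_dist_comp_left _ hd⟩
  | _, _, _, _, _, .subst h h' hE => by
      obtain ⟨hx, d, d', hd⟩ := h.sound hB M hM
      obtain ⟨-, e, e', he⟩ := h'.sound hB M hM
      obtain ⟨t, ht⟩ := SDer.exists_update M hx e (.append _ _)
      obtain ⟨t', ht'⟩ := SDer.exists_update M hx e' (.append _ _)
      obtain ⟨f, hf⟩ := d.exists_subst M t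
      obtain ⟨f', hf'⟩ := d'.exists_subst M t'
      -- In the composite the substituent comes first, so the two labels appear interchanged.
      have k := le_dist_comp (le_dist_comp_left (V := V) ((Shuffle.append _ _).split _)
        (le_dist_comp_right (snocIso _ _ _).inv ((one_mul _).symm.le.trans
          (le_dist_tensor (one_le_dist_self (M.retag rfl)) he)))) hd
      rw [← ht, ← ht', ← hf, ← hf', mul_comm] at k
      exact ⟨hE, f, f', k⟩
theorem VTheory.ThmArgs.sound (hB : IsLabelBasis B) (M : LInterp T.sig C) (hM : T.IsModel M) :
    ∀ {Γ : LCtx T.sig} {as bs : LArgs T.sig} {q : V} {As : List (LTy T.sig.G)},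
      T.ThmArgs Γ as bs q As →
      Γ.Distinct ∧ ∃ (d : LDerArgs T.sig Γ as As) (d' : LDerArgs T.sig Γ bs As),
        q ≤ dist (M.denArgs d) (M.denArgs d')
  | _, _, _, _, _, .nil => ⟨List.nodup_nil, .nil, .nil, one_le_dist_self _⟩
  | _, _, _, _, _, .snoc h h' s hE => by
      obtain ⟨-, d, d', hd⟩ := h.sound hB M hM
      obtain ⟨-, e, e', he⟩ := h'.sound hB M hM
      exact ⟨hE, .snoc d e s, .snoc d' e' s, le_dist_comp_left _ (le_dist_comp_right _
        (le_dist_tensor hd he))⟩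
end

theorem VTheory.Thm.satisfies (hB : IsLabelBasis B) (M : LInterp T.sig C) (hM : T.IsModel M)
    {e : VEqn V T.sig} (h : T.Thm e.ctx e.lhs e.rhs e.label e.ty) : M.Satisfies e := fun d d' =>
  LDer.le_dist_of_exists (h.sound hB M hM).1 (h.sound hB M hM).2 d d'

end Soundness

/-! ### Theorems are well typed -/

section Terminal

/-- There is exactly one morphism between any two objects of the terminal category. -/
def terminalHom (X Y : Discrete PUnit.{1}) : X ⟶ Y := eqToHom (Subsingleton.elim X Y)

theorem terminalHom_ext {X Y : Discrete PUnit.{1}} (f g : X ⟶ Y) : f = g := Subsingleton.elim _ _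

/-- The terminal category is symmetric monoidal. -/
abbrev terminalSymmetric : SymmetricCategory (Discrete PUnit.{1}) where
  symmetry _ _ := terminalHom_ext _ _

/-- The terminal category is monoidal closed. -/
abbrev terminalClosed : MonoidalClosed (Discrete PUnit.{1}) where
  closed _ :=
    { rightAdj := 𝟭 _
      adj := Adjunction.mkOfHomEquiv
        { homEquiv := fun _ _ => ⟨fun _ => terminalHom _ _, fun _ => terminalHom _ _,
            fun _ => terminalHom_ext _ _, fun _ => terminalHom_ext _ _⟩
          homEquiv_naturality_left_symm := fun _ _ => terminalHom_ext _ _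
          homEquiv_naturality_right := fun _ _ => terminalHom_ext _ _ } }

attribute [local instance] terminalSymmetric terminalClosed

/-- The terminal category, with all distances equal to `⊤`. -/
abbrev terminalEnriched (V : Type w) [CommMonoid V] [CompleteLattice V] :
    VCatSepAutonomous V (Discrete PUnit.{1}) where
  dist _ _ := ⊤
  isVCat _ _ := ⟨fun _ => le_top, fun _ _ _ => le_top⟩
  separated _ _ _ _ _ _ := terminalHom_ext _ _
  comp_vfunctor _ _ _ _ _ := le_top
  tensor_vfunctor _ _ _ _ _ _ := le_top
  ihom_vfunctor _ _ _ _ _ := le_top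
  curry_vfunctor _ _ _ _ _ := le_top
  uncurry_vfunctor _ _ _ _ _ := le_top

variable {V : Type w} [CommMonoid V] [CompleteLattice V] [IsQuantale V] {B : Set V}
  {T : VTheory.{w, u, u₂} V B}

/-- Both sides of a theorem are well typed: soundness, read in the terminal category. -/
theorem VTheory.Thm.hasTy (hB : IsLabelBasis B) {Γ : LCtx T.sig} {v w : LTm T.sig} {q : V}
    {A : LTy T.sig.G} (h : T.Thm Γ v w q A) : HasTy Γ v A ∧ HasTy Γ w A := by
  let := terminalEnriched V
  obtain ⟨hΓ, d, d', -⟩ := h.sound hB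
    (M := ⟨fun _ => ⟨⟨⟩⟩, fun _ => terminalHom _ _⟩) (fun _ _ _ _ => le_top)
  exact ⟨⟨hΓ, ⟨d⟩⟩, ⟨hΓ, ⟨d'⟩⟩⟩

end Terminal

theorem HasTy.mem_iff_free {S : LSig.{u, u₂}} {Γ : LCtx S} {v : LTm S} {A : LTy S.G}
    (h : HasTy Γ v A) {x : ℕ} : x ∈ Γ.map Prod.fst ↔ v.Free x := by
  obtain ⟨-, ⟨d⟩⟩ := h
  exact d.mem_iff_free x

theorem HasTy.hyp {S : LSig.{u, u₂}} (x : ℕ) (A : LTy S.G) :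
    HasTy [(x, A)] (LTm.var x : LTm S) A :=
  ⟨List.nodup_singleton _, ⟨.hyp x A⟩⟩

/-! ### Derived rules of the equational calculus -/

namespace VTheory

variable {V : Type w} [CommMonoid V] [CompleteLattice V] [IsQuantale V] {B : Set V}
  {T : VTheory.{w, u, u₂} V B}

theorem Thm.perm_hasTy (hB : IsLabelBasis B) {Γ Δ : LCtx T.sig} {v : LTm T.sig} {A : LTy T.sig.G}
    (h : HasTy Γ v A) (p : Δ.Perm Γ) : HasTy Δ v A :=
  (((Thm.refl h).exchange p).hasTy hB).1

/-- Substitution into a term with a single variable. Nothing else is free in the term, so that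
variable may be replaced by the constant substitution, and no context has to be kept disjoint. -/
theorem Thm.subst_const (hB : IsLabelBasis B) {Δ : LCtx T.sig} {x : ℕ} {v v' w w' : LTm T.sig}
    {q r : V} {A D : LTy T.sig.G} (h : T.Thm [(x, A)] v w q D) (h' : T.Thm Δ v' w' r A) :
    T.Thm Δ (v.subst fun _ => v') (w.subst fun _ => w') (q * r) D := by
  obtain ⟨hv, hw⟩ := h.hasTy hB
  have key : ∀ {v v' : LTm T.sig}, HasTy [(x, A)] v D → v.sub x v' = v.subst fun _ => v' :=
    fun hv => LTm.subst_congr _ fun y hy => by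
      obtain rfl : y = x := by simpa using hv.mem_iff_free.2 hy
      exact Function.update_self _ _ _
  have := h.subst h' (by rw [List.append_nil]; exact (h'.hasTy hB).1.1)
  rwa [List.append_nil, key hv, key hw] at this

/-- Renaming of part of the context, if the new names are disjoint from the old ones: the variables
are replaced one after the other. -/
theorem Thm.rename_disjoint (hB : IsLabelBasis B) (ρ : ℕ → ℕ) {q : V} {A : LTy T.sig.G} :
    ∀ (Γ Δ : LCtx T.sig) {v w : LTm T.sig}, T.Thm (Γ ++ Δ) v w q A →
      LCtx.Distinct (LCtx.ren ρ Γ ++ (Γ ++ Δ)) →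
      T.Thm (LCtx.ren ρ Γ ++ Δ)
        (v.subst fun x => if x ∈ Γ.map Prod.fst then .var (ρ x) else .var x)
        (w.subst fun x => if x ∈ Γ.map Prod.fst then .var (ρ x) else .var x) q A
  | [], Δ, v, w, h, _ => by
      simpa [LCtx.ren, LTm.subst_var] using h
  | (x, D) :: Γ, Δ, v, w, h, hd => by
      have hd' : LCtx.Distinct (S := T.sig) ((ρ x, D) :: LCtx.ren ρ Γ ++ (Γ ++ Δ)) :=
        hd.sublist (List.Sublist.append_left (List.sublist_cons_self _ _) _)
      have hx : ρ x ∉ Γ.map Prod.fst := by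
        intro hx
        obtain ⟨p, hp, hx⟩ := List.mem_map.1 hx
        exact (LCtx.distinct_cons.1 hd').1
          (List.mem_map.2 ⟨p, List.mem_append_right _ (List.mem_append_left _ hp), hx⟩)
      have p : (Γ ++ (ρ x, D) :: Δ).Perm ([(ρ x, D)] ++ (Γ ++ Δ)) := List.perm_middle
      have h₁ := (Thm.subst h (Thm.refl (HasTy.hyp (ρ x) D))
        (hd'.sublist ((List.sublist_append_right _ _).cons_cons _))).exchange p
      have h₂ := Thm.rename_disjoint hB ρ Γ ((ρ x, D) :: Δ) h₁ (hd'.of_perm (by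
        rw [List.cons_append, ← List.append_assoc, ← List.append_assoc]
        exact List.perm_middle.symm))
      have h₃ := h₂.exchange (Δ := LCtx.ren ρ ((x, D) :: Γ) ++ Δ) List.perm_middle.symm
      rw [← hB.integral, mul_one] at h₃
      have key : ∀ v : LTm T.sig, (v.sub x (.var (ρ x))).subst
          (fun x => if x ∈ Γ.map Prod.fst then .var (ρ x) else .var x) =
          v.subst fun y => if y ∈ ((x, D) :: Γ).map Prod.fst then .var (ρ y) else .var y := by
        intro v
        rw [LTm.sub, LTm.subst_subst]
        refine LTm.subst_congr _ fun y _ => ?_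
        by_cases hy : y = x
        · subst hy
          simp only [Function.update_self, LTm.subst]
          rw [if_neg hx, if_pos (by simp)]
        · simp only [Function.update_of_ne hy, LTm.subst, List.map_cons, List.mem_cons, hy,
            false_or]
      rwa [key, key] at h₃

/-- Theorems are closed under renaming of variables: the variables are replaced one after the
other, first by fresh ones. -/
theorem Thm.rename (hB : IsLabelBasis B) {Γ : LCtx T.sig} {v w : LTm T.sig} {q : V}
    {A : LTy T.sig.G} (h : T.Thm Γ v w q A) (ρ : ℕ → ℕ) (hρ : (LCtx.ren ρ Γ).Distinct) :
    T.Thm (LCtx.ren ρ Γ) (v.rename ρ) (w.rename ρ) q A := by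
  obtain ⟨hv, hw⟩ := h.hasTy hB
  obtain ⟨N, hN⟩ : ∃ N, ∀ x ∈ Γ.map Prod.fst ++ (Γ.map Prod.fst).map ρ, x < N :=
    ⟨(Γ.map Prod.fst ++ (Γ.map Prod.fst).map ρ).sum + 1,
      fun x hx => Nat.lt_succ_of_le (List.single_le_sum (fun _ _ => Nat.zero_le _) x hx)⟩
  have fst_ren : ∀ (ρ : ℕ → ℕ) (Γ : LCtx T.sig),
      (LCtx.ren ρ Γ).map Prod.fst = (Γ.map Prod.fst).map ρ := fun ρ Γ => by
    simp [LCtx.ren, Function.comp_def]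
  have d₁ : LCtx.Distinct (LCtx.ren (· + N) Γ ++ (Γ ++ [])) := by
    rw [LCtx.Distinct, List.map_append, List.append_nil, fst_ren, List.nodup_append]
    refine ⟨hv.1.map (add_left_injective N), hv.1, ?_⟩
    rintro a ha b hb rfl
    obtain ⟨c, -, rfl⟩ := List.mem_map.1 ha
    have := hN _ (List.mem_append_left _ hb)
    omega
  have e₂ : LCtx.ren (fun x => ρ (x - N)) (LCtx.ren (· + N) Γ) = LCtx.ren ρ Γ := by
    simp [LCtx.ren, Function.comp_def]
  have d₂ : LCtx.Distinct (LCtx.ren (fun x => ρ (x - N)) (LCtx.ren (· + N) Γ) ++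
      (LCtx.ren (· + N) Γ ++ [])) := by
    rw [e₂, LCtx.Distinct, List.map_append, List.append_nil, fst_ren, fst_ren, List.nodup_append]
    refine ⟨by rw [← fst_ren]; exact hρ, hv.1.map (add_left_injective N), ?_⟩
    rintro a ha b hb rfl
    obtain ⟨c, -, rfl⟩ := List.mem_map.1 hb
    have := hN _ (List.mem_append_right _ ha)
    omega
  have h₁ := Thm.rename_disjoint hB (· + N) Γ [] (by rwa [List.append_nil]) d₁
  have h₂ := Thm.rename_disjoint hB (fun x => ρ (x - N)) _ [] h₁ d₂
  rw [e₂, List.append_nil] at h₂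
  have key : ∀ {v : LTm T.sig}, HasTy Γ v A →
      (v.subst fun x => if x ∈ Γ.map Prod.fst then .var (x + N) else .var x).subst
        (fun x => if x ∈ (LCtx.ren (· + N) Γ).map Prod.fst then .var (ρ (x - N)) else .var x) =
      v.rename ρ := by
    intro v hv
    rw [LTm.subst_subst, LTm.rename_eq_subst]
    refine LTm.subst_congr _ fun x hx => ?_
    have hx := hv.mem_iff_free.2 hx
    rw [if_pos hx, LTm.subst, if_pos (by rw [fst_ren]; exact List.mem_map_of_mem hx),
      Nat.add_sub_cancel]
  rwa [key hv, key hw] at h₂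

/-- To prove an equation in a context with a variable `z : A ⊗ B`, it is enough to prove it with
a pair of fresh variables for `z`. -/
theorem Thm.tensor_ext (hB : IsLabelBasis B) {Δ : LCtx T.sig} {t t' : LTm T.sig} {z a b : ℕ}
    {q : V} {A A' D : LTy T.sig.G} (ht : HasTy ((z, .tensor A A') :: Δ) t D)
    (ht' : HasTy ((z, .tensor A A') :: Δ) t' D)
    (h : T.Thm ((b, A') :: (a, A) :: Δ) (t.sub z (.pair (.var a) (.var b)))
      (t'.sub z (.pair (.var a) (.var b))) q D) :
    T.Thm ((z, .tensor A A') :: Δ) t t' q D := by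
  have hd := (h.hasTy hB).1.1
  obtain ⟨hb, ha⟩ := LCtx.distinct_cons.1 hd
  obtain ⟨ha, hΔ⟩ := LCtx.distinct_cons.1 ha
  simp only [List.map_cons, List.mem_cons, not_or] at hb
  have hz := (LCtx.distinct_cons.1 ht.1).1
  let ρ : ℕ → ℕ := fun n => if n = b then 0 else if n = a then 1 else n + 2
  have hρ : ∀ x ∈ Δ.map Prod.fst, ρ x = x + 2 := fun x hx => by
    have h₁ : x ≠ b := fun h => hb.2 (h ▸ hx)
    have h₂ : x ≠ a := fun h => ha (h ▸ hx)
    simp [ρ, h₁, h₂]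
  have hΓ : LCtx.ren ρ ((b, A') :: (a, A) :: Δ) = Δ.bind₂ A A' := by
    have h₁ : LCtx.ren ρ Δ = Δ.shift 2 :=
      List.map_congr_left fun p hp => by rw [hρ _ (List.mem_map_of_mem hp)]
    have h₂ : ρ b = 0 := if_pos rfl
    have h₃ : ρ a = 1 := by simp [ρ, Ne.symm hb.1]
    simp only [LCtx.ren, LCtx.bind₂, List.map_cons, h₂, h₃] at h₁ ⊢
    rw [h₁]
  have h' := h.rename hB ρ (by rw [hΓ]; exact hΔ.bind₂ _ _)
  rw [hΓ] at h'
  have key : ∀ {t : LTm T.sig}, HasTy ((z, .tensor A A') :: Δ) t D →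
      (t.sub z (.pair (.var a) (.var b))).rename ρ =
        (t.rename (· + 2)).sub (z + 2) (.pair (.var 1) (.var 0)) := by
    intro t ht
    rw [LTm.sub_rename_add_two, LTm.sub, LTm.rename_subst]
    refine LTm.subst_congr _ fun x hx => ?_
    by_cases hxz : x = z
    · subst hxz
      simp [LTm.rename, ρ, Ne.symm hb.1]
    · have hx := ht.mem_iff_free.2 hx
      simp only [List.map_cons, List.mem_cons, hxz, false_or] at hx
      simp [Function.update_of_ne hxz, LTm.rename, hρ x hx]
  rw [key ht, key ht'] at h'
  have h'' := Thm.pm_congr (Thm.refl (HasTy.hyp z (.tensor A A'))) h'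
    (.left _ (.allRight Δ)) ht.1
  have eta : ∀ {t : LTm T.sig}, HasTy ((z, .tensor A A') :: Δ) t D → AutEqn
      ((z, .tensor A A') :: Δ) (.pm (.var z)
        ((t.rename (· + 2)).sub (z + 2) (.pair (.var 1) (.var 0)))) t D := by
    intro t ht
    have := AutEqn.tensor_eta (HasTy.hyp z (.tensor A A')) ht ht.1 (List.Perm.refl _)
    rwa [LTm.sub, LTm.sub, Function.update_eq_self, LTm.subst_var] at this
  have := ((Thm.aut_symm (eta ht)).trans h'').trans (Thm.aut (eta ht'))
  simpa only [← hB.integral, one_mul, mul_one] using this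

/-- To prove an equation in a context with a variable `z : I`, it is enough to prove it with
`*` for `z`. -/
theorem Thm.unit_ext (hB : IsLabelBasis B) {Δ : LCtx T.sig} {t t' : LTm T.sig} {z : ℕ}
    {q : V} {D : LTy T.sig.G} (ht : HasTy ((z, .unit) :: Δ) t D)
    (ht' : HasTy ((z, .unit) :: Δ) t' D)
    (h : T.Thm Δ (t.sub z .star) (t'.sub z .star) q D) :
    T.Thm ((z, .unit) :: Δ) t t' q D := by
  have h' := Thm.letStar_congr (Thm.refl (HasTy.hyp z .unit)) h (.left _ (.allRight Δ)) ht.1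
  have eta : ∀ {t : LTm T.sig}, HasTy ((z, .unit) :: Δ) t D → AutEqn
      ((z, .unit) :: Δ) (.letStar (.var z) (t.sub z .star)) t D := by
    intro t ht
    have := AutEqn.unit_eta (HasTy.hyp z .unit) ht ht.1 (List.Perm.refl _)
    rwa [LTm.sub, LTm.sub, Function.update_eq_self, LTm.subst_var] at this
  have := ((Thm.aut_symm (eta ht)).trans h').trans (Thm.aut (eta ht'))
  simpa only [← hB.integral, one_mul, mul_one] using this

/-- A variable may be replaced by another one in order to prove an equation. -/
theorem Thm.var_ext (hB : IsLabelBasis B) {Δ : LCtx T.sig} {t t' : LTm T.sig} {x z : ℕ}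
    {q : V} {A D : LTy T.sig.G} (ht : HasTy ((z, A) :: Δ) t D) (ht' : HasTy ((z, A) :: Δ) t' D)
    (h : T.Thm ((x, A) :: Δ) (t.sub z (.var x)) (t'.sub z (.var x)) q D) :
    T.Thm ((z, A) :: Δ) t t' q D := by
  have hx := (LCtx.distinct_cons.1 (h.hasTy hB).1.1).1
  have h' := h.subst (Thm.refl (HasTy.hyp z A)) ht.1
  have key : ∀ {t : LTm T.sig}, HasTy ((z, A) :: Δ) t D →
      (t.sub z (.var x)).sub x (.var z) = t := by
    intro t ht
    rw [LTm.sub, LTm.sub, LTm.subst_subst]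
    refine LTm.subst_eq_self fun y hy => ?_
    by_cases hyz : y = z
    · subst hyz; simp [LTm.subst]
    · have hy := ht.mem_iff_free.2 hy
      simp only [List.map_cons, List.mem_cons, hyz, false_or] at hy
      rw [Function.update_of_ne hyz, LTm.subst,
        Function.update_of_ne (fun h : y = x => hx (h ▸ hy))]
  rw [key ht, key ht'] at h'
  rw [← hB.integral, mul_one] at h'
  exact h'

end VTheory

/-! ### Patterns -/

theorem exists_forall_mem_lt (l : List ℕ) : ∃ N, ∀ x ∈ l, x < N :=
  ⟨l.sum + 1, fun _ hx => Nat.lt_succ_of_le (List.single_le_sum (fun _ _ => Nat.zero_le _) _ hx)⟩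

/-- `Pat Γ p A`: the term `p` of type `A` is built from `*` and the variables of `Γ` by pairing. -/
inductive Pat {S : LSig.{u, u₂}} : LCtx S → LTm S → LTy S.G → Prop
  | var (x : ℕ) (A : LTy S.G) : Pat [(x, A)] (.var x) A
  | star : Pat [] .star .unit
  | pair {Γ Δ E : LCtx S} {p p' : LTm S} {A A' : LTy S.G} (h : Pat Γ p A) (h' : Pat Δ p' A')
      (s : Shuffle Γ Δ E) : Pat E (.pair p p') (.tensor A A')

theorem Pat.hasTy {S : LSig.{u, u₂}} {Γ : LCtx S} {p : LTm S} {A : LTy S.G} (h : Pat Γ p A)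
    (hΓ : Γ.Distinct) : HasTy Γ p A := by
  induction h with
  | var x A => exact .hyp x A
  | star => exact ⟨List.nodup_nil, ⟨.unitI⟩⟩
  | pair _ _ s ih ih' =>
    obtain ⟨-, ⟨d⟩⟩ := ih (hΓ.left s)
    obtain ⟨-, ⟨d'⟩⟩ := ih' (hΓ.right s)
    exact ⟨hΓ, ⟨.tensorI d d' s⟩⟩

section

variable {V : Type w} [CommMonoid V] [CompleteLattice V] [IsQuantale V] {B : Set V}
  {T : VTheory.{w, u, u₂} V B}

theorem HasTy.sub (hB : IsLabelBasis B) (T : VTheory.{w, u, u₂} V B) {Γ Δ E : LCtx T.sig}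
    {t v : LTm T.sig} {z : ℕ} {A D : LTy T.sig.G} (ht : HasTy ((z, A) :: Γ) t D) (hv : HasTy Δ v A)
    (hE : E.Distinct) (p : E.Perm (Δ ++ Γ)) : HasTy E (t.sub z v) D :=
  ((((VTheory.Thm.refl (T := T) ht).subst (.refl hv) (hE.of_perm p)).exchange p).hasTy hB).1

theorem HasTy.subst_const (hB : IsLabelBasis B) (T : VTheory.{w, u, u₂} V B) {Δ : LCtx T.sig}
    {t v : LTm T.sig} {z : ℕ} {A D : LTy T.sig.G} (ht : HasTy [(z, A)] t D) (hv : HasTy Δ v A) :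
    HasTy Δ (t.subst fun _ => v) D :=
  (((VTheory.Thm.refl (T := T) ht).subst_const hB (.refl hv)).hasTy hB).1

/-- A variable may be replaced by a pattern in order to prove an equation: patterns are the
generic elements of their types. -/
theorem Pat.thm_of_sub (hB : IsLabelBasis B) {Γ : LCtx T.sig} {p : LTm T.sig} {X : LTy T.sig.G}
    (h : Pat Γ p X) : ∀ {Δ E : LCtx T.sig} {t t' : LTm T.sig} {z : ℕ} {q : V} {D : LTy T.sig.G},
      HasTy ((z, X) :: Δ) t D → HasTy ((z, X) :: Δ) t' D → E.Perm (Γ ++ Δ) →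
      T.Thm E (t.sub z p) (t'.sub z p) q D → T.Thm ((z, X) :: Δ) t t' q D := by
  induction h with
  | var x A => exact fun ht ht' p h => h.exchange p.symm |>.var_ext hB ht ht'
  | star => exact fun ht ht' p h => h.exchange p.symm |>.unit_ext hB ht ht'
  | @pair Γ₁ Γ₂ Γ p p' A A' h₁ h₂ s ih₁ ih₂ =>
    intro Δ E t t' z q D ht ht' hE h
    have hΓ := (h.hasTy hB).1.1.of_perm hE
    have hΓ' : LCtx.Distinct (Γ₁ ++ (Γ₂ ++ Δ)) := hΓ.of_perm (by
      rw [← List.append_assoc]; exact s.perm.append_right Δ)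
    obtain ⟨a, ha⟩ := exists_forall_mem_lt ((Γ₁ ++ (Γ₂ ++ Δ)).map Prod.fst)
    have hp' := h₂.hasTy ((hΓ.sublist (List.sublist_append_left _ _)).right s)
    have hfresh : ∀ {Θ : LCtx T.sig} {x : ℕ}, Θ.Sublist (Γ₁ ++ (Γ₂ ++ Δ)) → a ≤ x →
        x ∉ Θ.map Prod.fst := fun hΘ hx hx' =>
      absurd (ha _ ((hΘ.map _).subset hx')) (not_lt.2 hx)
    have sΔ : Δ.Sublist (Γ₁ ++ (Γ₂ ++ Δ)) :=
      (List.sublist_append_right _ _).trans (List.sublist_append_right _ _)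
    have s₂ : (Γ₂ ++ Δ).Sublist (Γ₁ ++ (Γ₂ ++ Δ)) := List.sublist_append_right _ _
    have s₃ : Γ₂.Sublist (Γ₁ ++ (Γ₂ ++ Δ)) := (List.sublist_append_left _ _).trans s₂
    have d₁ : LCtx.Distinct (S := T.sig) ((a, A) :: Δ) :=
      LCtx.distinct_cons.2 ⟨hfresh sΔ le_rfl, hΓ'.sublist sΔ⟩
    have d₂ : LCtx.Distinct (S := T.sig) ((a + 1, A') :: (a, A) :: Δ) :=
      LCtx.distinct_cons.2 ⟨fun h => by
        rcases List.mem_cons.1 h with h | h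
        · exact absurd h (Nat.succ_ne_self a)
        · exact hfresh (x := a + 1) sΔ a.le_succ h, d₁⟩
    have d₃ : LCtx.Distinct (S := T.sig) ((a, A) :: (Γ₂ ++ Δ)) :=
      LCtx.distinct_cons.2 ⟨hfresh s₂ le_rfl, hΓ'.sublist s₂⟩
    have typ : ∀ {t : LTm T.sig}, HasTy ((z, .tensor A A') :: Δ) t D →
        HasTy ((a + 1, A') :: (a, A) :: Δ) (t.sub z (.pair (.var a) (.var (a + 1)))) D :=
      fun ht => ht.sub hB T ((Pat.pair (.var a A) (.var (a + 1) A')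
        (.right _ (.allLeft _))).hasTy (d₂.sublist (List.Sublist.append_left
          (List.nil_sublist Δ) [(a + 1, A'), (a, A)]))) d₂ (List.Perm.refl _)
    have typ' : ∀ {t : LTm T.sig}, HasTy ((z, .tensor A A') :: Δ) t D →
        HasTy ((a, A) :: (Γ₂ ++ Δ))
          ((t.sub z (.pair (.var a) (.var (a + 1)))).sub (a + 1) p') D :=
      fun ht => (typ ht).sub hB T hp' d₃ List.perm_middle.symm
    have key : ∀ {t : LTm T.sig}, HasTy ((z, .tensor A A') :: Δ) t D →
        ((t.sub z (.pair (.var a) (.var (a + 1)))).sub (a + 1) p').sub a p =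
          t.sub z (.pair p p') := by
      intro t ht
      simp only [LTm.sub, LTm.subst_subst]
      refine LTm.subst_congr _ fun x hx => ?_
      by_cases hxz : x = z
      · subst hxz
        simp only [Function.update_self, LTm.subst]
        rw [Function.update_of_ne (Nat.succ_ne_self a).symm, LTm.subst, Function.update_self,
          LTm.subst_eq_self fun y hy => Function.update_of_ne
            (fun h : y = a => hfresh s₃ le_rfl (h ▸ hp'.mem_iff_free.2 hy)) _ _]
      · have hx := ht.mem_iff_free.2 hx
        simp only [List.map_cons, List.mem_cons, hxz, false_or] at hx
        rw [Function.update_of_ne hxz, Function.update_of_ne hxz, LTm.subst,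
          Function.update_of_ne (fun h : x = a + 1 => hfresh (x := a + 1) sΔ a.le_succ (h ▸ hx)),
          LTm.subst, Function.update_of_ne (fun h : x = a => hfresh sΔ le_rfl (h ▸ hx))]
    refine VTheory.Thm.tensor_ext hB ht ht' (ih₂ (typ ht) (typ ht') List.perm_middle.symm
      (ih₁ (typ' ht) (typ' ht') (hE.trans ?_) ?_))
    · rw [← List.append_assoc]; exact s.perm.append_right Δ
    · rwa [key ht, key ht']

theorem Pat.thm_of_subst (hB : IsLabelBasis B) {Γ : LCtx T.sig} {p : LTm T.sig} {X D : LTy T.sig.G}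
    {t t' : LTm T.sig} {q : V} (h : Pat Γ p X) (ht : HasTy [(0, X)] t D)
    (ht' : HasTy [(0, X)] t' D)
    (h' : T.Thm Γ (t.subst fun _ => p) (t'.subst fun _ => p) q D) : T.Thm [(0, X)] t t' q D := by
  have key : ∀ {t : LTm T.sig}, HasTy [(0, X)] t D → t.sub 0 p = t.subst fun _ => p :=
    fun ht => LTm.subst_congr _ fun y hy => by
      obtain rfl : y = 0 := by simpa using ht.mem_iff_free.2 hy
      exact Function.update_self _ _ _
  refine h.thm_of_sub hB ht ht' (E := Γ) (by rw [List.append_nil]) ?_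
  rwa [key ht, key ht']

/-! ### Provable distances -/

/-- A distance in `B` below the join of the provable distances is provable. -/
theorem VTheory.Thm.of_le_sSup {Γ : LCtx T.sig} {v w : LTm T.sig} {q : V}
    {A : LTy T.sig.G} (hv : HasTy Γ v A) (hw : HasTy Γ w A) (hq : q ∈ B)
    (h : q ≤ sSup {r | T.Thm Γ v w r A}) : T.Thm Γ v w q A := by
  refine .arch hv hw hq fun r hr hrq => ?_
  obtain ⟨s, hs, hfin, hrs⟩ := hrq _ h
  obtain ⟨n, f, -, rfl⟩ := hfin.fin_param
  exact (Thm.join hv hw fun i => hs (Set.mem_range_self i)).weak hr hrs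

/-- Two terms are provably equal if both are provably at distance `⊤` from each other. -/
def VTheory.Eqv (T : VTheory.{w, u, u₂} V B) (Γ : LCtx T.sig) (v w : LTm T.sig) (A : LTy T.sig.G) :
    Prop :=
  T.Thm Γ v w ⊤ A ∧ T.Thm Γ w v ⊤ A

namespace VTheory.Eqv

variable {Γ Δ E : LCtx T.sig} {v w t v' w' : LTm T.sig} {A D A' : LTy T.sig.G}

theorem of_aut (h : AutEqn Γ v w A) : T.Eqv Γ v w A := ⟨.aut h, .aut_symm h⟩

theorem refl (h : HasTy Γ v A) : T.Eqv Γ v v A := ⟨.refl h, .refl h⟩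

theorem symm (h : T.Eqv Γ v w A) : T.Eqv Γ w v A := ⟨h.2, h.1⟩

theorem top_mul_top (hB : IsLabelBasis B) : (⊤ : V) * ⊤ = ⊤ := by rw [← hB.integral, one_mul]

theorem trans (hB : IsLabelBasis B) (h : T.Eqv Γ v w A) (h' : T.Eqv Γ w t A) : T.Eqv Γ v t A :=
  ⟨top_mul_top hB ▸ h.1.trans h'.1, top_mul_top hB ▸ h'.2.trans h.2⟩

theorem right (hB : IsLabelBasis B) (h : T.Eqv Γ v w A) : HasTy Γ w A := (h.1.hasTy hB).2

theorem pair (hB : IsLabelBasis B) (h : T.Eqv Γ v w A) (h' : T.Eqv Δ v' w' D) (s : Shuffle Γ Δ E)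
    (hE : E.Distinct) : T.Eqv E (.pair v v') (.pair w w') (.tensor A D) :=
  ⟨top_mul_top hB ▸ h.1.pair_congr h'.1 s hE, top_mul_top hB ▸ h.2.pair_congr h'.2 s hE⟩

theorem pm (hB : IsLabelBasis B) (h : T.Eqv Γ v w (.tensor A A'))
    (h' : T.Eqv (Δ.bind₂ A A') v' w' D) (s : Shuffle Γ Δ E) (hE : E.Distinct) :
    T.Eqv E (.pm v v') (.pm w w') D :=
  ⟨top_mul_top hB ▸ h.1.pm_congr h'.1 s hE, top_mul_top hB ▸ h.2.pm_congr h'.2 s hE⟩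

theorem letStar (hB : IsLabelBasis B) (h : T.Eqv Γ v w .unit) (h' : T.Eqv Δ v' w' D)
    (s : Shuffle Γ Δ E) (hE : E.Distinct) : T.Eqv E (.letStar v v') (.letStar w w') D :=
  ⟨top_mul_top hB ▸ h.1.letStar_congr h'.1 s hE, top_mul_top hB ▸ h.2.letStar_congr h'.2 s hE⟩

theorem app (hB : IsLabelBasis B) (h : T.Eqv Γ v w (.lolli A D)) (h' : T.Eqv Δ v' w' A)
    (s : Shuffle Γ Δ E) (hE : E.Distinct) : T.Eqv E (.app v v') (.app w w') D :=
  ⟨top_mul_top hB ▸ h.1.app_congr h'.1 s hE, top_mul_top hB ▸ h.2.app_congr h'.2 s hE⟩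

theorem lam (h : T.Eqv (Γ.bind A) v w D) : T.Eqv Γ (.lam A v) (.lam A w) (.lolli A D) :=
  ⟨h.1.lam_congr, h.2.lam_congr⟩

theorem subst_const (hB : IsLabelBasis B) {x : ℕ} (h : T.Eqv [(x, A)] v w D)
    (h' : T.Eqv Δ v' w' A) : T.Eqv Δ (v.subst fun _ => v') (w.subst fun _ => w') D :=
  ⟨top_mul_top hB ▸ h.1.subst_const hB h'.1, top_mul_top hB ▸ h.2.subst_const hB h'.2⟩

/-- Provable distances are invariant under provable equality. -/
theorem thm (hB : IsLabelBasis B) {q : V} (h : T.Eqv Γ v w A) (h' : T.Eqv Γ v' w' A)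
    (k : T.Thm Γ v v' q A) : T.Thm Γ w w' q A := by
  have := (h.2.trans k).trans h'.1
  rwa [← hB.integral, one_mul, mul_one] at this

end VTheory.Eqv

/-- Elimination of a pair below a one-variable term. -/
theorem AutEqn.pm_subst_const (hB : IsLabelBasis B) (T : VTheory.{w, u, u₂} V B)
    {Γ Δ E : LCtx T.sig} {h a v : LTm T.sig} {X A A' D : LTy T.sig.G}
    (hh : HasTy [(0, .tensor X (.tensor A A'))] h D) (ha : HasTy Δ a X)
    (hv : HasTy Γ v (.tensor A A')) (s : Shuffle Γ Δ E) (hE : E.Distinct) :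
    AutEqn E (.pm v (h.subst fun _ => .pair (a.rename (· + 2)) (.pair (.var 1) (.var 0))))
      (h.subst fun _ => .pair a v) D := by
  obtain ⟨z, hz⟩ := exists_forall_mem_lt (Δ.map Prod.fst)
  have hz : z ∉ Δ.map Prod.fst := fun h => lt_irrefl _ (hz z h)
  have hp : HasTy ((z, .tensor A A') :: Δ) (.pair a (.var z)) (.tensor X (.tensor A A')) := by
    obtain ⟨hΔ, ⟨d⟩⟩ := ha
    exact ⟨LCtx.distinct_cons.2 ⟨hz, hΔ⟩, ⟨.tensorI d (.hyp z _) (.right _ (.allLeft _))⟩⟩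
  have key := AutEqn.tensor_eta hv (hh.subst_const hB T hp) hE s.perm
  have hne : ∀ x, a.Free x → x ≠ z := fun x hx h => hz (h ▸ ha.mem_iff_free.2 hx)
  have e₁ : a.subst (Function.update (fun n => LTm.var (n + 2)) z (.pair (.var 1) (.var 0))) =
      a.rename (· + 2) := by
    rw [LTm.rename_eq_subst]
    exact LTm.subst_congr _ fun x hx => Function.update_of_ne (hne x hx) _ _
  have e₂ : a.subst (Function.update LTm.var z v) = a :=
    LTm.subst_eq_self fun x hx => Function.update_of_ne (hne x hx) _ _
  rw [LTm.sub_rename_add_two, LTm.subst_subst, LTm.sub, LTm.subst_subst] at key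
  simpa only [LTm.subst, Function.update_self, e₁, e₂] using key

/-- Elimination of `*` below a one-variable term. -/
theorem AutEqn.letStar_subst_const (hB : IsLabelBasis B) (T : VTheory.{w, u, u₂} V B)
    {Γ Δ E : LCtx T.sig} {h a v : LTm T.sig} {X D : LTy T.sig.G}
    (hh : HasTy [(0, .tensor .unit X)] h D) (ha : HasTy Δ a X) (hv : HasTy Γ v .unit)
    (s : Shuffle Γ Δ E) (hE : E.Distinct) :
    AutEqn E (.letStar v (h.subst fun _ => .pair .star a)) (h.subst fun _ => .pair v a) D := by
  obtain ⟨z, hz⟩ := exists_forall_mem_lt (Δ.map Prod.fst)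
  have hz : z ∉ Δ.map Prod.fst := fun h => lt_irrefl _ (hz z h)
  have hp : HasTy ((z, .unit) :: Δ) (.pair (.var z) a) (.tensor .unit X) := by
    obtain ⟨hΔ, ⟨d⟩⟩ := ha
    exact ⟨LCtx.distinct_cons.2 ⟨hz, hΔ⟩, ⟨.tensorI (.hyp z _) d (.left _ (.allRight _))⟩⟩
  have key := AutEqn.unit_eta hv (hh.subst_const hB T hp) hE s.perm
  have e : ∀ v, a.subst (Function.update LTm.var z v) = a := fun v =>
    LTm.subst_eq_self fun x hx => Function.update_of_ne
      (fun h : x = z => hz (h ▸ ha.mem_iff_free.2 hx)) _ _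
  rw [LTm.sub, LTm.subst_subst, LTm.sub, LTm.subst_subst] at key
  simpa only [LTm.subst, Function.update_self, e] using key

end

/-! ### Inversion of typings -/

section

variable {V : Type w} [CommMonoid V] [CompleteLattice V] [IsQuantale V] {B : Set V}
  {T : VTheory.{w, u, u₂} V B} {Γ : LCtx T.sig} {v w t : LTm T.sig} {A D : LTy T.sig.G}

theorem HasTy.of_pair {S : LSig.{u, u₂}} {Γ : LCtx S} {v w : LTm S} {A A' : LTy S.G}
    (h : HasTy Γ (.pair v w) (.tensor A A')) :
    ∃ Γ₁ Γ₂, HasTy Γ₁ v A ∧ HasTy Γ₂ w A' ∧ Nonempty (Shuffle Γ₁ Γ₂ Γ) := by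
  obtain ⟨hΓ, ⟨d⟩⟩ := h
  cases d with
  | tensorI d e s => exact ⟨_, _, ⟨hΓ.left s, ⟨d⟩⟩, ⟨hΓ.right s, ⟨e⟩⟩, ⟨s⟩⟩

theorem VTheory.Eqv.tensor_beta (h : HasTy Γ (.pm (.pair v w) t) D) :
    T.Eqv Γ (.pm (.pair v w) t) (t.inst₂ v w) D := by
  obtain ⟨hΓ, ⟨d⟩⟩ := h
  cases d with
  | tensorE d e s =>
    cases d with
    | tensorI d d' s' =>
      have h' := hΓ.left s
      exact .of_aut (.tensor_beta ⟨h'.left s', ⟨d⟩⟩ ⟨h'.right s', ⟨d'⟩⟩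
        ⟨(hΓ.right s).bind₂ _ _, ⟨e⟩⟩ hΓ (s.perm.trans (s'.perm.append_right _)))

theorem VTheory.Eqv.unit_beta (h : HasTy Γ (.letStar .star v) A) :
    T.Eqv Γ (.letStar .star v) v A := by
  obtain ⟨hΓ, ⟨d⟩⟩ := h
  cases d with
  | unitE d e s =>
    cases d
    obtain ⟨rfl, -⟩ := s.eq_of_nil_left
    exact .of_aut (.unit_beta ⟨hΓ, ⟨e⟩⟩)

theorem VTheory.Eqv.lolli_beta (h : HasTy Γ (.app (.lam A v) w) D) :
    T.Eqv Γ (.app (.lam A v) w) (v.inst w) D := by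
  obtain ⟨hΓ, ⟨d⟩⟩ := h
  cases d with
  | lolliE d e s =>
    cases d with
    | lolliI d =>
      exact .of_aut (.lolli_beta ⟨(hΓ.left s).bind _, ⟨d⟩⟩ ⟨hΓ.right s, ⟨e⟩⟩ hΓ s.perm)

end

/-! ### Morphisms of the syntactic category -/

namespace VTheory

variable {V : Type w} [CommMonoid V] [CompleteLattice V] {B : Set V}
  {T : VTheory.{w, u, u₂} V B}

/-- Terms `v` with `x : A ▷ v : D`, up to provable distance `⊤` in both directions. -/
def SynHom (hT : Varietal.{w, u, u₂, v} T) (A D : LTy T.sig.G) : Type v :=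
  @Shrink.{v} (Quot fun v w : T.TermHom A D => 1 ≤ T.termDist v w ∧ 1 ≤ T.termDist w v) (hT A D)

namespace SynHom

variable {hT : Varietal.{w, u, u₂, v} T} {A D : LTy T.sig.G}

/-- The morphism represented by a term. -/
noncomputable def mk (hT : Varietal.{w, u, u₂, v} T) {A D : LTy T.sig.G} (t : LTm T.sig)
    (h : HasTy [(0, A)] t D) : SynHom hT A D :=
  @equivShrink.{v} _ (hT A D) (Quot.mk _ ⟨t, h⟩)

/-- A chosen representative of a morphism. -/
noncomputable def repHom (f : SynHom hT A D) : T.TermHom A D :=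
  ((@equivShrink.{v} _ (hT A D)).symm f).out

/-- The term underlying a chosen representative of a morphism. -/
noncomputable def rep (f : SynHom hT A D) : LTm T.sig := f.repHom.1

theorem hasTy (f : SynHom hT A D) : HasTy [(0, A)] f.rep D := f.repHom.2

/-- The action of a morphism on terms, by substitution. -/
noncomputable def act (f : SynHom hT A D) (u : LTm T.sig) : LTm T.sig := f.rep.subst fun _ => u

theorem act_subst (f : SynHom hT A D) (u : LTm T.sig) (σ : ℕ → LTm T.sig) :
    (f.act u).subst σ = f.act (u.subst σ) :=
  LTm.subst_subst _ _ _

theorem act_rename (f : SynHom hT A D) (u : LTm T.sig) (ρ : ℕ → ℕ) :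
    (f.act u).rename ρ = f.act (u.rename ρ) :=
  LTm.rename_subst _ _ _

/-- The distance between two morphisms. -/
noncomputable def dist (f g : SynHom hT A D) : V := T.termDist f.repHom g.repHom

theorem le_dist {f g : SynHom hT A D} {q : V} (h : T.Thm [(0, A)] f.rep g.rep q D) :
    q ≤ dist f g :=
  le_sSup h

variable [IsQuantale V]

/-- Since the multiplication preserves joins, an estimate of a product of distances may be checked
on provable labels. -/
theorem dist_mul_dist_le {A' D' : LTy T.sig.G} {f f' : SynHom hT A D} {g g' : SynHom hT A' D'}
    {c : V} (h : ∀ q r, T.Thm [(0, A)] f.rep f'.rep q D → T.Thm [(0, A')] g.rep g'.rep r D' →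
      q * r ≤ c) : dist f f' * dist g g' ≤ c := by
  rw [dist, termDist, sSup_mul_distrib]
  refine iSup₂_le fun q hq => ?_
  rw [dist, termDist, mul_sSup_distrib]
  exact iSup₂_le fun r hr => h q r hq hr

/-- Distances in the basis are attained by theorems. -/
theorem thm_of_le_dist {f g : SynHom hT A D} {q : V} (hq : q ∈ B)
    (h : q ≤ dist f g) : T.Thm [(0, A)] f.rep g.rep q D :=
  .of_le_sSup f.hasTy g.hasTy hq h

theorem eqv_of_one_le (hB : IsLabelBasis B) {v w : T.TermHom A D}
    (h : 1 ≤ T.termDist v w ∧ 1 ≤ T.termDist w v) : T.Eqv [(0, A)] v.1 w.1 D := by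
  rw [hB.integral] at h
  exact ⟨.of_le_sSup v.2 w.2 (hB.integral ▸ hB.one_mem) h.1,
    .of_le_sSup w.2 v.2 (hB.integral ▸ hB.one_mem) h.2⟩

theorem rep_mk (hB : IsLabelBasis B) (t : LTm T.sig) (h : HasTy [(0, A)] t D) :
    T.Eqv [(0, A)] (mk hT t h).rep t D := by
  have e : Quot.mk (fun v w : T.TermHom A D => 1 ≤ T.termDist v w ∧ 1 ≤ T.termDist w v)
      (mk hT t h).repHom = Quot.mk _ ⟨t, h⟩ := by
    rw [repHom, Quot.out_eq, mk, Equiv.symm_apply_apply]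
  have k := Quot.eqvGen_exact e
  have : ∀ {v w : T.TermHom A D}, Relation.EqvGen
      (fun v w : T.TermHom A D => 1 ≤ T.termDist v w ∧ 1 ≤ T.termDist w v) v w →
      T.Eqv [(0, A)] v.1 w.1 D := by
    intro v w h
    induction h with
    | rel v w h => exact eqv_of_one_le hB h
    | refl v => exact .refl v.2
    | symm v w _ ih => exact ih.symm
    | trans v w t _ _ ih ih' => exact ih.trans hB ih'
  exact this k

theorem ext_rep (hB : IsLabelBasis B) {f g : SynHom hT A D}
    (h : T.Eqv [(0, A)] f.rep g.rep D) : f = g := by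
  have : (@equivShrink.{v} _ (hT A D)).symm f = (@equivShrink.{v} _ (hT A D)).symm g := by
    rw [← Quot.out_eq ((@equivShrink.{v} _ (hT A D)).symm f),
      ← Quot.out_eq ((@equivShrink.{v} _ (hT A D)).symm g)]
    refine Quot.sound ?_
    exact ⟨hB.integral.le.trans (le_sSup h.1), hB.integral.le.trans (le_sSup h.2)⟩
  exact (@equivShrink.{v} _ (hT A D)).symm.injective this

theorem act_hasTy (hB : IsLabelBasis B) (f : SynHom hT A D) {Γ : LCtx T.sig} {u : LTm T.sig}
    (hu : HasTy Γ u A) : HasTy Γ (f.act u) D :=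
  f.hasTy.subst_const hB T hu

theorem act_congr (hB : IsLabelBasis B) (f : SynHom hT A D) {Γ : LCtx T.sig} {u u' : LTm T.sig}
    (hu : T.Eqv Γ u u' A) : T.Eqv Γ (f.act u) (f.act u') D :=
  (Eqv.refl f.hasTy).subst_const hB hu

theorem mk_act (hB : IsLabelBasis B) {t : LTm T.sig} (h : HasTy [(0, A)] t D) {Γ : LCtx T.sig}
    {u : LTm T.sig} (hu : HasTy Γ u A) :
    T.Eqv Γ ((mk hT t h).act u) (t.subst fun _ => u) D :=
  (rep_mk hB t h).subst_const hB (.refl hu)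

theorem thm_of_act (hB : IsLabelBasis B) {f g : SynHom hT A D} {Γ : LCtx T.sig} {p : LTm T.sig}
    {q : V} (hp : Pat Γ p A) (h : T.Thm Γ (f.act p) (g.act p) q D) :
    T.Thm [(0, A)] f.rep g.rep q D :=
  hp.thm_of_subst hB f.hasTy g.hasTy h

/-- The morphism `f` takes the term `u` to the term `u'`, up to provable equality and in every
context in which `u` makes sense. -/
def Ev (f : SynHom hT A D) (u u' : LTm T.sig) : Prop :=
  ∀ ⦃Γ : LCtx T.sig⦄, HasTy Γ u A → T.Eqv Γ (f.act u) u' D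

/-- Morphisms are equal if they agree on a pattern. -/
theorem ext_pat (hB : IsLabelBasis B) {f g : SynHom hT A D} {Γ : LCtx T.sig} {p u : LTm T.sig}
    (hp : Pat Γ p A) (hΓ : Γ.Distinct) (hf : f.Ev p u) (hg : g.Ev p u) : f = g := by
  have h := (hf (hp.hasTy hΓ)).trans hB (hg (hp.hasTy hΓ)).symm
  exact ext_rep hB ⟨thm_of_act hB hp h.1, thm_of_act hB hp h.2⟩

theorem Ev.self (hB : IsLabelBasis B) {f : SynHom hT A D} {u : LTm T.sig} : f.Ev u (f.act u) :=
  fun _ h => .refl (f.act_hasTy hB h)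

theorem Ev.trans (hB : IsLabelBasis B) {f : SynHom hT A D} {u u' u'' : LTm T.sig} (h : f.Ev u u')
    (h' : ∀ ⦃Γ : LCtx T.sig⦄, HasTy Γ u' D → T.Eqv Γ u' u'' D) : f.Ev u u'' := fun _ hu =>
  (h hu).trans hB (h' ((h hu).right hB))

/-- The identity. -/
noncomputable def id (hT : Varietal.{w, u, u₂, v} T) (A : LTy T.sig.G) : SynHom hT A A :=
  mk hT (.var 0) (.hyp 0 A)

/-- Composition is substitution. -/
noncomputable def comp (hB : IsLabelBasis B) {A A' D : LTy T.sig.G} (f : SynHom hT A A')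
    (g : SynHom hT A' D) : SynHom hT A D :=
  mk hT (g.act f.rep) (g.act_hasTy hB f.hasTy)

theorem Ev.id (hB : IsLabelBasis B) {u : LTm T.sig} : (id hT A).Ev u u := fun _ h => mk_act hB _ h

theorem Ev.comp (hB : IsLabelBasis B) {A A' D : LTy T.sig.G} {f : SynHom hT A A'}
    {g : SynHom hT A' D} {u u' u'' : LTm T.sig} (hf : f.Ev u u') (hg : g.Ev u' u'') :
    (f.comp hB g).Ev u u'' := fun _ h => by
  have := mk_act (hT := hT) hB (g.act_hasTy hB f.hasTy) h
  rw [act_subst] at this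
  exact this.trans hB ((g.act_congr hB (hf h)).trans hB (hg ((hf h).right hB)))

theorem pm_hasTy {A A' D : LTy T.sig.G} {t : LTm T.sig} (h : HasTy [(0, A'), (1, A)] t D) :
    HasTy [(0, A.tensor A')] (.pm (.var 0) t) D := by
  obtain ⟨-, ⟨d⟩⟩ := h
  exact ⟨List.nodup_singleton _, ⟨.tensorE (Δ := []) (.hyp 0 _) d (.allLeft _)⟩⟩

/-- The morphism out of a tensor product defined by a term with two variables. -/
noncomputable def ofPair (hT : Varietal.{w, u, u₂, v} T) {A A' D : LTy T.sig.G} (t : LTm T.sig)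
    (h : HasTy [(0, A'), (1, A)] t D) : SynHom hT (A.tensor A') D :=
  mk hT (.pm (.var 0) t) (pm_hasTy h)

theorem Ev.ofPair (hB : IsLabelBasis B) {A A' D : LTy T.sig.G} {t v w : LTm T.sig}
    {h : HasTy [(0, A'), (1, A)] t D} : (ofPair hT t h).Ev (.pair v w) (t.inst₂ v w) := by
  intro Γ hu
  have e : t.subst (upSubst (upSubst fun _ => .pair v w)) = t := by
    refine LTm.subst_eq_self fun x hx => ?_
    have hx := h.mem_iff_free.2 hx
    simp only [List.map_cons, List.map_nil, List.mem_cons, List.not_mem_nil, or_false] at hx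
    rcases hx with rfl | rfl <;> rfl
  -- The body `t` lies below the binder, so the substitution for the scrutinee does not affect it.
  have k := mk_act (hT := hT) hB (pm_hasTy h) hu
  rw [LTm.subst, e] at k
  exact k.trans hB (.tensor_beta (k.right hB))

theorem pair_hasTy {S : LSig.{u, u₂}} {A A' : LTy S.G} {v w : LTm S} {x y : ℕ} (hxy : y ≠ x)
    {D D' : LTy S.G} (hv : HasTy [(x, A)] v D) (hw : HasTy [(y, A')] w D') :
    HasTy [(y, A'), (x, A)] (.pair v w) (.tensor D D') := by
  obtain ⟨-, ⟨d⟩⟩ := hv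
  obtain ⟨-, ⟨e⟩⟩ := hw
  exact ⟨by simpa [LCtx.Distinct] using hxy, ⟨.tensorI d e (.right _ (.allLeft _))⟩⟩

/-- The tensor product of morphisms. -/
noncomputable def tensor (hB : IsLabelBasis B) {A A' D D' : LTy T.sig.G} (f : SynHom hT A D)
    (g : SynHom hT A' D') : SynHom hT (A.tensor A') (D.tensor D') :=
  ofPair hT (.pair (f.act (.var 1)) (g.act (.var 0)))
    (pair_hasTy Nat.zero_ne_one (f.act_hasTy hB (.hyp 1 A)) (g.act_hasTy hB (.hyp 0 A')))

theorem Ev.tensor (hB : IsLabelBasis B) {A A' D D' : LTy T.sig.G} {f : SynHom hT A D}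
    {g : SynHom hT A' D'} {v v' w w' : LTm T.sig} (hf : f.Ev v v') (hg : g.Ev w w') :
    (f.tensor hB g).Ev (.pair v w) (.pair v' w') := by
  intro Γ hu
  obtain ⟨Γ₁, Γ₂, hv, hw, ⟨s⟩⟩ := hu.of_pair
  have k := Ev.ofPair (hT := hT) hB (h := pair_hasTy Nat.zero_ne_one
    (f.act_hasTy hB (.hyp 1 A)) (g.act_hasTy hB (.hyp 0 A'))) hu
  simp only [LTm.inst₂, LTm.subst, act_subst, instSubst₂] at k
  exact k.trans hB ((hf hv).pair hB (hg hw) s hu.1)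

/-- The associator. -/
noncomputable def assoc (hT : Varietal.{w, u, u₂, v} T) (X Y Z : LTy T.sig.G) :
    SynHom hT ((X.tensor Y).tensor Z) (X.tensor (Y.tensor Z)) :=
  ofPair hT (.pm (.var 1) (.pair (.var 1) (.pair (.var 0) (.var 2))))
    ⟨by simp [LCtx.Distinct], ⟨.tensorE (Δ := [(0, Z)]) (.hyp 1 _)
      (.tensorI (.hyp 1 X) (.tensorI (.hyp 0 Y) (.hyp 2 Z) (.left _ (.allRight _)))
        (.right _ (.left _ (.allRight _)))) (.right _ (.allLeft _))⟩⟩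

/-- The inverse of the associator. -/
noncomputable def assocInv (hT : Varietal.{w, u, u₂, v} T) (X Y Z : LTy T.sig.G) :
    SynHom hT (X.tensor (Y.tensor Z)) ((X.tensor Y).tensor Z) :=
  ofPair hT (.pm (.var 0) (.pair (.pair (.var 3) (.var 1)) (.var 0)))
    ⟨by simp [LCtx.Distinct], ⟨.tensorE (Δ := [(1, X)]) (.hyp 0 _)
      (.tensorI (.tensorI (.hyp 3 X) (.hyp 1 Y) (.right _ (.allLeft _))) (.hyp 0 Z)
        (.right _ (.allLeft _))) (.left _ (.allRight _))⟩⟩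

/-- The left unitor. -/
noncomputable def leftUnitor (hT : Varietal.{w, u, u₂, v} T) (X : LTy T.sig.G) :
    SynHom hT (LTy.unit.tensor X) X :=
  ofPair hT (.letStar (.var 1) (.var 0))
    ⟨by simp [LCtx.Distinct], ⟨.unitE (.hyp 1 _) (.hyp 0 X) (.right _ (.allLeft _))⟩⟩

/-- The inverse of the left unitor. -/
noncomputable def leftUnitorInv (hT : Varietal.{w, u, u₂, v} T) (X : LTy T.sig.G) :
    SynHom hT X (LTy.unit.tensor X) :=
  mk hT (.pair .star (.var 0)) ⟨List.nodup_singleton _, ⟨.tensorI .unitI (.hyp 0 X) (.allRight _)⟩⟩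

/-- The right unitor. -/
noncomputable def rightUnitor (hT : Varietal.{w, u, u₂, v} T) (X : LTy T.sig.G) :
    SynHom hT (X.tensor .unit) X :=
  ofPair hT (.letStar (.var 0) (.var 1))
    ⟨by simp [LCtx.Distinct], ⟨.unitE (.hyp 0 _) (.hyp 1 X) (.left _ (.allRight _))⟩⟩

/-- The inverse of the right unitor. -/
noncomputable def rightUnitorInv (hT : Varietal.{w, u, u₂, v} T) (X : LTy T.sig.G) :
    SynHom hT X (X.tensor .unit) :=
  mk hT (.pair (.var 0) .star) ⟨List.nodup_singleton _, ⟨.tensorI (.hyp 0 X) .unitI (.allLeft _)⟩⟩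

/-- The symmetry. -/
noncomputable def braiding (hT : Varietal.{w, u, u₂, v} T) (X Y : LTy T.sig.G) :
    SynHom hT (X.tensor Y) (Y.tensor X) :=
  ofPair hT (.pair (.var 0) (.var 1))
    ⟨by simp [LCtx.Distinct], ⟨.tensorI (.hyp 0 Y) (.hyp 1 X) (.left _ (.allRight _))⟩⟩

theorem curry_hasTy (hB : IsLabelBasis B) {X Y Z : LTy T.sig.G} (f : SynHom hT (X.tensor Y) Z) :
    HasTy [(0, Y)] (.lam X (f.act (.pair (.var 0) (.var 1)))) (X.lolli Z) := by
  obtain ⟨-, ⟨d⟩⟩ := f.act_hasTy hB (Γ := [(0, X), (1, Y)]) (u := .pair (.var 0) (.var 1))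
    ⟨by simp [LCtx.Distinct], ⟨.tensorI (.hyp 0 X) (.hyp 1 Y) (.left _ (.allRight _))⟩⟩
  exact ⟨List.nodup_singleton _, ⟨.lolliI d⟩⟩

/-- Transposition of a morphism `X ⊗ Y ⟶ Z`. -/
noncomputable def curry (hB : IsLabelBasis B) {X Y Z : LTy T.sig.G}
    (f : SynHom hT (X.tensor Y) Z) : SynHom hT Y (X.lolli Z) :=
  mk hT (.lam X (f.act (.pair (.var 0) (.var 1)))) (f.curry_hasTy hB)

theorem uncurry_hasTy (hB : IsLabelBasis B) {X Y Z : LTy T.sig.G} (g : SynHom hT Y (X.lolli Z)) :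
    HasTy [(0, Y), (1, X)] (.app (g.act (.var 0)) (.var 1)) Z := by
  obtain ⟨-, ⟨d⟩⟩ := g.act_hasTy hB (.hyp 0 Y)
  exact ⟨by simp [LCtx.Distinct], ⟨.lolliE d (.hyp 1 X) (.left _ (.allRight _))⟩⟩

/-- Transposition of a morphism `Y ⟶ (X ⊸ Z)`. -/
noncomputable def uncurry (hB : IsLabelBasis B) {X Y Z : LTy T.sig.G}
    (g : SynHom hT Y (X.lolli Z)) : SynHom hT (X.tensor Y) Z :=
  ofPair hT (.app (g.act (.var 0)) (.var 1)) (g.uncurry_hasTy hB)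

/-! ### Evaluation of the structure morphisms -/

section Ev

variable {X Y Z : LTy T.sig.G} {a b c : LTm T.sig}

theorem Ev.assoc (hB : IsLabelBasis B) :
    (assoc hT X Y Z).Ev (.pair (.pair a b) c) (.pair a (.pair b c)) := by
  refine (Ev.ofPair hB).trans hB fun Γ h => ?_
  have k := Eqv.tensor_beta h
  simp only [LTm.inst₂, LTm.subst, instSubst₂, upSubst, LTm.rename, LTm.subst_rename] at h k
  rw [show (c.subst fun n => LTm.var n) = c from c.subst_var] at k
  exact k

theorem Ev.assocInv (hB : IsLabelBasis B) :
    (assocInv hT X Y Z).Ev (.pair a (.pair b c)) (.pair (.pair a b) c) := by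
  refine (Ev.ofPair hB).trans hB fun Γ h => ?_
  have k := Eqv.tensor_beta h
  simp only [LTm.inst₂, LTm.subst, instSubst₂, upSubst, LTm.rename, LTm.subst_rename] at h k
  rw [show (a.subst fun n => LTm.var n) = a from a.subst_var] at k
  exact k

theorem Ev.leftUnitor (hB : IsLabelBasis B) : (leftUnitor hT X).Ev (.pair .star a) a :=
  (Ev.ofPair hB).trans hB fun _ h => .unit_beta h

theorem Ev.rightUnitor (hB : IsLabelBasis B) : (rightUnitor hT X).Ev (.pair a .star) a :=
  (Ev.ofPair hB).trans hB fun _ h => .unit_beta h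

theorem Ev.leftUnitorInv (hB : IsLabelBasis B) : (leftUnitorInv hT X).Ev a (.pair .star a) :=
  fun _ h => mk_act hB _ h

theorem Ev.rightUnitorInv (hB : IsLabelBasis B) : (rightUnitorInv hT X).Ev a (.pair a .star) :=
  fun _ h => mk_act hB _ h

theorem Ev.braiding (hB : IsLabelBasis B) : (braiding hT X Y).Ev (.pair a b) (.pair b a) :=
  Ev.ofPair hB

theorem Ev.curry (hB : IsLabelBasis B) {f : SynHom hT (X.tensor Y) Z}
    (hf : f.Ev (.pair (.var 0) (a.rename (· + 1))) b) : (f.curry hB).Ev a (.lam X b) := by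
  intro Γ h
  have k := mk_act (hT := hT) hB (f.curry_hasTy hB) h
  rw [LTm.subst, act_subst] at k
  obtain ⟨hΓ, ⟨d⟩⟩ := (((Thm.refl (T := T) h).rename hB (· + 1) (h.1.shift 1)).hasTy hB).1
  exact k.trans hB (.lam (hf ⟨h.1.bind X, ⟨.tensorI (.hyp 0 X) d (.left _ (.allRight _))⟩⟩))

theorem Ev.uncurry (hB : IsLabelBasis B) {g : SynHom hT Y (X.lolli Z)} {b' : LTm T.sig}
    (h : g.Ev b b') : (g.uncurry hB).Ev (.pair a b) (.app b' a) := by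
  intro Γ hu
  have k := Ev.ofPair (hT := hT) hB (h := g.uncurry_hasTy hB) hu
  rw [LTm.inst₂, LTm.subst, act_subst] at k
  obtain ⟨Γ₁, Γ₂, ha, hb, ⟨s⟩⟩ := hu.of_pair
  exact k.trans hB ((h hb).app hB (.refl ha) s.swap hu.1)

end Ev

/-! ### Laws of the syntactic category -/

section Laws

variable {A' A'' D' X Y Z W X' Y' Z' : LTy T.sig.G}

-- Each law is checked by evaluating both sides on a pattern of the source.
theorem id_comp (hB : IsLabelBasis B) (f : SynHom hT A D) : (id hT A).comp hB f = f :=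
  ext_pat hB (.var 0 A) (List.nodup_singleton _) ((Ev.id hB).comp hB (.self hB)) (.self hB)

theorem comp_id (hB : IsLabelBasis B) (f : SynHom hT A D) : f.comp hB (id hT D) = f :=
  ext_pat hB (.var 0 A) (List.nodup_singleton _) ((Ev.self hB).comp hB (.id hB)) (.self hB)

theorem comp_assoc (hB : IsLabelBasis B) (f : SynHom hT A A') (g : SynHom hT A' A'')
    (h : SynHom hT A'' D) : (f.comp hB g).comp hB h = f.comp hB (g.comp hB h) :=
  ext_pat hB (.var 0 A) (List.nodup_singleton _)
    (((Ev.self hB).comp hB (.self hB)).comp hB (.self hB))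
    ((Ev.self hB).comp hB ((Ev.self hB).comp hB (.self hB)))

theorem pat₂ (X Y : LTy T.sig.G) : Pat (S := T.sig) [(1, Y), (0, X)] (.pair (.var 0) (.var 1))
    (X.tensor Y) :=
  .pair (.var 0 X) (.var 1 Y) (.append _ _)

theorem pat₃ (X Y Z : LTy T.sig.G) : Pat (S := T.sig) [(2, Z), (1, Y), (0, X)]
    (.pair (.pair (.var 0) (.var 1)) (.var 2)) ((X.tensor Y).tensor Z) :=
  .pair (pat₂ X Y) (.var 2 Z) (.append _ _)

theorem pat₃' (X Y Z : LTy T.sig.G) : Pat (S := T.sig) [(2, Z), (1, Y), (0, X)]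
    (.pair (.var 0) (.pair (.var 1) (.var 2))) (X.tensor (Y.tensor Z)) :=
  .pair (.var 0 X) (.pair (.var 1 Y) (.var 2 Z) (.append _ _)) (.append _ _)

theorem pat₄ (W X Y Z : LTy T.sig.G) : Pat (S := T.sig) [(3, Z), (2, Y), (1, X), (0, W)]
    (.pair (.pair (.pair (.var 0) (.var 1)) (.var 2)) (.var 3))
    (((W.tensor X).tensor Y).tensor Z) :=
  .pair (pat₃ W X Y) (.var 3 Z) (.append _ _)

theorem distinct₂ (X Y : LTy T.sig.G) : LCtx.Distinct (S := T.sig) [(1, Y), (0, X)] := by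
  simp [LCtx.Distinct]

theorem distinct₃ (X Y Z : LTy T.sig.G) :
    LCtx.Distinct (S := T.sig) [(2, Z), (1, Y), (0, X)] := by
  simp [LCtx.Distinct]

theorem distinct₄ (W X Y Z : LTy T.sig.G) :
    LCtx.Distinct (S := T.sig) [(3, Z), (2, Y), (1, X), (0, W)] := by
  simp [LCtx.Distinct]

theorem id_tensor_id (hB : IsLabelBasis B) (X Y : LTy T.sig.G) :
    (id hT X).tensor hB (id hT Y) = id hT (X.tensor Y) :=
  ext_pat hB (pat₂ X Y) (distinct₂ X Y) ((Ev.id hB).tensor hB (.id hB)) (.id hB)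

theorem tensor_comp_tensor (hB : IsLabelBasis B) (f : SynHom hT A A') (f' : SynHom hT X X')
    (g : SynHom hT A' A'') (g' : SynHom hT X' Y) :
    (f.tensor hB f').comp hB (g.tensor hB g') = (f.comp hB g).tensor hB (f'.comp hB g') :=
  ext_pat hB (pat₂ A X) (distinct₂ A X)
    (((Ev.self hB).tensor hB (.self hB)).comp hB ((Ev.self hB).tensor hB (.self hB)))
    (((Ev.self hB).comp hB (.self hB)).tensor hB ((Ev.self hB).comp hB (.self hB)))

theorem assoc_comp_inv (hB : IsLabelBasis B) (X Y Z : LTy T.sig.G) :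
    (assoc hT X Y Z).comp hB (assocInv hT X Y Z) = id hT _ :=
  ext_pat hB (pat₃ X Y Z) (distinct₃ X Y Z) ((Ev.assoc hB).comp hB (.assocInv hB)) (.id hB)

theorem assocInv_comp (hB : IsLabelBasis B) (X Y Z : LTy T.sig.G) :
    (assocInv hT X Y Z).comp hB (assoc hT X Y Z) = id hT _ :=
  ext_pat hB (pat₃' X Y Z) (distinct₃ X Y Z) ((Ev.assocInv hB).comp hB (.assoc hB)) (.id hB)

theorem pat_star_left (X : LTy T.sig.G) :
    Pat (S := T.sig) [(0, X)] (.pair .star (.var 0)) (LTy.unit.tensor X) :=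
  .pair .star (.var 0 X) (.append _ _)

theorem pat_star_right (X : LTy T.sig.G) :
    Pat (S := T.sig) [(0, X)] (.pair (.var 0) .star) (X.tensor .unit) :=
  .pair (.var 0 X) .star (.append _ _)

theorem leftUnitor_comp_inv (hB : IsLabelBasis B) (X : LTy T.sig.G) :
    (leftUnitor hT X).comp hB (leftUnitorInv hT X) = id hT _ :=
  ext_pat hB (pat_star_left X) (List.nodup_singleton _)
    ((Ev.leftUnitor hB).comp hB (.leftUnitorInv hB)) (.id hB)

theorem leftUnitorInv_comp (hB : IsLabelBasis B) (X : LTy T.sig.G) :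
    (leftUnitorInv hT X).comp hB (leftUnitor hT X) = id hT _ :=
  ext_pat hB (.var 0 X) (List.nodup_singleton _)
    ((Ev.leftUnitorInv hB).comp hB (.leftUnitor hB)) (.id hB)

theorem rightUnitor_comp_inv (hB : IsLabelBasis B) (X : LTy T.sig.G) :
    (rightUnitor hT X).comp hB (rightUnitorInv hT X) = id hT _ :=
  ext_pat hB (pat_star_right X) (List.nodup_singleton _)
    ((Ev.rightUnitor hB).comp hB (.rightUnitorInv hB)) (.id hB)

theorem rightUnitorInv_comp (hB : IsLabelBasis B) (X : LTy T.sig.G) :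
    (rightUnitorInv hT X).comp hB (rightUnitor hT X) = id hT _ :=
  ext_pat hB (.var 0 X) (List.nodup_singleton _)
    ((Ev.rightUnitorInv hB).comp hB (.rightUnitor hB)) (.id hB)

theorem assoc_natural (hB : IsLabelBasis B) (f : SynHom hT X X') (g : SynHom hT Y Y')
    (h : SynHom hT Z Z') : ((f.tensor hB g).tensor hB h).comp hB (assoc hT X' Y' Z') =
      (assoc hT X Y Z).comp hB (f.tensor hB (g.tensor hB h)) :=
  ext_pat hB (pat₃ X Y Z) (distinct₃ X Y Z)
    ((((Ev.self hB).tensor hB (.self hB)).tensor hB (.self hB)).comp hB (.assoc hB))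
    ((Ev.assoc hB).comp hB ((Ev.self hB).tensor hB ((Ev.self hB).tensor hB (.self hB))))

theorem leftUnitor_natural (hB : IsLabelBasis B) (f : SynHom hT X Y) :
    ((id hT .unit).tensor hB f).comp hB (leftUnitor hT Y) = (leftUnitor hT X).comp hB f :=
  ext_pat hB (pat_star_left X) (List.nodup_singleton _)
    (((Ev.id hB).tensor hB (.self hB)).comp hB (.leftUnitor hB))
    ((Ev.leftUnitor hB).comp hB (.self hB))

theorem rightUnitor_natural (hB : IsLabelBasis B) (f : SynHom hT X Y) :
    (f.tensor hB (id hT .unit)).comp hB (rightUnitor hT Y) = (rightUnitor hT X).comp hB f :=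
  ext_pat hB (pat_star_right X) (List.nodup_singleton _)
    (((Ev.self hB).tensor hB (.id hB)).comp hB (.rightUnitor hB))
    ((Ev.rightUnitor hB).comp hB (.self hB))

theorem pentagon (hB : IsLabelBasis B) (W X Y Z : LTy T.sig.G) :
    ((assoc hT W X Y).tensor hB (id hT Z)).comp hB ((assoc hT W (X.tensor Y) Z).comp hB
        ((id hT W).tensor hB (assoc hT X Y Z))) =
      (assoc hT (W.tensor X) Y Z).comp hB (assoc hT W X (Y.tensor Z)) :=
  ext_pat hB (pat₄ W X Y Z) (distinct₄ W X Y Z)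
    (((Ev.assoc hB).tensor hB (.id hB)).comp hB ((Ev.assoc hB).comp hB
      ((Ev.id hB).tensor hB (.assoc hB))))
    ((Ev.assoc hB).comp hB (.assoc hB))

theorem triangle (hB : IsLabelBasis B) (X Y : LTy T.sig.G) :
    (assoc hT X .unit Y).comp hB ((id hT X).tensor hB (leftUnitor hT Y)) =
      (rightUnitor hT X).tensor hB (id hT Y) :=
  ext_pat hB (Pat.pair (pat_star_right X) (.var 1 Y) (.append _ _)) (distinct₂ X Y)
    ((Ev.assoc hB).comp hB ((Ev.id hB).tensor hB (.leftUnitor hB)))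
    ((Ev.rightUnitor hB).tensor hB (.id hB))

theorem braiding_comp_braiding (hB : IsLabelBasis B) (X Y : LTy T.sig.G) :
    (braiding hT X Y).comp hB (braiding hT Y X) = id hT _ :=
  ext_pat hB (pat₂ X Y) (distinct₂ X Y) ((Ev.braiding hB).comp hB (.braiding hB)) (.id hB)

theorem braiding_natural (hB : IsLabelBasis B) (f : SynHom hT X X') (g : SynHom hT Y Y') :
    (f.tensor hB g).comp hB (braiding hT X' Y') = (braiding hT X Y).comp hB (g.tensor hB f) :=
  ext_pat hB (pat₂ X Y) (distinct₂ X Y)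
    (((Ev.self hB).tensor hB (.self hB)).comp hB (.braiding hB))
    ((Ev.braiding hB).comp hB ((Ev.self hB).tensor hB (.self hB)))

theorem hexagon_forward (hB : IsLabelBasis B) (X Y Z : LTy T.sig.G) :
    (assoc hT X Y Z).comp hB ((braiding hT X (Y.tensor Z)).comp hB (assoc hT Y Z X)) =
      ((braiding hT X Y).tensor hB (id hT Z)).comp hB ((assoc hT Y X Z).comp hB
        ((id hT Y).tensor hB (braiding hT X Z))) :=
  ext_pat hB (pat₃ X Y Z) (distinct₃ X Y Z)
    ((Ev.assoc hB).comp hB ((Ev.braiding hB).comp hB (.assoc hB)))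
    (((Ev.braiding hB).tensor hB (.id hB)).comp hB ((Ev.assoc hB).comp hB
      ((Ev.id hB).tensor hB (.braiding hB))))

theorem hexagon_reverse (hB : IsLabelBasis B) (X Y Z : LTy T.sig.G) :
    (assocInv hT X Y Z).comp hB ((braiding hT (X.tensor Y) Z).comp hB (assocInv hT Z X Y)) =
      ((id hT X).tensor hB (braiding hT Y Z)).comp hB ((assocInv hT X Z Y).comp hB
        ((braiding hT X Z).tensor hB (id hT Y))) :=
  ext_pat hB (pat₃' X Y Z) (distinct₃ X Y Z)
    ((Ev.assocInv hB).comp hB ((Ev.braiding hB).comp hB (.assocInv hB)))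
    (((Ev.id hB).tensor hB (.braiding hB)).comp hB ((Ev.assocInv hB).comp hB
      ((Ev.braiding hB).tensor hB (.id hB))))

theorem uncurry_curry (hB : IsLabelBasis B) (f : SynHom hT (X.tensor Y) Z) :
    (f.curry hB).uncurry hB = f := by
  refine ext_pat hB (pat₂ X Y) (distinct₂ X Y)
    ((Ev.uncurry hB (.curry hB (.self hB))).trans hB fun Γ h => ?_) (.self hB)
  have k := Eqv.lolli_beta h
  rwa [LTm.inst, act_subst] at k

theorem curry_uncurry (hB : IsLabelBasis B) (g : SynHom hT Y (X.lolli Z)) :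
    (g.uncurry hB).curry hB = g := by
  refine ext_pat hB (.var 0 Y) (List.nodup_singleton _) (fun Γ h => ?_) (.self hB)
  have k := Ev.curry hB (.uncurry hB (.self hB)) h (f := g.uncurry hB)
  rw [← act_rename] at k
  exact k.trans hB (.of_aut (.lolli_eta (g.act_hasTy hB h)))

theorem curry_comp (hB : IsLabelBasis B) (f : SynHom hT Y Y') (g : SynHom hT (X.tensor Y') Z) :
    (((id hT X).tensor hB f).comp hB g).curry hB = f.comp hB (g.curry hB) := by
  refine ext_pat hB (.var 0 Y) (List.nodup_singleton _)
    (Ev.curry hB (((Ev.id hB).tensor hB (.self hB)).comp hB (.self hB)))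
    ((Ev.self hB).comp hB (.curry hB ?_))
  rw [act_rename]
  exact .self hB

end Laws

end SynHom

end VTheory

/-! ### The syntactic category -/

/-- The syntactic category of a varietal theory: its objects are the types, its morphisms are the
terms with one free variable up to provable equality. -/
structure SynCat {V : Type w} [CommMonoid V] [CompleteLattice V] [IsQuantale V] {B : Set V}
    (hB : IsLabelBasis B) (T : VTheory.{w, u, u₂} V B)
    (hT : VTheory.Varietal.{w, u, u₂, v} T) : Type (max u u') where
  ty : LTy T.sig.G

namespace VTheory.SynHom

variable {V : Type w} [CommMonoid V] [CompleteLattice V] [IsQuantale V] {B : Set V}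
  {T : VTheory.{w, u, u₂} V B} {hT : Varietal.{w, u, u₂, v} T} {A D X Y Z X' Y' : LTy T.sig.G}
  {q : V}

theorem act_thm (hB : IsLabelBasis B) {f g : SynHom hT A D} {Γ : LCtx T.sig} {u : LTm T.sig}
    (h : T.Thm [(0, A)] f.rep g.rep q D) (hu : HasTy Γ u A) : T.Thm Γ (f.act u) (g.act u) q D := by
  have := h.subst_const hB (.refl hu)
  rwa [← hB.integral, mul_one] at this

/-- Distances may be computed on patterns. -/
theorem le_dist_of_ev (hB : IsLabelBasis B) {f g : SynHom hT A D} {Γ : LCtx T.sig}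
    {p u u' : LTm T.sig} (hp : Pat Γ p A) (hΓ : Γ.Distinct) (hf : f.Ev p u) (hg : g.Ev p u')
    (h : T.Thm Γ u u' q D) : q ≤ dist f g :=
  le_dist (thm_of_act hB hp (((hf (hp.hasTy hΓ)).symm.thm hB (hg (hp.hasTy hΓ)).symm h)))

theorem one_le_dist_self (hB : IsLabelBasis B) (f : SynHom hT A D) : 1 ≤ dist f f :=
  hB.integral.le.trans (le_dist (.refl f.hasTy))

theorem dist_triangle (f g h : SynHom hT A D) : dist f g * dist g h ≤ dist f h :=
  dist_mul_dist_le fun _ _ h h' => le_dist (h.trans h')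

theorem eq_of_one_le_dist (hB : IsLabelBasis B) {f g : SynHom hT A D} (h : 1 ≤ dist f g)
    (h' : 1 ≤ dist g f) : f = g :=
  ext_rep hB (eqv_of_one_le hB ⟨h, h'⟩)

theorem dist_comp (hB : IsLabelBasis B) (f f' : SynHom hT X Y) (g g' : SynHom hT Y Z) :
    dist f f' * dist g g' ≤ dist (f.comp hB g) (f'.comp hB g') :=
  dist_mul_dist_le fun q r h h' => le_dist_of_ev hB (.var 0 X) (List.nodup_singleton _)
    ((Ev.self hB).comp hB (.self hB)) ((Ev.self hB).comp hB (.self hB))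
    (mul_comm q r ▸ h'.subst_const hB (act_thm hB h (.hyp 0 X)))

theorem dist_tensor (hB : IsLabelBasis B) (f f' : SynHom hT X X') (g g' : SynHom hT Y Y') :
    dist f f' * dist g g' ≤ dist (f.tensor hB g) (f'.tensor hB g') :=
  dist_mul_dist_le fun _ _ h h' => le_dist_of_ev hB (pat₂ X Y) (distinct₂ X Y)
    ((Ev.self hB).tensor hB (.self hB)) ((Ev.self hB).tensor hB (.self hB))
    (.pair_congr (act_thm hB h (.hyp 0 X)) (act_thm hB h' (.hyp 1 Y)) (.append _ _)
      (distinct₂ X Y))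

theorem dist_curry (hB : IsLabelBasis B) (f g : SynHom hT (X.tensor Y) Z) :
    dist f g ≤ dist (f.curry hB) (g.curry hB) :=
  sSup_le fun _ h => le_dist_of_ev hB (.var 1 Y) (List.nodup_singleton _) (.curry hB (.self hB))
    (.curry hB (.self hB)) (.lam_congr (act_thm hB h
      ⟨by simp [LCtx.Distinct, LCtx.bind, LCtx.shift],
        ⟨.tensorI (.hyp 0 X) (.hyp 2 Y) (.left _ (.allRight _))⟩⟩))

theorem dist_uncurry (hB : IsLabelBasis B) (f g : SynHom hT Y (X.lolli Z)) :
    dist f g ≤ dist (f.uncurry hB) (g.uncurry hB) :=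
  sSup_le fun q h => le_dist_of_ev hB (pat₂ X Y) (distinct₂ X Y) (.uncurry hB (.self hB))
    (.uncurry hB (.self hB)) (by
      have := Thm.app_congr (act_thm hB h (.hyp 1 Y)) (.refl (.hyp 0 X)) (.left _ (.allRight _))
        (distinct₂ X Y)
      rwa [← hB.integral, mul_one] at this)

end VTheory.SynHom

namespace SynCat

open VTheory

variable {V : Type w} [CommMonoid V] [CompleteLattice V] [IsQuantale V] {B : Set V}
  {hB : IsLabelBasis B} {T : VTheory.{w, u, u₂} V B} {hT : VTheory.Varietal.{w, u, u₂, v} T}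

noncomputable instance : Category.{v} (SynCat.{w, u, u₂, u', v} hB T hT) where
  Hom X Y := SynHom hT X.ty Y.ty
  id X := SynHom.id hT X.ty
  comp f g := f.comp hB g
  id_comp := SynHom.id_comp hB
  comp_id := SynHom.comp_id hB
  assoc := SynHom.comp_assoc hB

noncomputable instance : MonoidalCategoryStruct (SynCat.{w, u, u₂, u', v} hB T hT) where
  tensorObj X Y := ⟨X.ty.tensor Y.ty⟩
  tensorUnit := ⟨.unit⟩
  tensorHom f g := SynHom.tensor hB f g
  whiskerLeft X _ _ f := SynHom.tensor hB (SynHom.id hT X.ty) f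
  whiskerRight f X := SynHom.tensor hB f (SynHom.id hT X.ty)
  associator X Y Z := ⟨SynHom.assoc hT X.ty Y.ty Z.ty, SynHom.assocInv hT X.ty Y.ty Z.ty,
    SynHom.assoc_comp_inv hB _ _ _, SynHom.assocInv_comp hB _ _ _⟩
  leftUnitor X := ⟨SynHom.leftUnitor hT X.ty, SynHom.leftUnitorInv hT X.ty,
    SynHom.leftUnitor_comp_inv hB _, SynHom.leftUnitorInv_comp hB _⟩
  rightUnitor X := ⟨SynHom.rightUnitor hT X.ty, SynHom.rightUnitorInv hT X.ty,
    SynHom.rightUnitor_comp_inv hB _, SynHom.rightUnitorInv_comp hB _⟩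

noncomputable instance : MonoidalCategory (SynCat.{w, u, u₂, u', v} hB T hT) :=
  .ofTensorHom
    (id_tensorHom_id := fun _ _ => SynHom.id_tensor_id hB _ _)
    (id_tensorHom := fun _ _ _ _ => rfl)
    (tensorHom_id := fun _ _ => rfl)
    (tensorHom_comp_tensorHom := fun _ _ _ _ => SynHom.tensor_comp_tensor hB _ _ _ _)
    (associator_naturality := fun _ _ _ => SynHom.assoc_natural hB _ _ _)
    (leftUnitor_naturality := fun _ => SynHom.leftUnitor_natural hB _)
    (rightUnitor_naturality := fun _ => SynHom.rightUnitor_natural hB _)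
    (pentagon := fun _ _ _ _ => SynHom.pentagon hB _ _ _ _)
    (triangle := fun _ _ => SynHom.triangle hB _ _)

noncomputable instance : SymmetricCategory (SynCat.{w, u, u₂, u', v} hB T hT) where
  braiding X Y := ⟨SynHom.braiding hT X.ty Y.ty, SynHom.braiding hT Y.ty X.ty,
    SynHom.braiding_comp_braiding hB _ _, SynHom.braiding_comp_braiding hB _ _⟩
  braiding_naturality_right _ _ _ _ := SynHom.braiding_natural hB _ _
  braiding_naturality_left _ _ := SynHom.braiding_natural hB _ _
  hexagon_forward _ _ _ := SynHom.hexagon_forward hB _ _ _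
  hexagon_reverse _ _ _ := SynHom.hexagon_reverse hB _ _ _
  symmetry _ _ := SynHom.braiding_comp_braiding hB _ _

/-- The hom-bijection of the closed structure. -/
noncomputable def curryEquiv (X Y Z : SynCat.{w, u, u₂, u', v} hB T hT) :
    ((tensorLeft X).obj Y ⟶ Z) ≃ (Y ⟶ ⟨X.ty.lolli Z.ty⟩) where
  toFun f := SynHom.curry hB f
  invFun g := SynHom.uncurry hB g
  left_inv f := SynHom.uncurry_curry hB f
  right_inv g := SynHom.curry_uncurry hB g

noncomputable instance : MonoidalClosed (SynCat.{w, u, u₂, u', v} hB T hT) where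
  closed X :=
    { rightAdj := Adjunction.rightAdjointOfEquiv (curryEquiv X) fun _ _ _ f g =>
        SynHom.curry_comp hB f g
      adj := Adjunction.adjunctionOfEquivRight _ _ }

theorem curry_eq {X Y Z : SynCat.{w, u, u₂, u', v} hB T hT} (f : X ⊗ Y ⟶ Z) :
    MonoidalClosed.curry f = SynHom.curry hB f := by
  have h : (Adjunction.adjunctionOfEquivRight (curryEquiv X) fun _ _ _ f g =>
      SynHom.curry_comp hB f g).homEquiv = curryEquiv X := Adjunction.mkOfHomEquiv_homEquiv _
  exact DFunLike.congr_fun (congrFun (congrFun h Y) Z) f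

theorem ihom_map_eq {X Y Z : SynCat.{w, u, u₂, u', v} hB T hT} (f : Y ⟶ Z) :
    (ihom X).map f = SynHom.curry hB
      (SynHom.comp hB (SynHom.uncurry hB (SynHom.id hT (X.ty.lolli Y.ty))) f) :=
  rfl

theorem uncurry_eq {X Y Z : SynCat.{w, u, u₂, u', v} hB T hT} (f : Y ⟶ (ihom X).obj Z) :
    MonoidalClosed.uncurry f = SynHom.uncurry hB f := by
  have h : f = SynHom.curry hB (SynHom.uncurry hB f) := (SynHom.curry_uncurry hB f).symm
  rw [← curry_eq] at h
  exact (congrArg _ h).trans (MonoidalClosed.uncurry_curry _)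

noncomputable instance : VCatSepAutonomous V (SynCat.{w, u, u₂, u', v} hB T hT) where
  dist f g := SynHom.dist f g
  isVCat _ _ := ⟨SynHom.one_le_dist_self hB, SynHom.dist_triangle⟩
  separated _ _ _ _ := SynHom.eq_of_one_le_dist hB
  comp_vfunctor _ _ _ _ _ := SynHom.dist_comp hB _ _ _ _
  tensor_vfunctor _ _ _ _ _ _ := SynHom.dist_tensor hB _ _ _ _
  ihom_vfunctor X Y Z f g := by
    beta_reduce
    rw [ihom_map_eq, ihom_map_eq]
    refine le_trans ?_ (SynHom.dist_curry hB _ _)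
    refine le_trans ?_ (SynHom.dist_comp hB _ _ _ _)
    exact (one_mul _).symm.le.trans (mul_le_mul_left (SynHom.one_le_dist_self hB _) _)
  curry_vfunctor _ _ _ f g := by
    beta_reduce
    rw [curry_eq, curry_eq]
    exact SynHom.dist_curry hB _ _
  uncurry_vfunctor _ _ _ f g := by
    beta_reduce
    rw [uncurry_eq, uncurry_eq]
    exact SynHom.dist_uncurry hB _ _

end SynCat

/-! ### Tuples -/

section Tuples

variable {S : LSig.{u, u₂}}

/-- The arguments given by a sequence of variables. -/
def LArgs.ofVars : List ℕ → LArgs S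
  | [] => .nil
  | x :: l => .snoc (ofVars l) (.var x)

/-- The arguments `as` followed by the values of `σ` at a sequence of variables. -/
def LArgs.extend (as : LArgs S) (σ : ℕ → LTm S) : List ℕ → LArgs S
  | [] => as
  | x :: l => .snoc (as.extend σ l) (σ x)

/-- The tuple of an argument list, bracketed to the left; `*` for the empty list. -/
def LArgs.tuple : LArgs S → LTm S
  | .nil => .star
  | .snoc .nil v => v
  | .snoc (.snoc as v) w => .pair (LArgs.tuple (.snoc as v)) w

/-- The tuple of the variables of a context. -/
def LCtx.tuple (Γ : LCtx S) : LTm S := (LArgs.ofVars (Γ.map Prod.fst)).tuple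

theorem LArgs.tuple_rename (ρ : ℕ → ℕ) : ∀ as : LArgs S, (as.rename ρ).tuple = as.tuple.rename ρ
  | .nil => rfl
  | .snoc .nil _ => rfl
  | .snoc (.snoc as v) w => by
      have h := tuple_rename ρ (.snoc as v)
      simp only [LArgs.rename, LArgs.tuple, LTm.rename] at h ⊢
      rw [h]

theorem LArgs.ofVars_rename (ρ : ℕ → ℕ) : ∀ l : List ℕ,
    (ofVars l : LArgs S).rename ρ = ofVars (l.map ρ)
  | [] => rfl
  | x :: l => by simp only [ofVars, LArgs.rename, List.map_cons, LTm.rename, ofVars_rename ρ l]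

theorem LCtx.tuple_shift (n : ℕ) (Γ : LCtx S) : (Γ.shift n).tuple = Γ.tuple.rename (· + n) := by
  rw [LCtx.tuple, LCtx.tuple, ← LArgs.tuple_rename, LArgs.ofVars_rename]
  simp [LCtx.shift, Function.comp_def]

theorem LArgs.ofVars_subst (σ : ℕ → LTm S) (x : ℕ) : ∀ l : List ℕ,
    (ofVars (l ++ [x]) : LArgs S).subst σ = (LArgs.snoc .nil (σ x)).extend σ l
  | [] => rfl
  | y :: l => by
      simp only [List.cons_append, ofVars, LArgs.subst, LTm.subst, extend, ofVars_subst σ x l]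

theorem LArgs.extend_map (as : LArgs S) (σ τ : ℕ → LTm S) (h : ∀ x, τ (x + 2) = σ x) :
    ∀ l : List ℕ, as.extend τ (l.map (· + 2) ++ [0]) = (LArgs.snoc as (τ 0)).extend σ l
  | [] => rfl
  | x :: l => by simp only [List.map_cons, List.cons_append, extend, h, extend_map as σ τ h l]

theorem LDerArgs.nonempty_ofVars : ∀ Γ : LCtx S,
    Nonempty (LDerArgs S Γ (LArgs.ofVars (Γ.map Prod.fst)) (Γ.map Prod.snd))
  | [] => ⟨.nil⟩
  | (x, A) :: Γ => by
      obtain ⟨d⟩ := nonempty_ofVars Γ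
      exact ⟨.snoc d (.hyp x A) (.right _ (.allLeft _))⟩

/-- `A₁ ⊗ ⋯ ⊗ Aₙ`, bracketed to the left; the unit for `n = 0`. -/
def LTy.tens {G : Type u} : List (LTy G) → LTy G
  | [] => .unit
  | [A] => A
  | A :: A' :: l => .tensor (LTy.tens (A' :: l)) A

/-- The operation symbol `f`, applied to the components of the variable `m` and to the variables in
the sequence `l`. Operation symbols have at least one argument, so the case of no components does
not matter. -/
def LTm.unpack (f : S.Op) : List (LTy S.G) → ℕ → List ℕ → LTm S
  | [], _, l => .op f (.ofVars l)
  | [_], m, l => .op f (.ofVars (l ++ [m]))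
  | _ :: A :: As, m, l => .pm (.var m) (LTm.unpack f (A :: As) 1 (l.map (· + 2) ++ [0]))

end Tuples

section

variable {V : Type w} [CommMonoid V] [CompleteLattice V] [IsQuantale V] {B : Set V}

/-- If the types in `Γ` and `As` together make up the domain of `f`, unpacking a variable of type
`LTy.tens As` gives a well typed term. -/
theorem LTm.unpack_hasTy (hB : IsLabelBasis B) (T : VTheory.{w, u, u₂} V B) (f : T.sig.Op) :
    ∀ (As : List (LTy T.sig.G)) (m : ℕ) (Γ : LCtx T.sig), As ≠ [] →
      LCtx.Distinct (Γ ++ [(m, LTy.tens As)]) → Γ.map Prod.snd ++ As = T.sig.dom f →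
      HasTy (Γ ++ [(m, LTy.tens As)]) (LTm.unpack f As m (Γ.map Prod.fst)) (T.sig.cod f)
  | [], _, _, h, _, _ => absurd rfl h
  | [A], m, Γ, _, hd, hf => by
      obtain ⟨d⟩ := LDerArgs.nonempty_ofVars (Γ ++ [(m, A)])
      rw [List.map_append, List.map_append, List.map_singleton, List.map_singleton, hf] at d
      exact ⟨hd, ⟨.ax f d⟩⟩
  | A :: A' :: As, m, Γ, _, hd, hf => by
      have hΓ : Γ.Distinct := hd.sublist (List.sublist_append_left _ _)
      have p : (Γ.bind₂ (LTy.tens (A' :: As)) A).Perm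
          (Γ.shift 2 ++ [(0, A)] ++ [(1, LTy.tens (A' :: As))]) := by
        rw [List.append_assoc]
        exact List.perm_append_comm (l₁ := [(0, A), (1, LTy.tens (A' :: As))])
      have h := LTm.unpack_hasTy hB T f (A' :: As) 1 (Γ.shift 2 ++ [(0, A)]) (by simp)
        ((hΓ.bind₂ _ _).of_perm p) (by rw [← hf]; simp [LCtx.shift, Function.comp_def])
      obtain ⟨-, ⟨d⟩⟩ := VTheory.Thm.perm_hasTy hB h p
      have e : (Γ.shift 2 ++ [(0, A)]).map Prod.fst = (Γ.map Prod.fst).map (· + 2) ++ [0] := by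
        simp [LCtx.shift, Function.comp_def]
      rw [e] at d
      exact ⟨hd, ⟨.tensorE (.hyp m _) d (.append _ _)⟩⟩

/-- Unpacking a tuple gives its entries. -/
theorem LTm.unpack_eqv (hB : IsLabelBasis B) {T : VTheory.{w, u, u₂} V B} (f : T.sig.Op)
    {E : LCtx T.sig} : ∀ {As : List (LTy T.sig.G)} {as : LArgs T.sig} {Γ : LCtx T.sig},
      LDerArgs T.sig Γ as As → As ≠ [] → ∀ (m : ℕ) (l : List ℕ) (σ : ℕ → LTm T.sig),
      σ m = as.tuple → HasTy E ((LTm.unpack f As m l).subst σ) (T.sig.cod f) →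
      T.Eqv E ((LTm.unpack f As m l).subst σ) (.op f (as.extend σ l)) (T.sig.cod f)
  | _, _, _, .nil, h => absurd rfl h
  | _, _, _, .snoc .nil e s, _ => by
      intro m l σ hm h
      simp only [LTm.unpack, LTm.subst, LArgs.ofVars_subst, hm] at h ⊢
      exact .refl h
  | _, _, _, .snoc (.snoc (as := as) (v := v) d e' s') (v := w) e s, _ => by
      intro m l σ hm h
      simp only [LTm.unpack, LTm.subst, hm, LArgs.tuple] at h ⊢
      have k := VTheory.Eqv.tensor_beta h
      refine k.trans hB ?_
      have k' := k.right hB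
      rw [LTm.inst₂, LTm.subst_subst] at k' ⊢
      have key := LTm.unpack_eqv hB f (.snoc d e' s') (by simp) 1 _ _ rfl k'
      rwa [LArgs.extend_map _ σ] at key
      intro x
      simp only [upSubst, LTm.rename_rename, LTm.subst_rename]
      exact LTm.subst_var _

end

/-! ### The syntactic model -/

namespace SynCat

open VTheory

variable {V : Type w} [CommMonoid V] [CompleteLattice V] [IsQuantale V] {B : Set V}
  {hB : IsLabelBasis B} {T : VTheory.{w, u, u₂} V B} {hT : VTheory.Varietal.{w, u, u₂, v} T}

/-- The morphism `f` takes the term `u` to the term `u'`. -/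
def Ev {X Y : SynCat.{w, u, u₂, u', v} hB T hT} (f : X ⟶ Y) (u u' : LTm T.sig) : Prop :=
  SynHom.Ev (hT := hT) (A := X.ty) (D := Y.ty) f u u'

namespace Ev

variable {X Y Z X' Y' : SynCat.{w, u, u₂, u', v} hB T hT} {a b c a' b' : LTm T.sig}

theorem id : Ev (𝟙 X) a a := SynHom.Ev.id hB

theorem comp {f : X ⟶ Y} {g : Y ⟶ Z} (hf : Ev f a b) (hg : Ev g b c) : Ev (f ≫ g) a c :=
  SynHom.Ev.comp hB hf hg

theorem tensor {f : X ⟶ X'} {g : Y ⟶ Y'} (hf : Ev f a a') (hg : Ev g b b') :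
    Ev (f ⊗ₘ g) (.pair a b) (.pair a' b') :=
  SynHom.Ev.tensor hB hf hg

theorem whiskerLeft {g : Y ⟶ Y'} (hg : Ev g b b') : Ev (X ◁ g) (.pair a b) (.pair a b') :=
  SynHom.Ev.tensor hB (.id hB) hg

theorem whiskerRight {f : X ⟶ X'} (hf : Ev f a a') : Ev (f ▷ Y) (.pair a b) (.pair a' b) :=
  SynHom.Ev.tensor hB hf (.id hB)

theorem assoc : Ev (α_ X Y Z).hom (.pair (.pair a b) c) (.pair a (.pair b c)) := SynHom.Ev.assoc hB

theorem assocInv : Ev (α_ X Y Z).inv (.pair a (.pair b c)) (.pair (.pair a b) c) :=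
  SynHom.Ev.assocInv hB

theorem leftUnitor : Ev (λ_ X).hom (.pair .star a) a := SynHom.Ev.leftUnitor hB

theorem leftUnitorInv : Ev (λ_ X).inv a (.pair .star a) := SynHom.Ev.leftUnitorInv hB

theorem braiding : Ev (β_ X Y).hom (.pair a b) (.pair b a) := SynHom.Ev.braiding hB

theorem eqToHom (h : X = Y) : Ev (eqToHom h) a a := by
  subst h
  exact id

theorem curry {f : X ⊗ Y ⟶ Z} (hf : Ev f (.pair (.var 0) (a.rename (· + 1))) b) :
    Ev (MonoidalClosed.curry f) a (.lam X.ty b) := by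
  rw [curry_eq]
  exact SynHom.Ev.curry hB hf

theorem ihom_ev : Ev ((ihom.ev X).app Y) (.pair a b) (.app b a) := by
  rw [← MonoidalClosed.uncurry_id_eq_ev, uncurry_eq]
  exact SynHom.Ev.uncurry hB (.id hB)

theorem appHom : Ev (LInterp.appHom X Y) (.pair a b) (.app a b) :=
  braiding.comp ihom_ev

theorem transpose {f : Y ⊗ X ⟶ Z} (hf : Ev f (.pair (a.rename (· + 1)) (.var 0)) b) :
    Ev (LInterp.transpose f) a (.lam X.ty b) :=
  .curry (braiding.comp hf)

/-- A morphism out of `I ⊗ Y` is determined by its value at `*`; the elimination of `c : I` is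
commuted past `f`. -/
theorem letStar {f : 𝟙_ (SynCat.{w, u, u₂, u', v} hB T hT) ⊗ Y ⟶ Z} (hf : Ev f (.pair .star a) b) :
    Ev f (.pair c a) (.letStar c b) := by
  intro Γ h
  obtain ⟨Γ₁, Γ₂, hc, ha, ⟨s⟩⟩ := h.of_pair
  refine (Eqv.of_aut (AutEqn.letStar_subst_const hB T (SynHom.hasTy _) ha hc s h.1)).symm.trans hB
    ((Eqv.refl hc).letStar hB (hf ?_) s h.1)
  obtain ⟨hΓ, ⟨d⟩⟩ := ha
  exact ⟨hΓ, ⟨.tensorI .unitI d (.allRight _)⟩⟩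

/-- A morphism out of `X ⊗ (Y ⊗ Y')` is determined by its value at a pair of variables; the
elimination of `c : Y ⊗ Y'` is commuted past `f`. -/
theorem pm {f : X ⊗ (Y ⊗ Y') ⟶ Z}
    (hf : Ev f (.pair (a.rename (· + 2)) (.pair (.var 1) (.var 0))) b) :
    Ev f (.pair a c) (.pm c b) := by
  intro Γ h
  obtain ⟨Γ₁, Γ₂, ha, hc, ⟨s⟩⟩ := h.of_pair
  refine (Eqv.of_aut (AutEqn.pm_subst_const hB T (SynHom.hasTy _) ha hc s.swap h.1)).symm.trans hB
    ((Eqv.refl hc).pm hB (hf ?_) s.swap h.1)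
  obtain ⟨hΓ, ⟨d⟩⟩ := (((Thm.refl (T := T) ha).rename hB (· + 2) (ha.1.shift 2)).hasTy hB).1
  exact ⟨ha.1.bind₂ _ _, ⟨.tensorI d (.tensorI (.hyp 1 _) (.hyp 0 _) (.right _ (.allLeft _)))
    (.right _ (.right _ (.allLeft _)))⟩⟩

/-- The condition `h` says that the tuple `as` is empty exactly if the list is; `snocIso` is then a
unitor on both sides, or the identity. -/
theorem snocIso_hom {α : Type u} {F : α → SynCat.{w, u, u₂, u', v} hB T hT} {x : α} {l : List α}
    {as : LArgs T.sig} (h : l = [] ↔ as = .nil) :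
    Ev (snocIso F x l).hom (LArgs.tuple (.snoc as a)) (.pair as.tuple a) := by
  match l, as, h with
  | [], .nil, _ => exact leftUnitorInv
  | _ :: _, .snoc _ _, _ => exact id
  | [], .snoc _ _, h => simp at h
  | _ :: _, .nil, h => simp at h

theorem snocIso_inv {α : Type u} {F : α → SynCat.{w, u, u₂, u', v} hB T hT} {x : α} {l : List α}
    {as : LArgs T.sig} (h : l = [] ↔ as = .nil) :
    Ev (snocIso F x l).inv (.pair as.tuple a) (LArgs.tuple (.snoc as a)) := by
  match l, as, h with
  | [], .nil, _ => exact leftUnitor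
  | _ :: _, .snoc _ _, _ => exact id
  | [], .snoc _ _, h => simp at h
  | _ :: _, .nil, h => simp at h

theorem ofVars_eq_nil (Γ : LCtx T.sig) :
    Γ = [] ↔ LArgs.ofVars (S := T.sig) (Γ.map Prod.fst) = .nil := by
  cases Γ <;> simp [LArgs.ofVars]

/-- The shuffle-and-split morphisms split tuples of variables. -/
theorem split {F : ℕ × LTy T.sig.G → SynCat.{w, u, u₂, u', v} hB T hT} :
    ∀ {Γ Δ E : LCtx T.sig} (s : Shuffle Γ Δ E),
      Ev (s.split F) E.tuple (.pair Γ.tuple Δ.tuple)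
  | _, _, _, .nil => leftUnitorInv
  | _, _, _, .left _ s => (snocIso_hom (ofVars_eq_nil _)).comp ((whiskerRight (split s)).comp
      (assoc.comp ((whiskerLeft braiding).comp (assocInv.comp
        (whiskerRight (snocIso_inv (ofVars_eq_nil _)))))))
  | _, _, _, .right _ s => (snocIso_hom (ofVars_eq_nil _)).comp ((whiskerRight (split s)).comp
      (assoc.comp (whiskerLeft (snocIso_inv (ofVars_eq_nil _)))))

end Ev

/-- Types are interpreted by themselves. -/
theorem interp_ty (A : LTy T.sig.G) :
    (A.interp (C := SynCat.{w, u, u₂, u', v} hB T hT) fun X => ⟨.ground X⟩).ty = A := by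
  induction A with
  | ground X => rfl
  | unit => rfl
  | tensor A A' ih ih' => exact congrArg₂ LTy.tensor ih ih'
  | lolli A A' ih ih' => exact congrArg₂ LTy.lolli ih ih'

theorem tens_ty {α : Type u} (F : α → SynCat.{w, u, u₂, u', v} hB T hT) :
    ∀ l : List α, (tens F l).ty = LTy.tens (l.map fun x => (F x).ty)
  | [] => rfl
  | [_] => rfl
  | _ :: b :: l => congrArg (LTy.tensor · _) (tens_ty F (b :: l))

theorem op_hasTy (f : T.sig.Op) :
    HasTy [(0, (tens (LTy.interp fun X => (⟨.ground X⟩ : SynCat.{w, u, u₂, u', v} hB T hT))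
      (T.sig.dom f)).ty)] (LTm.unpack f (T.sig.dom f) 0 []) ((T.sig.cod f).interp fun X =>
        (⟨.ground X⟩ : SynCat.{w, u, u₂, u', v} hB T hT)).ty := by
  have h := LTm.unpack_hasTy hB T f (T.sig.dom f) 0 [] (T.sig.dom_ne_nil f)
    (List.nodup_singleton _) rfl
  rw [tens_ty, interp_ty]
  simp only [interp_ty, List.map_id']
  exact h

variable (hB T hT) in
/-- The interpretation of the signature in the syntactic category. -/
noncomputable def model : LInterp T.sig (SynCat.{w, u, u₂, u', v} hB T hT) where
  ground X := ⟨.ground X⟩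
  op f := SynHom.mk hT (LTm.unpack f (T.sig.dom f) 0 []) (op_hasTy f)

theorem model_ty (A : LTy T.sig.G) : ((model.{w, u, u₂, u', v} hB T hT).ty A).ty = A := interp_ty A

/-- The tuple of the variables of a context is generic. -/
theorem pat_tuple : ∀ Γ : LCtx T.sig,
    Pat Γ Γ.tuple ((model.{w, u, u₂, u', v} hB T hT).ctx Γ).ty
  | [] => .star
  | [(x, A)] => Eq.mpr (congrArg (Pat [(x, A)] (.var x)) (model_ty A)) (.var x A)
  | (x, A) :: p :: Γ => (pat_tuple (p :: Γ)).pair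
      (Eq.mpr (congrArg (Pat [(x, A)] (.var x)) (model_ty A)) (.var x A))
      (.right (x, A) (.allLeft _))

theorem ev_op (f : T.sig.Op) {as : LArgs T.sig} {Γ : LCtx T.sig}
    (d : LDerArgs T.sig Γ as (T.sig.dom f)) :
    Ev ((model.{w, u, u₂, u', v} hB T hT).op f) as.tuple (.op f as) := by
  intro Γ h
  have k := SynHom.mk_act (hT := hT) hB (op_hasTy f) h
  refine k.trans hB ?_
  have h' := k.right hB
  rw [interp_ty] at h'
  exact Eq.mpr (congrArg (T.Eqv Γ _ _) (interp_ty _))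
    (LTm.unpack_eqv hB f d (T.sig.dom_ne_nil f) 0 [] (fun _ => as.tuple) rfl h')

theorem ev_join₁ (Γ : LCtx T.sig) (A : LTy T.sig.G) :
    Ev ((model.{w, u, u₂, u', v} hB T hT).join₁ Γ A)
      (.pair (Γ.tuple.rename (· + 1)) (.var 0)) (LCtx.bind Γ A).tuple := by
  rw [← LCtx.tuple_shift]
  exact (Ev.whiskerRight (Ev.eqToHom _)).comp (Ev.snocIso_inv (Ev.ofVars_eq_nil _))

theorem ev_join₂ (Γ : LCtx T.sig) (A A' : LTy T.sig.G) :
    Ev ((model.{w, u, u₂, u', v} hB T hT).join₂ Γ A A')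
      (.pair (.pair (Γ.tuple.rename (· + 2)) (.var 1)) (.var 0)) (LCtx.bind₂ Γ A A').tuple := by
  rw [← LCtx.tuple_shift]
  exact (Ev.whiskerRight ((Ev.whiskerRight (Ev.eqToHom _)).comp
    (Ev.snocIso_inv (Ev.ofVars_eq_nil _)))).comp
      (Ev.snocIso_inv (Ev.ofVars_eq_nil ((1, A) :: Γ.shift 2)))

theorem _root_.LDerArgs.nil_iff {S : LSig.{u, u₂}} {Γ : LCtx S} {as : LArgs S}
    {As : List (LTy S.G)} (d : LDerArgs S Γ as As) : As = [] ↔ as = .nil := by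
  cases d <;> simp

mutual
/-- The interpretation of a judgement in the syntactic model is the judgement itself. -/
theorem ev_den : ∀ {Γ : LCtx T.sig} {v : LTm T.sig} {A : LTy T.sig.G} (d : LDer T.sig Γ v A),
    Ev ((model.{w, u, u₂, u', v} hB T hT).den d) Γ.tuple v
  | _, _, _, .ax f d => (ev_denArgs d).comp (ev_op f d)
  | _, _, _, .hyp _ _ => .id
  | _, _, _, .unitI => .id
  | _, _, _, .unitE d e s => (Ev.split s).comp ((Ev.whiskerRight (ev_den d)).comp
      (.letStar (Ev.leftUnitor.comp (ev_den e))))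
  | _, _, _, .tensorI d e s => (Ev.split s).comp ((ev_den d).tensor (ev_den e))
  | _, _, _, .tensorE d e s => (Ev.split s).comp ((Ev.whiskerRight (ev_den d)).comp
      (Ev.braiding.comp (.pm (Ev.assocInv.comp ((ev_join₂ _ _ _).comp (ev_den e))))))
  | _, _, _, .lolliI (A := A) d => by
      have h := Ev.transpose ((ev_join₁ _ _).comp (ev_den d))
      rw [model_ty] at h
      exact h
  | _, _, _, .lolliE d e s => (Ev.split s).comp (((ev_den d).tensor (ev_den e)).comp .appHom)
theorem ev_denArgs : ∀ {Γ : LCtx T.sig} {as : LArgs T.sig} {As : List (LTy T.sig.G)}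
    (d : LDerArgs T.sig Γ as As),
    Ev ((model.{w, u, u₂, u', v} hB T hT).denArgs d) Γ.tuple as.tuple
  | _, _, _, .nil => .id
  | _, _, _, .snoc d e s => (Ev.split s).comp (((ev_denArgs d).tensor (ev_den e)).comp
      (.snocIso_inv d.nil_iff))
end

/-- The labels of `B` below the distance of two denotations in the syntactic model are exactly the
provable ones. -/
theorem le_dist_den_iff {Γ : LCtx T.sig} {v w : LTm T.sig} {A : LTy T.sig.G} {q : V}
    (hΓ : Γ.Distinct) (hq : q ∈ B) (d : LDer T.sig Γ v A) (d' : LDer T.sig Γ w A) :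
    q ≤ VCatSepEnriched.dist ((model.{w, u, u₂, u', v} hB T hT).den d)
      ((model.{w, u, u₂, u', v} hB T hT).den d') ↔ T.Thm Γ v w q A := by
  have hp := pat_tuple.{w, u, u₂, u', v} (hB := hB) (T := T) (hT := hT) Γ
  have ht := hp.hasTy hΓ
  constructor
  · intro h
    have k := SynHom.act_thm hB (SynHom.thm_of_le_dist hq h) ht
    have := (ev_den d ht).thm hB (ev_den d' ht) k
    rwa [model_ty] at this
  · intro h
    refine SynHom.le_dist_of_ev hB hp hΓ (ev_den d) (ev_den d') ?_
    rwa [model_ty]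

end SynCat

theorem theorem3 {V : Type w} [CommMonoid V] [CompleteLattice V] [IsQuantale V]
    {B : Set V} (hB : IsLabelBasis B)
    (T : VTheory.{w, u, u₂} V B) (hT : VTheory.Varietal.{w, u, u₂, v} T)
    (e : VEqn V T.sig) (he : e.WellFormed B) :
    T.Thm e.ctx e.lhs e.rhs e.label e.ty ↔
      ∀ (C : Type (max u u')) [Category.{v} C] [MonoidalCategory C] [SymmetricCategory C]
        [MonoidalClosed C] [VCatSepAutonomous V C] (M : LInterp T.sig C),
        T.IsModel M → M.Satisfies e := by
  constructor
  · intro h C _ _ _ _ _ M hM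
    exact h.satisfies hB M hM
  · intro h
    obtain ⟨hq, ⟨hΓ, ⟨d⟩⟩, ⟨-, ⟨d'⟩⟩⟩ := he
    refine (SynCat.le_dist_den_iff hΓ hq d d').1 (h (SynCat.{w, u, u₂, u', v} hB T hT)
      (SynCat.model hB T hT) (fun a ha d d' => ?_) d d')
    obtain ⟨hq, ⟨hΓ, -⟩, -⟩ := T.wellFormed a ha
    exact (SynCat.le_dist_den_iff hΓ hq d d').2 (.axiom_mem ha)
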